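/- Let $a>0$ and $x_0\in\mathbb{R}$, let $V(\phi)=2\phi^2(\phi-\tanh a)(\phi-\coth a)$, and consider the Klein--Gordon equation $\phi_{tt}-\phi_{xx}+V'(\phi)=0$ on the real line with its ground state lump $$\phi(x)=\frac{\sinh(2a)}{\cosh(2a)+\cosh(2(x-x_0))}.$$ Let $U(x)=V''(\phi(x))$ and let $H=-\partial_x^2+U(x)$ be the linearization operator about the lump, acting on $L^2(\mathbb{R};\mathbb{C})$ with domain $H^2(\mathbb{R})$. Then: 1. The continuous spectrum of $H$ (the points $\lambda$ of the spectrum for which $H-\lambda$ is injective with dense range) is $[4,\infty)$. The essential spectrum of $H$ (the complement, in the spectrum, of the discrete spectrum, that is, of the isolated points of the spectrum that are eigenvalues of finite multiplicity) is also $[4,\infty)$. 2. $\phi'$ is an eigenfunction of $H$ with eigenvalue $0$ (a zero mode), and it has exactly one node, at $x=x_0$. 3. The spectrum of $H$ is real and has a least element $\lambda_{-1}$, which is negative and belongs to the discrete spectrum. It has a real eigenfunction $\eta_{-1}$ of class $C^2$, with $\eta_{-1},\eta_{-1}'\in L^2(\mathbb{R})$, that has no zeros and is even about $x_0$, i.e.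 $\eta_{-1}(x_0-s)=\eta_{-1}(x_0+s)$ for all $s$. The function $w(t,x)=e^{\sqrt{|\lambda_{-1}|}\,t}\,\eta_{-1}(x)$ solves the linearized equation $w_{tt}-w_{xx}+U(x)w=0$. 4. Consequently the lump is linearly unstable: the linearized equation has a growing mode $e^{\kappa t}\eta(x)$ with $\kappa>0$, $0\ne\eta\in C^2$ and $\eta,\eta'\in L^2(\mathbb{R})$. Moreover the lump is a sphaleron over the false vacuum $0$: it is a static solution ($\phi''=V'(\phi)$), its energy density $\tfrac12\phi'^2+V(\phi)$ is integrable, it is non-constant with $\phi(x)\to0$ as $x\to\pm\infty$, where $0$ is a local but not global minimum of $V$, and it is linearly unstable. -/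

import Mathlib

open MeasureTheory Set Filter Topology
open scoped ContDiff

noncomputable section

namespace Sphaleron

/-! Spectra of unbounded operators -/

section Spectra

variable {E : Type*} [NormedAddCommGroup E] [NormedSpace ℂ E]

/-- The operator `T - z` on the domain of `T`. -/
def shift (T : E →ₗ.[ℂ] E) (z : ℂ) : T.domain →ₗ[ℂ] E :=
  T.toFun - z • T.domain.subtype

/-- The resolvent set: `T - z` is a bijection from the domain of `T` onto `E`
with a bounded inverse `R`. -/
def resolventSet (T : E →ₗ.[ℂ] E) : Set ℂ :=
  {z | ∃ R : E →L[ℂ] E,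
    (∀ y : E, ∃ x : T.domain, (x : E) = R y ∧ shift T z x = y) ∧
    ∀ x : T.domain, R (shift T z x) = x}

/-- The spectrum of an unbounded operator. -/
def spectrum (T : E →ₗ.[ℂ] E) : Set ℂ := (resolventSet T)ᶜ

/-- The continuous spectrum: the points `z` of the spectrum for which `T - z` is injective
with dense range. -/
def continuousSpectrum (T : E →ₗ.[ℂ] E) : Set ℂ :=
  {z | z ∈ spectrum T ∧ Function.Injective (shift T z) ∧ DenseRange (shift T z)}

/-- The discrete spectrum (of a self-adjoint operator): the isolated points of the spectrum that
are eigenvalues of finite multiplicity. -/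
def discreteSpectrum (T : E →ₗ.[ℂ] E) : Set ℂ :=
  {z | z ∈ spectrum T ∧ (∃ ε > 0, spectrum T ∩ Metric.ball z ε ⊆ {z}) ∧
    LinearMap.ker (shift T z) ≠ ⊥ ∧ FiniteDimensional ℂ (LinearMap.ker (shift T z))}

/-- The essential spectrum (of a self-adjoint operator): the complement of the discrete spectrum
in the spectrum. -/
def essentialSpectrum (T : E →ₗ.[ℂ] E) : Set ℂ := spectrum T \ discreteSpectrum T

end Spectra

/-! Schrödinger operators on the line -/

/-- The Hilbert space `L²(ℝ; ℂ)`. -/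
abbrev L2 : Type := Lp ℂ 2 (volume : Measure ℝ)

/-- `g` is the weak derivative of `f`. -/
def IsWeakDeriv (f g : L2) : Prop :=
  ∀ ψ : ℝ → ℝ, ContDiff ℝ ∞ ψ → HasCompactSupport ψ →
    ∫ x, deriv ψ x • f x = - ∫ x, ψ x • g x

theorem integrable_test_smul (f : L2) {ψ : ℝ → ℝ} (h : Continuous ψ) (hc : HasCompactSupport ψ) :
    Integrable (fun x => ψ x • f x) :=
  ((Lp.memLp f).locallyIntegrable (by norm_num)).integrable_smul_left_of_hasCompactSupport h hc

theorem integrable_deriv_test_smul (f : L2) {ψ : ℝ → ℝ} (h : ContDiff ℝ ∞ ψ)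
    (hc : HasCompactSupport ψ) : Integrable (fun x => deriv ψ x • f x) :=
  integrable_test_smul f (h.continuous_deriv (by simp)) hc.deriv

theorem integral_smul_add (f f' : L2) {ψ : ℝ → ℝ} (h : Continuous ψ) (hc : HasCompactSupport ψ) :
    ∫ x, ψ x • (f + f' : L2) x = (∫ x, ψ x • f x) + ∫ x, ψ x • f' x := by
  rw [← integral_add (integrable_test_smul f h hc) (integrable_test_smul f' h hc)]
  refine integral_congr_ae ?_
  filter_upwards [Lp.coeFn_add f f'] with x hx
  rw [hx, Pi.add_apply, smul_add]

theorem integral_smul_const_smul (c : ℂ) (f : L2) (ψ : ℝ → ℝ) :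
    ∫ x, ψ x • (c • f : L2) x = c * ∫ x, ψ x • f x := by
  rw [← integral_const_mul]
  refine integral_congr_ae ?_
  filter_upwards [Lp.coeFn_smul c f] with x hx
  rw [hx, Pi.smul_apply, smul_comm, smul_eq_mul]

theorem IsWeakDeriv.add {f g f' g' : L2} (h : IsWeakDeriv f g) (h' : IsWeakDeriv f' g') :
    IsWeakDeriv (f + f') (g + g') := by
  intro ψ hψ hc
  rw [integral_smul_add f f' (hψ.continuous_deriv (by simp)) hc.deriv,
    integral_smul_add g g' hψ.continuous hc, h ψ hψ hc, h' ψ hψ hc]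
  ring

theorem IsWeakDeriv.const_smul (c : ℂ) {f g : L2} (h : IsWeakDeriv f g) :
    IsWeakDeriv (c • f) (c • g) := by
  intro ψ hψ hc
  rw [integral_smul_const_smul, integral_smul_const_smul, h ψ hψ hc]
  ring

theorem isWeakDeriv_zero : IsWeakDeriv 0 0 := by
  intro ψ _ _
  simp

theorem IsWeakDeriv.eq_zero {g : L2} (h : IsWeakDeriv 0 g) : g = 0 := by
  have key : ∀ᵐ x, g x = 0 := by
    refine ae_eq_zero_of_integral_contDiff_smul_eq_zero
      ((Lp.memLp g).locallyIntegrable (by norm_num)) ?_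
    intro ψ hψ hc
    have := h ψ hψ hc
    rw [integral_eq_zero_of_ae] at this
    · simpa using this
    · exact Eventually.of_forall fun x => by simp
  rw [Lp.eq_zero_iff_ae_eq_zero]
  exact key

/-- The graph of `-∂ₓ² + U` on `L²(ℝ; ℂ)`: the pairs `(f, k)` for which `f` has weak derivatives
`f' = g` and `f'' = h` in `L²` (that is, `f ∈ H²(ℝ)`) and `k = -f'' + U f` lies in `L²`. -/
def schrodingerGraph (U : ℝ → ℝ) : Submodule ℂ (L2 × L2) where
  carrier := {p | ∃ g h : L2, IsWeakDeriv p.1 g ∧ IsWeakDeriv g h ∧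
    ∀ᵐ x, p.2 x = - h x + (U x : ℂ) * p.1 x}
  zero_mem' := by
    refine ⟨0, 0, isWeakDeriv_zero, isWeakDeriv_zero, ?_⟩
    exact Eventually.of_forall fun x => by simp
  add_mem' := by
    rintro p q ⟨g, h, hg, hh, hp⟩ ⟨g', h', hg', hh', hq⟩
    refine ⟨g + g', h + h', hg.add hg', hh.add hh', ?_⟩
    filter_upwards [hp, hq, Lp.coeFn_add p.1 q.1, Lp.coeFn_add p.2 q.2, Lp.coeFn_add h h']
      with x h1 h2 h3 h4 h5
    rw [Prod.snd_add, Prod.fst_add, h3, h4, h5]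
    simp only [Pi.add_apply, h1, h2]
    ring
  smul_mem' := by
    rintro c p ⟨g, h, hg, hh, hp⟩
    refine ⟨c • g, c • h, hg.const_smul c, hh.const_smul c, ?_⟩
    filter_upwards [hp, Lp.coeFn_smul c p.1, Lp.coeFn_smul c p.2, Lp.coeFn_smul c h]
      with x h1 h3 h4 h5
    rw [Prod.smul_snd, Prod.smul_fst, h3, h4, h5]
    simp only [Pi.smul_apply, smul_eq_mul, h1]
    ring

theorem schrodingerGraph_single_valued (U : ℝ → ℝ) :
    ∀ p ∈ schrodingerGraph U, p.1 = 0 → p.2 = 0 := by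
  rintro p ⟨g, h, hg, hh, hp⟩ h1
  rw [h1] at hg
  have e1 : g = 0 := hg.eq_zero
  rw [e1] at hh
  have e2 : h = 0 := hh.eq_zero
  rw [Lp.eq_zero_iff_ae_eq_zero]
  have h0 := Lp.coeFn_zero ℂ 2 (volume : Measure ℝ)
  filter_upwards [hp, h0] with x hx hx0
  rw [hx, h1, e2, hx0]
  simp

/-- The Schrödinger operator `-∂ₓ² + U` on `L²(ℝ; ℂ)`, with domain
`{f ∈ H²(ℝ) | U f ∈ L²}`, which is `H²(ℝ)` when `U` is bounded and measurable. -/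
def schrodinger (U : ℝ → ℝ) : L2 →ₗ.[ℂ] L2 := (schrodingerGraph U).toLinearPMap

theorem schrodinger_graph (U : ℝ → ℝ) : (schrodinger U).graph = schrodingerGraph U :=
  Submodule.toLinearPMap_graph_eq _ (schrodingerGraph_single_valued U)

/-- The real function `η` represents an eigenfunction of `T` with eigenvalue `μ`. -/
def IsEigenfunction (T : L2 →ₗ.[ℂ] L2) (μ : ℝ) (η : ℝ → ℝ) : Prop :=
  ∃ f : T.domain, (f : L2) ≠ 0 ∧ (∀ᵐ x, (f : L2) x = (η x : ℂ)) ∧ T f = (μ : ℂ) • (f : L2)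

/-! Klein–Gordon models `φ_tt - φ_xx + V'(φ) = 0` -/

/-- The potential `U(x) = V''(φ(x))` of the linearization about a static solution `φ`. -/
def perturbationPotential (V φ : ℝ → ℝ) (x : ℝ) : ℝ := deriv (deriv V) (φ x)

/-- `φ` is a static solution: `φ'' = V'(φ)`. -/
def IsStaticSolution (V φ : ℝ → ℝ) : Prop :=
  ContDiff ℝ 2 φ ∧ ∀ x, deriv (deriv φ) x = deriv V (φ x)

/-- The energy `∫ (φ'² / 2 + V(φ)) dx` of a static field is finite. -/
def HasFiniteEnergy (V φ : ℝ → ℝ) : Prop :=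
  Integrable (fun x => (1 / 2) * deriv φ x ^ 2 + V (φ x))

/-- A false vacuum: a local minimum of `V` that is not a global minimum. -/
def IsFalseVacuum (V : ℝ → ℝ) (c : ℝ) : Prop := IsLocalMin V c ∧ ∃ d, V d < V c

/-- A localized profile: a non-constant field that tends to `c` at both ends of the line. -/
def IsLocalized (φ : ℝ → ℝ) (c : ℝ) : Prop :=
  (∃ x, φ x ≠ c) ∧ Tendsto φ atBot (𝓝 c) ∧ Tendsto φ atTop (𝓝 c)

/-- `w(t, x) = exp(κ t) η(x)`, with `κ > 0` and `η ≠ 0` of class `C²` with `η, η' ∈ L²`,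
solves the linearized equation `w_tt - w_xx + V''(φ) w = 0`. -/
def IsGrowingMode (V φ : ℝ → ℝ) (κ : ℝ) (η : ℝ → ℝ) : Prop :=
  0 < κ ∧ η ≠ 0 ∧ ContDiff ℝ 2 η ∧ MemLp η 2 ∧ MemLp (deriv η) 2 ∧
  ∀ t x : ℝ,
    deriv (deriv (fun s => Real.exp (κ * s) * η x)) t
      - deriv (deriv (fun y => Real.exp (κ * t) * η y)) x
      + perturbationPotential V φ x * (Real.exp (κ * t) * η x) = 0

/-- Linear instability: an exponentially growing mode exists. -/
def IsLinearlyUnstable (V φ : ℝ → ℝ) : Prop := ∃ κ η, IsGrowingMode V φ κ η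

/-- A sphaleron: a static solution of finite energy with a profile localized over a false vacuum
`c`, which is linearly unstable. -/
structure IsSphaleron (V φ : ℝ → ℝ) (c : ℝ) : Prop where
  static : IsStaticSolution V φ
  falseVacuum : IsFalseVacuum V c
  localized : IsLocalized φ c
  finiteEnergy : HasFiniteEnergy V φ
  unstable : IsLinearlyUnstable V φ

/-- The quartic potential `V(φ) = 2 φ² (φ - tanh a) (φ - coth a)`. -/
def quarticPotential (a u : ℝ) : ℝ :=
  2 * u ^ 2 * (u - Real.tanh a) * (u - Real.cosh a / Real.sinh a)

/-- The ground state lump `φ(x) = sinh 2a / (cosh 2a + cosh 2(x - x₀))`. -/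
def lump (a x₀ x : ℝ) : ℝ :=
  Real.sinh (2 * a) / (Real.cosh (2 * a) + Real.cosh (2 * (x - x₀)))

/-- The linearization operator `-∂ₓ² + V''(φ(x))` about the lump. -/
def lumpOperator (a x₀ : ℝ) : L2 →ₗ.[ℂ] L2 :=
  schrodinger (perturbationPotential (quarticPotential a) (lump a x₀))

end Sphaleron

end

noncomputable section

namespace Sphaleron

/-!
For bounded square integrable `W`, multiplication by `W` is compact after the free resolvent, whose
kernel is explicit. By the Fredholm alternative every point of the spectrum of `-∂² + c + W` off
`[c, ∞)` is then an isolated eigenvalue of finite multiplicity. Every `r ≥ c` lies in the spectrum,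
by a Weyl sequence of wave packets, and is not an eigenvalue when `W` is short range, because a
square integrable solution of the differential equation vanishes near `+∞`, hence everywhere.

For `W ≤ 0` and `μ` far below the spectrum the resolvent at `μ` preserves positivity. Its norm is
`(l - μ)⁻¹` with `l` the bottom of the spectrum, so with an eigenfunction `u` for `l` also `|u|` is
one, and `|u|` has no zeros by uniqueness for the initial value problem. The zero mode `φ'` of the
lump has a node, so it cannot belong to the bottom of the spectrum, which is therefore negative and
gives a growing mode.
-/

/-! ### Weak derivatives on the line -/

section Primitive

variable {E : Type*} [NormedAddCommGroup E]

theorem intervalIntegrable_of_locallyIntegrable {g : ℝ → E} (hg : LocallyIntegrable g) (a b : ℝ) :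
    IntervalIntegrable g volume a b :=
  (hg.integrableOn_isCompact isCompact_uIcc).intervalIntegrable

variable [NormedSpace ℝ E]

/-- `G` is a primitive of `g` on the line: the absolutely continuous functions are the primitives
of the locally integrable ones. -/
def IsPrimitive (G g : ℝ → E) : Prop := ∀ x y, G y - G x = ∫ t in x..y, g t

theorem IsPrimitive.congr_ae {G g g' : ℝ → E} (hG : IsPrimitive G g) (h : g =ᵐ[volume] g') :
    IsPrimitive G g' := fun x y => by
  rw [hG, intervalIntegral.integral_congr_ae (h.mono fun t ht _ => ht)]

theorem isPrimitive_integral {g : ℝ → E} (hg : LocallyIntegrable g) :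
    IsPrimitive (fun y => ∫ t in (0 : ℝ)..y, g t) g := fun x y =>
  intervalIntegral.integral_interval_sub_left (intervalIntegrable_of_locallyIntegrable hg 0 y)
    (intervalIntegrable_of_locallyIntegrable hg 0 x)

theorem IsPrimitive.continuous {g G : ℝ → E} (hG : IsPrimitive G g) (hg : LocallyIntegrable g) :
    Continuous G := by
  have hG0 : G = fun y => G 0 + ∫ t in (0 : ℝ)..y, g t := by
    ext y
    rw [← hG, add_sub_cancel]
  rw [hG0]
  exact continuous_const.add
    (intervalIntegral.continuous_primitive (intervalIntegrable_of_locallyIntegrable hg) 0)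

variable [CompleteSpace E]

theorem IsPrimitive.hasDerivAt {G g : ℝ → E} (hG : IsPrimitive G g) (hg : Continuous g) (x : ℝ) :
    HasDerivAt G (g x) x := by
  have hG0 : G = fun y => G 0 + ∫ t in (0 : ℝ)..y, g t := by
    ext y
    rw [← hG, add_sub_cancel]
  rw [hG0]
  exact (intervalIntegral.integral_hasDerivAt_right (hg.intervalIntegrable _ _)
    (hg.stronglyMeasurableAtFilter _ _) hg.continuousAt).const_add _

theorem isPrimitive_of_hasDerivAt {G g : ℝ → E} (hG : ∀ x, HasDerivAt G (g x) x)
    (hg : Continuous g) : IsPrimitive G g := fun x y =>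
  (intervalIntegral.integral_eq_sub_of_hasDerivAt (fun t _ => hG t)
    (hg.intervalIntegrable x y)).symm

/-- Both sides are the integral of `ψ'(x) g(t)` over the half-plane `t < x`. -/
theorem integral_deriv_smul_integral_Iio {ψ : ℝ → ℝ} {g : ℝ → E} (hψ : ContDiff ℝ 1 ψ)
    (hc : HasCompactSupport ψ) (hg : Integrable g) :
    ∫ x, deriv ψ x • ∫ t in Iio x, g t = - ∫ t, ψ t • g t := by
  have hψ' : Integrable (deriv ψ) :=
    (hψ.continuous_deriv le_rfl).integrable_of_hasCompactSupport hc.deriv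
  have hint : Integrable (Function.uncurry fun x t : ℝ =>
      (Iio x).indicator (fun t => deriv ψ x • g t) t) (volume.prod volume) :=
    (hψ'.smul_prod hg).indicator (s := {p : ℝ × ℝ | p.2 < p.1})
      (measurableSet_lt measurable_snd measurable_fst)
  have hswap := integral_integral_swap hint
  have inner_t : ∀ x, ∫ t, (Iio x).indicator (fun t => deriv ψ x • g t) t
      = deriv ψ x • ∫ t in Iio x, g t := fun x => by
    rw [integral_indicator measurableSet_Iio, integral_smul]
  have inner_x : ∀ t, ∫ x, (Iio x).indicator (fun t => deriv ψ x • g t) t = -(ψ t • g t) :=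
    fun t => by
      have hflip : ∀ x, (Iio x).indicator (fun t => deriv ψ x • g t) t
          = (Ioi t).indicator (fun x => deriv ψ x • g t) x := fun x => by
        simp [indicator]
      simp_rw [hflip]
      rw [integral_indicator measurableSet_Ioi, integral_smul_const,
        hc.integral_Ioi_deriv_eq hψ, neg_smul]
  simpa only [inner_t, inner_x, integral_neg] using hswap

theorem integral_deriv_eq_zero_of_hasCompactSupport {ψ : ℝ → ℝ} (hψ : ContDiff ℝ 1 ψ)
    (hc : HasCompactSupport ψ) : ∫ x, deriv ψ x = 0 :=
  integral_eq_zero_of_hasDerivAt_of_integrable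
    (fun x => (hψ.differentiable one_ne_zero x).hasDerivAt)
    ((hψ.continuous_deriv le_rfl).integrable_of_hasCompactSupport hc.deriv)
    (hψ.continuous.integrable_of_hasCompactSupport hc)

theorem IsPrimitive.integral_deriv_smul {ψ : ℝ → ℝ} {g G : ℝ → E} (hG : IsPrimitive G g)
    (hg : LocallyIntegrable g) (hψ : ContDiff ℝ 1 ψ) (hc : HasCompactSupport ψ) :
    ∫ x, deriv ψ x • G x = - ∫ x, ψ x • g x := by
  obtain ⟨R, -, hR⟩ := hc.exists_pos_le_norm
  obtain ⟨R', -, hR'⟩ := hc.deriv.exists_pos_le_norm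
  set S := max R R'
  set g₀ := (Ioo (-S) S).indicator g with hg₀
  have hg₀i : Integrable g₀ := (integrable_indicator_iff measurableSet_Ioo).2
    ((hg.integrableOn_isCompact isCompact_Icc).mono_set Ioo_subset_Icc_self)
  have hout : ∀ x ∉ Ioo (-S) S, S ≤ ‖x‖ := fun x hx => by
    rw [Real.norm_eq_abs]
    by_contra! h
    exact hx (abs_lt.1 h)
  have hprim : ∀ x, deriv ψ x • G x
      = deriv ψ x • (∫ t in Iio x, g₀ t) + deriv ψ x • G (-S) := fun x => by
    by_cases hx : x ∈ Ioo (-S) S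
    · have hset : Iio x ∩ Ioo (-S) S = Ioo (-S) x := by
        rw [Iio_inter_Ioo, min_eq_left hx.2.le]
      rw [hg₀, setIntegral_indicator measurableSet_Ioo, hset, ← integral_Ioc_eq_integral_Ioo,
        ← intervalIntegral.integral_of_le hx.1.le, ← hG, ← smul_add, sub_add_cancel]
    · simp [hR' x ((le_max_right _ _).trans (hout x hx))]
  have htest : ∀ x, ψ x • g₀ x = ψ x • g x := fun x => by
    by_cases hx : x ∈ Ioo (-S) S
    · simp [hg₀, hx]
    · simp [hR x ((le_max_left _ _).trans (hout x hx))]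
  have hψ' := hψ.continuous_deriv le_rfl
  have hconst : Integrable fun x => deriv ψ x • G (-S) :=
    (hψ'.integrable_of_hasCompactSupport hc.deriv).smul_const _
  have hprod : Integrable fun x => deriv ψ x • G x :=
    (hψ'.smul (hG.continuous hg)).integrable_of_hasCompactSupport hc.deriv.smul_right
  have hIio : Integrable fun x => deriv ψ x • ∫ t in Iio x, g₀ t :=
    (hprod.sub hconst).congr (Eventually.of_forall fun x => by simp [hprim x])
  simp_rw [hprim]
  rw [integral_add hIio hconst, integral_deriv_smul_integral_Iio hψ hc hg₀i, integral_smul_const,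
    integral_deriv_eq_zero_of_hasCompactSupport hψ hc, zero_smul, add_zero]
  simp_rw [htest]

theorem exists_hasCompactSupport_deriv_eq {q : ℝ → ℝ} (hq : ContDiff ℝ ∞ q)
    (hc : HasCompactSupport q) (h0 : ∫ x, q x = 0) :
    ∃ ψ : ℝ → ℝ, ContDiff ℝ ∞ ψ ∧ HasCompactSupport ψ ∧ deriv ψ = q := by
  have hqi : Integrable q := hq.continuous.integrable_of_hasCompactSupport hc
  obtain ⟨R, -, hR⟩ := hc.exists_pos_le_norm
  set ψ : ℝ → ℝ := fun x => ∫ t in Iic x, q t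
  have hprim : IsPrimitive ψ q := fun x y =>
    intervalIntegral.integral_Iic_sub_Iic hqi.integrableOn hqi.integrableOn
  have hderiv : deriv ψ = q := funext fun x => (hprim.hasDerivAt hq.continuous x).deriv
  refine ⟨ψ, contDiff_infty_iff_deriv.2
    ⟨fun x => (hprim.hasDerivAt hq.continuous x).differentiableAt, hderiv ▸ hq⟩,
    HasCompactSupport.intro (isCompact_Icc (a := -R) (b := R)) fun x hx => ?_, hderiv⟩
  rcases lt_or_ge x (-R) with hx' | hx'
  · exact setIntegral_eq_zero_of_forall_eq_zero fun t ht =>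
      hR t (le_abs.2 (Or.inr (by linarith [mem_Iic.1 ht])))
  · have hRx : R < x := not_le.1 fun h => hx ⟨hx', h⟩
    have htail : ∫ t in (Iic x)ᶜ, q t = 0 :=
      setIntegral_eq_zero_of_forall_eq_zero fun t ht =>
        hR t (le_abs.2 (Or.inl (hRx.trans (not_le.1 ht)).le))
    simpa only [htail, h0, add_zero] using integral_add_compl (measurableSet_Iic (a := x)) hqi

/-- A test function `θ` differs from `(∫ θ) ρ`, for a fixed bump `ρ` of mass one, by the derivative
of a test function, so that `h` acts on `θ` as the constant `∫ ρ h`. -/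
theorem exists_ae_eq_const_of_integral_deriv_smul_eq_zero {h : ℝ → E} (hh : LocallyIntegrable h)
    (h0 : ∀ ψ : ℝ → ℝ, ContDiff ℝ ∞ ψ → HasCompactSupport ψ → ∫ x, deriv ψ x • h x = 0) :
    ∃ c : E, ∀ᵐ x, h x = c := by
  let b : ContDiffBump (0 : ℝ) := ⟨1, 2, by norm_num, by norm_num⟩
  let ρ : ℝ → ℝ := b.normed volume
  have hρ : ContDiff ℝ ∞ ρ := b.contDiff_normed
  have hρc : HasCompactSupport ρ := b.hasCompactSupport_normed
  have hρi : Integrable ρ := hρ.continuous.integrable_of_hasCompactSupport hρc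
  have hρh : Integrable fun x => ρ x • h x :=
    hh.integrable_smul_left_of_hasCompactSupport hρ.continuous hρc
  set c := ∫ x, ρ x • h x with hcdef
  refine ⟨c, ?_⟩
  suffices ∀ᵐ x, h x - c = 0 from this.mono fun x hx => sub_eq_zero.1 hx
  refine ae_eq_zero_of_integral_contDiff_smul_eq_zero (hh.sub (locallyIntegrable_const c))
    fun θ hθ hθc => ?_
  have hθi := hθ.continuous.integrable_of_hasCompactSupport hθc (μ := volume)
  have hθh : Integrable fun x => θ x • h x :=
    hh.integrable_smul_left_of_hasCompactSupport hθ.continuous hθc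
  set I := ∫ x, θ x with hI
  have hmean : ∫ x, (θ x - I * ρ x) = 0 := by
    rw [integral_sub hθi (hρi.const_mul I), integral_const_mul, b.integral_normed, ← hI, mul_one,
      sub_self]
  obtain ⟨ψ, hψ, hψc, hψ'⟩ := exists_hasCompactSupport_deriv_eq
    (hθ.sub (contDiff_const.mul hρ)) (hθc.sub hρc.mul_left) hmean
  have hact := h0 ψ hψ hψc
  simp only [hψ', sub_smul, mul_smul] at hact
  rw [integral_sub hθh (hρh.fun_smul I), integral_smul, ← hcdef] at hact
  simp_rw [smul_sub]
  rw [integral_sub hθh (hθi.smul_const c), integral_smul_const, ← hI, hact]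

end Primitive

theorem locallyIntegrable_coeFn (f : L2) : LocallyIntegrable f :=
  (Lp.memLp f).locallyIntegrable (by norm_num)

theorem IsWeakDeriv.sub {f g f' g' : L2} (h : IsWeakDeriv f g) (h' : IsWeakDeriv f' g') :
    IsWeakDeriv (f - f') (g - g') := by
  simpa [sub_eq_add_neg] using h.add (h'.const_smul (-1))

theorem IsPrimitive.isWeakDeriv {f g : L2} {F : ℝ → ℂ} (hF : IsPrimitive F g)
    (hf : f =ᵐ[volume] F) : IsWeakDeriv f g := fun ψ hψ hc => by
  rw [← hF.integral_deriv_smul (locallyIntegrable_coeFn g) (hψ.of_le (by simp)) hc]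
  exact integral_congr_ae (hf.mono fun x hx => by simp only [hx])

theorem IsWeakDeriv.exists_isPrimitive {f g : L2} (h : IsWeakDeriv f g) :
    ∃ F : ℝ → ℂ, f =ᵐ[volume] F ∧ Continuous F ∧ IsPrimitive F g := by
  have hg := locallyIntegrable_coeFn g
  have hf := locallyIntegrable_coeFn f
  obtain ⟨G, hG⟩ : ∃ G : ℝ → ℂ, IsPrimitive G g := ⟨_, isPrimitive_integral hg⟩
  have hGc : Continuous G := hG.continuous hg
  obtain ⟨c, hc⟩ : ∃ c : ℂ, ∀ᵐ x, f x - G x = c := by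
    refine exists_ae_eq_const_of_integral_deriv_smul_eq_zero (hf.sub hGc.locallyIntegrable)
      fun ψ hψ hψc => ?_
    have hψ' : Continuous (deriv ψ) := hψ.continuous_deriv (by simp)
    simp only [smul_sub]
    rw [integral_sub (hf.integrable_smul_left_of_hasCompactSupport hψ' hψc.deriv)
      (hGc.locallyIntegrable.integrable_smul_left_of_hasCompactSupport hψ' hψc.deriv),
      hG.integral_deriv_smul hg (hψ.of_le (by simp)) hψc, h ψ hψ hψc, sub_self]
  refine ⟨fun x => G x + c, hc.mono fun x hx => ?_, hGc.add continuous_const, fun x y => ?_⟩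
  · simp only [← hx, add_sub_cancel]
  · rw [← hG, add_sub_add_right_eq_sub]

open scoped Convolution

/-! ### Convolution operators on `L²` -/

section Young

variable {𝕜 G E E' F : Type*} [NontriviallyNormedField 𝕜] [NormedAddCommGroup E]
  [NormedAddCommGroup E'] [NormedAddCommGroup F] [NormedSpace 𝕜 E] [NormedSpace 𝕜 E']
  [NormedSpace 𝕜 F] [MeasurableSpace G] {μ : Measure G}

theorem sq_lintegral_mul_le {a b : G → ENNReal} (ha : AEMeasurable a μ) (hb : AEMeasurable b μ) :
    (∫⁻ x, a x * b x ∂μ) ^ 2 ≤ (∫⁻ x, a x ∂μ) * ∫⁻ x, a x * b x ^ 2 ∂μ := by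
  have hsplit : ∀ s t : ENNReal, s ^ (1 / 2 : ℝ) * (s * t ^ 2) ^ (1 / 2 : ℝ) = s * t :=
      fun s t => by
    rw [← ENNReal.mul_rpow_of_nonneg _ _ (by norm_num), ← mul_assoc, ← sq, ← mul_pow,
      ← ENNReal.rpow_two, ← ENNReal.rpow_mul]
    norm_num
  have h := ENNReal.lintegral_mul_norm_pow_le ha (ha.mul (hb.pow_const 2))
    (p := 1 / 2) (q := 1 / 2) (by norm_num) (by norm_num) (by norm_num)
  simp only [Pi.mul_apply, hsplit] at h
  calc (∫⁻ x, a x * b x ∂μ) ^ 2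
      ≤ ((∫⁻ x, a x ∂μ) ^ (1 / 2 : ℝ) * (∫⁻ x, a x * b x ^ 2 ∂μ) ^ (1 / 2 : ℝ)) ^ 2 := by gcongr
    _ = _ := by
      rw [← ENNReal.mul_rpow_of_nonneg _ _ (by norm_num), ← ENNReal.rpow_two, ← ENNReal.rpow_mul]
      norm_num

theorem sq_eLpNorm_two (f : G → E) : eLpNorm f 2 μ ^ 2 = ∫⁻ x, ‖f x‖ₑ ^ 2 ∂μ := by
  simpa [ENNReal.rpow_two] using eLpNorm_nnreal_pow_eq_lintegral (f := f) (μ := μ) two_ne_zero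

variable [NormedSpace ℝ F] [AddCommGroup G] [MeasurableAdd₂ G] [MeasurableNeg G] [SFinite μ]
  [μ.IsAddLeftInvariant] [μ.IsNegInvariant] {f : G → E} {K : G → E'} (L : E →L[𝕜] E' →L[𝕜] F)

theorem lintegral_sq_lintegral_mul_sub_le (hf : AEStronglyMeasurable f μ)
    (hK : AEStronglyMeasurable K μ) :
    ∫⁻ x, (∫⁻ y, ‖K (x - y)‖ₑ * ‖f y‖ₑ ∂μ) ^ 2 ∂μ
      ≤ ((∫⁻ s, ‖K s‖ₑ ∂μ) * eLpNorm f 2 μ) ^ 2 := by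
  have hKx : ∀ x, AEMeasurable (fun y => ‖K (x - y)‖ₑ) μ := fun x =>
    (hK.comp_measurePreserving (Measure.measurePreserving_sub_left μ x)).enorm
  have hKy : ∀ y, AEMeasurable (fun x => ‖K (x - y)‖ₑ) μ := fun y =>
    (hK.comp_measurePreserving (measurePreserving_sub_right μ y)).enorm
  have hKf : AEMeasurable (Function.uncurry fun x y => ‖K (x - y)‖ₑ * ‖f y‖ₑ ^ 2) (μ.prod μ) :=
    (hK.comp_quasiMeasurePreserving
      (quasiMeasurePreserving_sub_of_right_invariant μ μ)).enorm.mul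
      (hf.comp_snd.enorm.pow_const 2)
  calc ∫⁻ x, (∫⁻ y, ‖K (x - y)‖ₑ * ‖f y‖ₑ ∂μ) ^ 2 ∂μ
      ≤ ∫⁻ x, (∫⁻ s, ‖K s‖ₑ ∂μ) * ∫⁻ y, ‖K (x - y)‖ₑ * ‖f y‖ₑ ^ 2 ∂μ ∂μ := by
        refine lintegral_mono fun x => (sq_lintegral_mul_le (hKx x) hf.enorm).trans ?_
        rw [lintegral_sub_left_eq_self (fun s => ‖K s‖ₑ) x]
    _ = (∫⁻ s, ‖K s‖ₑ ∂μ) * ∫⁻ y, ∫⁻ x, ‖K (x - y)‖ₑ * ‖f y‖ₑ ^ 2 ∂μ ∂μ := by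
        rw [← lintegral_lintegral_swap hKf]
        exact lintegral_const_mul'' _ hKf.lintegral_prod_right'
    _ = (∫⁻ s, ‖K s‖ₑ ∂μ) * ∫⁻ y, (∫⁻ s, ‖K s‖ₑ ∂μ) * ‖f y‖ₑ ^ 2 ∂μ := by
        congr 1
        refine lintegral_congr fun y => ?_
        rw [lintegral_mul_const'' _ (hKy y), lintegral_sub_right_eq_self (fun s => ‖K s‖ₑ) y]
    _ = ((∫⁻ s, ‖K s‖ₑ ∂μ) * eLpNorm f 2 μ) ^ 2 := by
        rw [lintegral_const_mul'' _ (hf.enorm.pow_const 2), mul_pow, sq_eLpNorm_two, sq, mul_assoc]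

theorem eLpNorm_two_convolution_le (hf : AEStronglyMeasurable f μ)
    (hK : AEStronglyMeasurable K μ) :
    eLpNorm (f ⋆[L, μ] K) 2 μ ≤ ‖L‖ₑ * ((∫⁻ s, ‖K s‖ₑ ∂μ) * eLpNorm f 2 μ) := by
  have hpt : ∀ x, ‖(f ⋆[L, μ] K) x‖ₑ ≤ ‖L‖ₑ * ∫⁻ y, ‖K (x - y)‖ₑ * ‖f y‖ₑ ∂μ := fun x => by
    rw [← lintegral_const_mul' _ _ enorm_ne_top]
    refine (enorm_integral_le_lintegral_enorm _).trans (lintegral_mono fun y => ?_)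
    calc ‖L (f y) (K (x - y))‖ₑ ≤ ‖L‖ₑ * ‖f y‖ₑ * ‖K (x - y)‖ₑ := L.le_opENorm₂ _ _
      _ = ‖L‖ₑ * (‖K (x - y)‖ₑ * ‖f y‖ₑ) := by ring
  rw [← ENNReal.pow_le_pow_left_iff two_ne_zero]
  calc eLpNorm (f ⋆[L, μ] K) 2 μ ^ 2
      ≤ ∫⁻ x, ‖L‖ₑ ^ 2 * (∫⁻ y, ‖K (x - y)‖ₑ * ‖f y‖ₑ ∂μ) ^ 2 ∂μ := by
        rw [sq_eLpNorm_two]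
        refine lintegral_mono fun x => ?_
        rw [← mul_pow]
        gcongr
        exact hpt x
    _ ≤ (‖L‖ₑ * ((∫⁻ s, ‖K s‖ₑ ∂μ) * eLpNorm f 2 μ)) ^ 2 := by
        rw [lintegral_const_mul' _ _ (ENNReal.pow_ne_top enorm_ne_top), mul_pow ‖L‖ₑ]
        gcongr
        exact lintegral_sq_lintegral_mul_sub_le hf hK

theorem memLp_two_convolution (hf : MemLp f 2 μ) (hK : Integrable K μ) :
    MemLp (f ⋆[L, μ] K) 2 μ :=
  ⟨(hf.1.convolution_integrand L hK.1).integral_prod_right',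
    (eLpNorm_two_convolution_le L hf.1 hK.1).trans_lt
      (ENNReal.mul_lt_top enorm_lt_top (ENNReal.mul_lt_top hK.2 hf.2))⟩

end Young

section Transpose

open ContinuousLinearMap (mul)

variable {𝕜 G : Type*} [RCLike 𝕜] [MeasurableSpace G] [AddCommGroup G] [MeasurableAdd₂ G]
  [MeasurableNeg G] {μ : Measure G} [μ.IsAddLeftInvariant] [μ.IsNegInvariant] {f g K : G → 𝕜}

theorem memLp_comp_sub_left (hK : MemLp K 2 μ) (x : G) : MemLp (fun y => K (x - y)) 2 μ :=
  hK.comp_measurePreserving (Measure.measurePreserving_sub_left μ x)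

theorem convolutionExists_of_memLp_two (hf : MemLp f 2 μ) (hK : MemLp K 2 μ) :
    ConvolutionExists f K (mul 𝕜 𝕜) μ := fun x =>
  hf.integrable_mul (memLp_comp_sub_left hK x)

variable [SFinite μ]

theorem integrable_prod_mul_mul_sub (hg : MemLp g 2 μ) (hf : MemLp f 2 μ) (h1 : Integrable K μ)
    (h2 : MemLp K 2 μ) :
    Integrable (fun p : G × G => g p.1 * (f p.2 * K (p.1 - p.2))) (μ.prod μ) := by
  refine (integrable_prod_iff
    (hg.1.comp_fst.mul (hf.1.convolution_integrand (mul 𝕜 𝕜) h1.1))).2 ⟨?_, ?_⟩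
  · exact .of_forall fun x => (convolutionExists_of_memLp_two hf h2 x).const_mul (g x)
  · have h : MemLp (fun x => ∫ y, ‖f y‖ * ‖K (x - y)‖ ∂μ) 2 μ :=
      memLp_two_convolution (mul ℝ ℝ) hf.norm h1.norm
    refine (hg.norm.integrable_mul h).congr (.of_forall fun x => ?_)
    simp [integral_const_mul]

theorem integrable_mul_integral_mul_sub (hg : MemLp g 2 μ) (hf : MemLp f 2 μ)
    (h1 : Integrable K μ) (h2 : MemLp K 2 μ) :
    Integrable (fun y => f y * ∫ x, g x * K (x - y) ∂μ) μ := by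
  refine (integrable_prod_mul_mul_sub hg hf h1 h2).integral_prod_right.congr
    (.of_forall fun y => ?_)
  simp_rw [mul_left_comm, integral_const_mul]

theorem integral_mul_convolution (hg : MemLp g 2 μ) (hf : MemLp f 2 μ) (h1 : Integrable K μ)
    (h2 : MemLp K 2 μ) :
    ∫ x, g x * (f ⋆[mul 𝕜 𝕜, μ] K) x ∂μ = ∫ y, f y * ∫ x, g x * K (x - y) ∂μ ∂μ := by
  simp_rw [convolution_mul, ← integral_const_mul]
  rw [integral_integral_swap (integrable_prod_mul_mul_sub hg hf h1 h2)]
  simp_rw [mul_left_comm]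

end Transpose

section Operator

open ContinuousLinearMap (mul)

variable {K : ℝ → ℂ}

/-- Convolution with a kernel in `L¹ ∩ L²`, as a bounded operator on `L²`. -/
def convolutionOperator (h1 : Integrable K) (h2 : MemLp K 2) : L2 →L[ℂ] L2 :=
  LinearMap.mkContinuous
    { toFun := fun f => (memLp_two_convolution (mul ℂ ℂ) (Lp.memLp f) h1).toLp
      map_add' := fun f g => by
        rw [← MemLp.toLp_add]
        refine MemLp.toLp_congr _ _ (.of_forall fun x => ?_)
        rw [convolution_congr _ (Lp.coeFn_add f g) (.refl _ K),
          (convolutionExists_of_memLp_two (Lp.memLp f) h2).add_distrib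
            (convolutionExists_of_memLp_two (Lp.memLp g) h2)]
      map_smul' := fun c f => by
        rw [RingHom.id_apply, ← MemLp.toLp_const_smul]
        refine MemLp.toLp_congr _ _ (.of_forall fun x => ?_)
        rw [convolution_congr _ (Lp.coeFn_smul c f) (.refl _ K), smul_convolution] }
    (∫ s, ‖K s‖) fun f => by
      have hle := eLpNorm_two_convolution_le (mul ℂ ℂ) (Lp.memLp f).1 h1.1
      rw [← ofReal_norm, ContinuousLinearMap.opNorm_mul, ENNReal.ofReal_one, one_mul] at hle
      rw [LinearMap.coe_mk, AddHom.coe_mk, Lp.norm_toLp, Lp.norm_def,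
        integral_norm_eq_lintegral_enorm h1.1, ← ENNReal.toReal_mul]
      exact ENNReal.toReal_mono (ENNReal.mul_lt_top h1.2 (Lp.memLp f).2).ne hle

theorem coeFn_convolutionOperator (h1 : Integrable K) (h2 : MemLp K 2) (f : L2) :
    convolutionOperator h1 h2 f =ᵐ[volume] f ⋆[mul ℂ ℂ] K :=
  (memLp_two_convolution (mul ℂ ℂ) (Lp.memLp f) h1).coeFn_toLp

theorem convolutionOperator_const_smul (h1 : Integrable K) (h2 : MemLp K 2) (c : ℂ) (f : L2) :
    convolutionOperator (h1.smul c) (h2.const_smul c) f = c • convolutionOperator h1 h2 f := by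
  refine Lp.ext ?_
  filter_upwards [coeFn_convolutionOperator (h1.smul c) (h2.const_smul c) f,
    coeFn_convolutionOperator h1 h2 f, Lp.coeFn_smul c (convolutionOperator h1 h2 f)]
    with x hx hx' hc
  rw [hx, hc, Pi.smul_apply, hx', convolution_smul, Pi.smul_apply]

theorem norm_convolutionOperator_le (h1 : Integrable K) (h2 : MemLp K 2) :
    ‖convolutionOperator h1 h2‖ ≤ ∫ s, ‖K s‖ :=
  LinearMap.mkContinuous_norm_le _ (integral_nonneg fun _ => norm_nonneg _) _

theorem convolution_eq_inner (h2 : MemLp K 2) (f : L2) (x : ℝ) :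
    (f ⋆[mul ℂ ℂ] K) x = inner ℂ ((memLp_comp_sub_left h2 x).star.toLp _) f := by
  rw [L2.inner_def, convolution_mul]
  refine integral_congr_ae ?_
  filter_upwards [MemLp.coeFn_toLp (memLp_comp_sub_left h2 x).star] with y hy
  rw [hy]
  simp

theorem norm_toLp_star_comp_sub_left (h2 : MemLp K 2) (x : ℝ) :
    ‖(memLp_comp_sub_left h2 x).star.toLp _‖ = (eLpNorm K 2 volume).toReal := by
  rw [Lp.norm_toLp, eLpNorm_star]
  exact congrArg _
    (eLpNorm_comp_measurePreserving h2.1 (Measure.measurePreserving_sub_left volume x))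

theorem inner_convolutionOperator {K' : ℝ → ℂ} (h1 : Integrable K) (h2 : MemLp K 2)
    (h1' : Integrable K') (h2' : MemLp K' 2) (hK : ∀ s, K' (-s) = star (K s)) (f g : L2) :
    inner ℂ f (convolutionOperator h1 h2 g) = inner ℂ (convolutionOperator h1' h2' f) g := by
  rw [L2.inner_def, L2.inner_def]
  calc ∫ x, inner ℂ (f x) (convolutionOperator h1 h2 g x)
      = ∫ x, star (f x) * ((g : ℝ → ℂ) ⋆[mul ℂ ℂ] K) x := by
        refine integral_congr_ae ?_
        filter_upwards [coeFn_convolutionOperator h1 h2 g] with x hx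
        rw [hx, RCLike.inner_apply, mul_comm]
        rfl
    _ = ∫ y, g y * ∫ x, star (f x) * K (x - y) :=
        integral_mul_convolution (Lp.memLp f).star (Lp.memLp g) h1 h2
    _ = _ := by
        refine integral_congr_ae ?_
        filter_upwards [coeFn_convolutionOperator h1' h2' f] with y hy
        rw [hy, RCLike.inner_apply, convolution_mul, ← integral_conj]
        congr 1
        refine integral_congr_ae (.of_forall fun x => ?_)
        have := hK (x - y)
        rw [neg_sub] at this
        simp [this]

end Operator

/-! ### The free resolvent -/

section DistributionalDerivative

open ContinuousLinearMap (mul)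

/-- `K' + j δ₀` is the distributional derivative of `K`. -/
def HasDistribDeriv (K K' : ℝ → ℂ) (j : ℂ) : Prop :=
  ∀ ψ : ℝ → ℝ, ContDiff ℝ ∞ ψ → HasCompactSupport ψ →
    ∫ x, deriv ψ x • K x = -(∫ x, ψ x • K' x) - ψ 0 • j

theorem hasDistribDeriv_piecewise {A A' B B' : ℝ → ℂ} (hA : ∀ x, HasDerivAt A (A' x) x)
    (hB : ∀ x, HasDerivAt B (B' x) x) (hA' : Continuous A') (hB' : Continuous B') :
    HasDistribDeriv ((Iic 0).piecewise A B) ((Iic 0).piecewise A' B') (B 0 - A 0) := by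
  intro ψ hψ hc
  have hderiv : ∀ {F F' : ℝ → ℂ}, (∀ x, HasDerivAt F (F' x) x) → ∀ x,
      deriv (fun x => ψ x • F x) x = deriv ψ x • F x + ψ x • F' x := fun {F F'} hF x => by
    rw [((hψ.differentiable (by simp) x).hasDerivAt.fun_smul (hF x)).deriv, add_comm]
  have hint : ∀ {F F' : ℝ → ℂ}, (∀ x, HasDerivAt F (F' x) x) → Continuous F' →
      Integrable (fun x => deriv ψ x • F x) ∧ Integrable (fun x => ψ x • F' x) ∧
        ContDiff ℝ 1 (fun x => ψ x • F x) := fun {F F'} hF hF' =>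
    have hF1 : ContDiff ℝ 1 F := contDiff_one_iff_deriv.2
      ⟨fun x => (hF x).differentiableAt, (funext fun x => (hF x).deriv : deriv F = F') ▸ hF'⟩
    ⟨((hψ.continuous_deriv (by simp)).smul hF1.continuous).integrable_of_hasCompactSupport
        hc.deriv.smul_right,
      (hψ.continuous.smul hF').integrable_of_hasCompactSupport hc.smul_right,
      (hψ.of_le (by simp)).smul hF1⟩
  have hIic : ∫ x in Iic 0, (deriv ψ x • A x + ψ x • A' x) = ψ 0 • A 0 := by
    simp_rw [← hderiv hA]
    exact HasCompactSupport.integral_Iic_deriv_eq (hint hA hA').2.2 hc.smul_right 0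
  have hIoi : ∫ x in Ioi 0, (deriv ψ x • B x + ψ x • B' x) = -(ψ 0 • B 0) := by
    simp_rw [← hderiv hB]
    exact HasCompactSupport.integral_Ioi_deriv_eq (hint hB hB').2.2 hc.smul_right 0
  rw [integral_add (hint hA hA').1.integrableOn (hint hA hA').2.1.integrableOn] at hIic
  rw [integral_add (hint hB hB').1.integrableOn (hint hB hB').2.1.integrableOn] at hIoi
  have hsmul : ∀ (q : ℝ → ℝ) (F H : ℝ → ℂ), (fun x => q x • (Iic 0).piecewise F H x)
      = (Iic 0).piecewise (fun x => q x • F x) (fun x => q x • H x) := fun q F H =>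
    (piecewise_op (Iic 0) F H fun x z => q x • z).symm
  rw [hsmul, hsmul,
    integral_piecewise measurableSet_Iic (hint hA hA').1.integrableOn
      (hint hB hB').1.integrableOn,
    integral_piecewise measurableSet_Iic (hint hA hA').2.1.integrableOn
      (hint hB hB').2.1.integrableOn, compl_Iic, smul_sub]
  linear_combination hIic + hIoi

theorem HasDistribDeriv.integral_comp_sub {K K' : ℝ → ℂ} {j : ℂ} (hK : HasDistribDeriv K K' j)
    {ψ : ℝ → ℝ} (hψ : ContDiff ℝ ∞ ψ) (hc : HasCompactSupport ψ) (y : ℝ) :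
    ∫ x, deriv ψ x • K (x - y) = -(∫ x, ψ x • K' (x - y)) - ψ y • j := by
  rw [← integral_add_right_eq_self _ y, ← integral_add_right_eq_self (fun x => ψ x • _) y]
  have h := hK (fun x => ψ (x + y)) (hψ.comp (contDiff_id.add contDiff_const))
    (hc.comp_homeomorph (Homeomorph.addRight y))
  simpa [deriv_comp_add_const] using h

theorem memLp_two_ofReal_of_hasCompactSupport {ψ : ℝ → ℝ} (h : Continuous ψ)
    (hc : HasCompactSupport ψ) : MemLp (fun x => (ψ x : ℂ)) 2 :=
  (h.memLp_of_hasCompactSupport hc).ofReal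

theorem integral_smul_convolutionOperator {K : ℝ → ℂ} (h1 : Integrable K) (h2 : MemLp K 2)
    (f : L2) {ψ : ℝ → ℝ} (hψ : Continuous ψ) (hc : HasCompactSupport ψ) :
    ∫ x, ψ x • convolutionOperator h1 h2 f x = ∫ y, f y * ∫ x, ψ x • K (x - y) := by
  simp_rw [Complex.real_smul]
  rw [← integral_mul_convolution (memLp_two_ofReal_of_hasCompactSupport hψ hc) (Lp.memLp f) h1 h2]
  refine integral_congr_ae ?_
  filter_upwards [coeFn_convolutionOperator h1 h2 f] with x hx
  rw [hx]

theorem HasDistribDeriv.isWeakDeriv_convolutionOperator {K K' : ℝ → ℂ} {j : ℂ}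
    (hK : HasDistribDeriv K K' j) (h1 : Integrable K) (h2 : MemLp K 2) (h1' : Integrable K')
    (h2' : MemLp K' 2) (f : L2) :
    IsWeakDeriv (convolutionOperator h1 h2 f) (convolutionOperator h1' h2' f + j • f) := by
  intro ψ hψ hc
  have hint : Integrable fun y => f y * ∫ x, ψ x • K' (x - y) := by
    simp_rw [Complex.real_smul]
    exact integrable_mul_integral_mul_sub
      (memLp_two_ofReal_of_hasCompactSupport hψ.continuous hc) (Lp.memLp f) h1' h2'
  have hjump : ∀ y, f y * (ψ y • j) = j * (ψ y • f y) := fun y => by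
    simp only [Complex.real_smul]
    ring
  rw [integral_smul_add _ _ hψ.continuous hc, integral_smul_const_smul,
    integral_smul_convolutionOperator h1 h2 f (hψ.continuous_deriv (by simp)) hc.deriv,
    integral_smul_convolutionOperator h1' h2' f hψ.continuous hc]
  simp_rw [hK.integral_comp_sub hψ hc, mul_sub, mul_neg, hjump]
  rw [integral_sub (f := fun y => -(f y * _)) hint.neg
      ((integrable_test_smul f hψ.continuous hc).const_mul j), integral_neg, integral_const_mul]
  ring

end DistributionalDerivative

section Kernel

variable {k p q : ℂ}

/-- The two-sided exponential kernel `p e^{ks}` for `s ≤ 0` and `q e^{-ks}` for `s > 0`. -/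
def expKernel (k p q : ℂ) : ℝ → ℂ :=
  (Iic 0).piecewise (fun s => p * Complex.exp (k * s)) (fun s => q * Complex.exp (-k * s))

theorem integrable_expKernel (hk : 0 < k.re) (p q : ℂ) : Integrable (expKernel k p q) := by
  refine .piecewise measurableSet_Iic ((integrableOn_exp_mul_complex_Iic hk 0).const_mul p) ?_
  rw [compl_Iic]
  exact (integrableOn_exp_mul_complex_Ioi (by simpa using hk) 0).const_mul q

theorem expKernel_mul (k c p q : ℂ) : expKernel k (c * p) (c * q) = c • expKernel k p q := by
  ext s
  by_cases hs : s ≤ 0 <;> simp [expKernel, piecewise, hs, mul_assoc]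

theorem sq_expKernel (k p q : ℂ) (s : ℝ) :
    expKernel k p q s ^ 2 = expKernel (2 * k) (p ^ 2) (q ^ 2) s := by
  by_cases hs : s ≤ 0 <;>
  · simp only [expKernel, piecewise, mem_Iic, hs, if_true, if_false, mul_pow, ← Complex.exp_nat_mul]
    congr 2
    push_cast
    ring

theorem memLp_expKernel (hk : 0 < k.re) (p q : ℂ) : MemLp (expKernel k p q) 2 := by
  rw [memLp_two_iff_integrable_sq_norm (integrable_expKernel hk p q).1]
  simp_rw [← norm_pow, sq_expKernel]
  exact (integrable_expKernel (by simpa using hk) _ _).norm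

theorem hasDistribDeriv_expKernel (k p q : ℂ) :
    HasDistribDeriv (expKernel k p q) (expKernel k (k * p) (-k * q)) (q - p) := by
  have hexp : ∀ (c r : ℂ) (s : ℝ),
      HasDerivAt (fun s : ℝ => r * Complex.exp (c * s)) (c * r * Complex.exp (c * s)) s :=
    fun c r s => by
      have h := (((hasDerivAt_id s).ofReal_comp.const_mul c).cexp).const_mul r
      convert! h using 1
      simp
      ring
  have h := hasDistribDeriv_piecewise (hexp k p) (hexp (-k) q) (by fun_prop) (by fun_prop)
  simp only [Complex.ofReal_zero, mul_zero, Complex.exp_zero, mul_one] at h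
  exact h

theorem integral_norm_expKernel (hk : 0 < k.re) (p q : ℂ) :
    ∫ s, ‖expKernel k p q s‖ = (‖p‖ + ‖q‖) / k.re := by
  have hnorm : (fun s => ‖expKernel k p q s‖) = (Iic 0).piecewise
      (fun s => ‖p‖ * Real.exp (k.re * s)) (fun s => ‖q‖ * Real.exp (-k.re * s)) := by
    ext s
    by_cases hs : s ≤ 0 <;> simp [expKernel, piecewise, hs, Complex.norm_exp]
  rw [hnorm, integral_piecewise measurableSet_Iic ((integrableOn_exp_mul_Iic hk 0).const_mul _)
    (by rw [compl_Iic]; exact (integrableOn_exp_mul_Ioi (by linarith) 0).const_mul _),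
    compl_Iic, integral_const_mul, integral_const_mul, integral_exp_mul_Iic hk,
    integral_exp_mul_Ioi (by linarith)]
  simp
  ring

/-- Green's function `e^{-k|s|} / (2k)` of `-∂² + k²`. -/
def greenKernel (k : ℂ) : ℝ → ℂ := expKernel k (2 * k)⁻¹ (2 * k)⁻¹

theorem integrable_greenKernel (hk : 0 < k.re) : Integrable (greenKernel k) :=
  integrable_expKernel hk _ _

theorem memLp_greenKernel (hk : 0 < k.re) : MemLp (greenKernel k) 2 := memLp_expKernel hk _ _

/-- The inverse of `-∂² + k²` on `L²`. -/
def freeResolvent (hk : 0 < k.re) : L2 →L[ℂ] L2 :=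
  convolutionOperator (integrable_greenKernel hk) (memLp_greenKernel hk)

theorem freeResolvent_isWeakDeriv (hk : 0 < k.re) (f : L2) :
    ∃ g, IsWeakDeriv (freeResolvent hk f) g ∧
      IsWeakDeriv g (k ^ 2 • freeResolvent hk f - f) := by
  have hk0 : k ≠ 0 := fun h => by simp [h] at hk
  have h1 := integrable_expKernel hk
  have h2 := memLp_expKernel hk
  have hG : HasDistribDeriv (greenKernel k) (expKernel k 2⁻¹ (-2⁻¹)) 0 := by
    have h := hasDistribDeriv_expKernel k (2 * k)⁻¹ (2 * k)⁻¹
    rwa [show k * (2 * k)⁻¹ = 2⁻¹ by field_simp, show -k * (2 * k)⁻¹ = -2⁻¹ by field_simp,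
      sub_self] at h
  have hG' : HasDistribDeriv (expKernel k 2⁻¹ (-2⁻¹)) (k ^ 2 • greenKernel k) (-1) := by
    have h := hasDistribDeriv_expKernel k 2⁻¹ (-2⁻¹)
    rwa [show k * 2⁻¹ = k ^ 2 * (2 * k)⁻¹ by field_simp,
      show -k * -2⁻¹ = k ^ 2 * (2 * k)⁻¹ by field_simp, expKernel_mul,
      show -2⁻¹ - 2⁻¹ = (-1 : ℂ) by norm_num] at h
  have hR := integrable_greenKernel hk
  have hR2 := memLp_greenKernel hk
  refine ⟨convolutionOperator (h1 2⁻¹ (-2⁻¹)) (h2 _ _) f, ?_, ?_⟩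
  · have h := hG.isWeakDeriv_convolutionOperator hR hR2 (h1 _ _) (h2 _ _) f
    rwa [zero_smul, add_zero] at h
  · have h := hG'.isWeakDeriv_convolutionOperator (h1 _ _) (h2 _ _) (hR.smul (k ^ 2))
      (hR2.const_smul (k ^ 2)) f
    rwa [convolutionOperator_const_smul hR hR2, neg_one_smul, ← sub_eq_add_neg] at h

theorem exists_ae_eq_exp_mul_of_isWeakDeriv_smul {u : L2} {σ : ℂ} (h : IsWeakDeriv u (σ • u)) :
    ∃ c : ℂ, u =ᵐ[volume] fun x : ℝ => Complex.exp (σ * x) * c := by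
  obtain ⟨F, hF, hFc, hFi⟩ := h.exists_isPrimitive
  have hF' : IsPrimitive F fun t => σ * F t := hFi.congr_ae <| by
    filter_upwards [hF, Lp.coeFn_smul σ u] with t ht ht'
    rw [ht', Pi.smul_apply, ht, smul_eq_mul]
  have hd := hF'.hasDerivAt (by fun_prop)
  have hexp : ∀ x : ℝ, HasDerivAt (fun x : ℝ => Complex.exp (-σ * x))
      (Complex.exp (-σ * x) * -σ) x := fun x => by
    simpa using ((hasDerivAt_id x).ofReal_comp.const_mul (-σ)).cexp
  have hconst : ∀ x : ℝ, Complex.exp (-σ * x) * F x = F 0 := fun x => by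
    simpa using is_const_of_deriv_eq_zero (f := fun x : ℝ => Complex.exp (-σ * x) * F x)
      (fun x => ((hexp x).mul (hd x)).differentiableAt)
      (fun x => by rw [((hexp x).fun_mul (hd x)).deriv]; ring) x 0
  refine ⟨F 0, ?_⟩
  filter_upwards [hF] with x hx
  rw [hx, ← hconst x, ← mul_assoc, ← Complex.exp_add]
  simp

theorem eq_zero_of_memLp_exp_mul {σ c : ℂ}
    (h : MemLp (fun x : ℝ => Complex.exp (σ * x) * c) 2) : c = 0 := by
  obtain ⟨s, hs, hv, hx⟩ : ∃ s : Set ℝ, MeasurableSet s ∧ volume s = ⊤ ∧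
      ∀ x ∈ s, 0 ≤ σ.re * x := by
    rcases le_total 0 σ.re with h | h
    · exact ⟨Ioi 0, measurableSet_Ioi, by simp, fun x hx => mul_nonneg h (mem_Ioi.1 hx).le⟩
    · exact ⟨Iio 0, measurableSet_Iio, by simp,
        fun x hx => mul_nonneg_of_nonpos_of_nonpos h (mem_Iio.1 hx).le⟩
  have hconst : MemLp (fun _ : ℝ => c) 2 (volume.restrict s) := by
    refine (h.restrict s).mono aestronglyMeasurable_const ?_
    filter_upwards [ae_restrict_mem hs] with x hxs
    rw [norm_mul, Complex.norm_exp]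
    exact le_mul_of_one_le_left (norm_nonneg _) (Real.one_le_exp (by simpa using hx x hxs))
  simpa [memLp_const_iff, hv] using hconst

theorem eq_zero_of_isWeakDeriv_smul {u : L2} {σ : ℂ} (h : IsWeakDeriv u (σ • u)) : u = 0 := by
  obtain ⟨c, hc⟩ := exists_ae_eq_exp_mul_of_isWeakDeriv_smul h
  rw [eq_zero_of_memLp_exp_mul ((memLp_congr_ae hc).1 (Lp.memLp u))] at hc
  simpa [Lp.eq_zero_iff_ae_eq_zero, EventuallyEq] using hc

theorem eq_zero_of_isWeakDeriv_sq_smul {u g : L2} {k : ℂ} (h : IsWeakDeriv u g)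
    (h' : IsWeakDeriv g (k ^ 2 • u)) : u = 0 := by
  have h1 : IsWeakDeriv (g - k • u) ((-k) • (g - k • u)) := by
    convert! h'.sub (h.const_smul k) using 1
    match_scalars <;> ring
  rw [sub_eq_zero.1 (eq_zero_of_isWeakDeriv_smul h1)] at h
  exact eq_zero_of_isWeakDeriv_smul h

theorem eq_freeResolvent_iff (hk : 0 < k.re) {u p : L2} :
    u = freeResolvent hk p ↔ ∃ g, IsWeakDeriv u g ∧ IsWeakDeriv g (k ^ 2 • u - p) := by
  obtain ⟨g', hg', hh'⟩ := freeResolvent_isWeakDeriv hk p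
  constructor
  · rintro rfl
    exact ⟨g', hg', hh'⟩
  · rintro ⟨g, hg, hh⟩
    have h := hh.sub hh'
    rw [show k ^ 2 • u - p - (k ^ 2 • freeResolvent hk p - p)
      = k ^ 2 • (u - freeResolvent hk p) by module] at h
    exact sub_eq_zero.1 (eq_zero_of_isWeakDeriv_sq_smul (hg.sub hg') h)

end Kernel

/-! ### The resolvent equation -/

section Multiplication

variable {W : ℝ → ℝ}

/-- Multiplication by a bounded real function, as an operator on `L²`. -/
def mulOperator (hW : MemLp W ⊤) : L2 →L[ℂ] L2 :=
  (ContinuousLinearMap.mul ℂ ℂ).holderL volume ⊤ 2 2 (hW.ofReal (K := ℂ)).toLp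

theorem coeFn_mulOperator (hW : MemLp W ⊤) (f : L2) :
    mulOperator hW f =ᵐ[volume] fun x => (W x : ℂ) * f x := by
  filter_upwards [(ContinuousLinearMap.mul ℂ ℂ).coeFn_holder (r := 2) (hW.ofReal (K := ℂ)).toLp f,
    (hW.ofReal (K := ℂ)).coeFn_toLp] with x hx hW
  exact hx.trans (by rw [hW]; rfl)

theorem norm_mulOperator_le (hW : MemLp W ⊤) {C : ℝ} (hC0 : 0 ≤ C) (hC : ∀ x, |W x| ≤ C) :
    ‖mulOperator hW‖ ≤ C := by
  refine ContinuousLinearMap.opNorm_le_bound _ hC0 fun f => Lp.norm_le_mul_norm_of_ae_le_mul ?_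
  filter_upwards [coeFn_mulOperator hW f] with x hx
  rw [hx, norm_mul, Complex.norm_real, Real.norm_eq_abs]
  gcongr
  exact hC x

theorem mem_schrodingerGraph_iff_isWeakDeriv (hW : MemLp W ⊤) {c : ℝ} {u f : L2} :
    (u, f) ∈ schrodingerGraph (fun x => c + W x) ↔
      ∃ g, IsWeakDeriv u g ∧ IsWeakDeriv g ((c : ℂ) • u + mulOperator hW u - f) := by
  have hcoe : ∀ᵐ x, ((c : ℂ) • u + mulOperator hW u - f : L2) x
      = ((c + W x : ℝ) : ℂ) * u x - f x := by
    filter_upwards [coeFn_mulOperator hW u, Lp.coeFn_sub ((c : ℂ) • u + mulOperator hW u) f,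
      Lp.coeFn_add ((c : ℂ) • u) (mulOperator hW u), Lp.coeFn_smul (c : ℂ) u] with x h1 h2 h3 h4
    rw [h2, Pi.sub_apply, h3, Pi.add_apply, h4, h1, Pi.smul_apply, smul_eq_mul]
    push_cast
    ring
  constructor
  · rintro ⟨g, h, hg, hh, hf⟩
    refine ⟨g, hg, ?_⟩
    convert! hh using 1
    refine Lp.ext ?_
    filter_upwards [hcoe, hf] with x hx hfx
    rw [hx, hfx]
    ring
  · rintro ⟨g, hg, hh⟩
    refine ⟨g, _, hg, hh, ?_⟩
    filter_upwards [hcoe] with x hx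
    rw [hx]
    ring

theorem mem_schrodingerGraph_iff_eq_freeResolvent (hW : MemLp W ⊤) {c : ℝ} {k : ℂ}
    (hk : 0 < k.re) {u f : L2} : (u, f) ∈ schrodingerGraph (fun x => c + W x) ↔
      u = freeResolvent hk (f - (c - k ^ 2) • u - mulOperator hW u) := by
  rw [mem_schrodingerGraph_iff_isWeakDeriv hW, eq_freeResolvent_iff,
    show k ^ 2 • u - (f - (c - k ^ 2) • u - mulOperator hW u)
      = (c : ℂ) • u + mulOperator hW u - f by module]

end Multiplication

section Graph

variable {U : ℝ → ℝ}

theorem mem_graph_of_domain (x : (schrodinger U).domain) :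
    ((x : L2), schrodinger U x) ∈ schrodingerGraph U := by
  rw [← schrodinger_graph]
  exact (schrodinger U).mem_graph x

theorem exists_domain_of_mem_graph {u f : L2} (h : (u, f) ∈ schrodingerGraph U) :
    ∃ x : (schrodinger U).domain, (x : L2) = u ∧ schrodinger U x = f := by
  rw [← schrodinger_graph] at h
  exact (LinearPMap.mem_graph_iff _).1 h

theorem shift_apply (z : ℂ) (x : (schrodinger U).domain) :
    shift (schrodinger U) z x = schrodinger U x - z • (x : L2) := rfl

theorem mem_resolventSet_iff {z : ℂ} :
    z ∈ resolventSet (schrodinger U) ↔ ∃ R : L2 →L[ℂ] L2,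
      (∀ y, (R y, y + z • R y) ∈ schrodingerGraph U) ∧
      ∀ u f, (u, f) ∈ schrodingerGraph U → R (f - z • u) = u := by
  refine exists_congr fun R => and_congr (forall_congr' fun y => ?_) ?_
  · constructor
    · rintro ⟨x, hx, hy⟩
      have := mem_graph_of_domain x
      rw [shift_apply, sub_eq_iff_eq_add] at hy
      rwa [hy, hx] at this
    · intro h
      obtain ⟨x, hx, hy⟩ := exists_domain_of_mem_graph h
      refine ⟨x, hx, ?_⟩
      rw [shift_apply, hy, hx, add_sub_cancel_right]
  · constructor
    · intro h u f huf
      obtain ⟨x, rfl, rfl⟩ := exists_domain_of_mem_graph huf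
      exact h x
    · intro h x
      exact h _ _ (mem_graph_of_domain x)

theorem mem_ker_shift_iff {z : ℂ} {x : (schrodinger U).domain} :
    x ∈ LinearMap.ker (shift (schrodinger U) z) ↔
      ((x : L2), z • (x : L2)) ∈ schrodingerGraph U := by
  rw [LinearMap.mem_ker, shift_apply, sub_eq_zero]
  constructor
  · intro h
    rw [← h]
    exact mem_graph_of_domain x
  · intro h
    obtain ⟨x', hx, hy⟩ := exists_domain_of_mem_graph h
    rw [← hy]
    congr 1
    exact Subtype.ext hx.symm

/-- `z` is an eigenvalue of `-∂² + U`, read off the graph to avoid elements of the domain. -/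
def IsEigenvalue (U : ℝ → ℝ) (z : ℂ) : Prop :=
  ∃ u : L2, u ≠ 0 ∧ (u, z • u) ∈ schrodingerGraph U

theorem ker_shift_ne_bot_iff {z : ℂ} :
    LinearMap.ker (shift (schrodinger U) z) ≠ ⊥ ↔ IsEigenvalue U z := by
  rw [Submodule.ne_bot_iff]
  constructor
  · rintro ⟨x, hx, hx0⟩
    exact ⟨x, fun h => hx0 (Subtype.ext h), mem_ker_shift_iff.1 hx⟩
  · rintro ⟨u, hu, h⟩
    obtain ⟨x, rfl, -⟩ := exists_domain_of_mem_graph h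
    exact ⟨x, mem_ker_shift_iff.2 h, fun h => hu (by simp [h])⟩

theorem IsEigenvalue.mem_spectrum {z : ℂ} (h : IsEigenvalue U z) :
    z ∈ spectrum (schrodinger U) := by
  obtain ⟨u, hu, hg⟩ := h
  intro hz
  obtain ⟨R, -, hR⟩ := mem_resolventSet_iff.1 hz
  have := hR u _ hg
  rw [sub_self, map_zero] at this
  exact hu this.symm

theorem injective_shift_of_not_isEigenvalue {z : ℂ} (h : ¬ IsEigenvalue U z) :
    Function.Injective (shift (schrodinger U) z) := by
  rw [← LinearMap.ker_eq_bot]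
  by_contra h'
  exact h (ker_shift_ne_bot_iff.1 h')

end Graph

/-! ### Compactness and the Fredholm alternative -/

section Compactness

variable {H F X : Type*} [NormedAddCommGroup H] [InnerProductSpace ℂ H] [CompleteSpace H]
  [TopologicalSpace.SeparableSpace H] [NormedAddCommGroup F] [NormedSpace ℂ F]
  [MeasurableSpace X] {μ : Measure X}

theorem exists_weakly_convergent_subseq {f : ℕ → H} {r : ℝ}
    (hf : ∀ n, ‖f n‖ ≤ r) : ∃ f₀ : H, ‖f₀‖ ≤ r ∧ ∃ φ : ℕ → ℕ, StrictMono φ ∧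
      ∀ g, Tendsto (fun n => inner ℂ g (f (φ n))) atTop (𝓝 (inner ℂ g f₀)) := by
  obtain ⟨a, ha, φ, hφ, hlim⟩ := WeakDual.isSeqCompact_closedBall ℂ H 0 r
    (x := fun n => StrongDual.toWeakDual (InnerProductSpace.toDual ℂ H (f n)))
    (fun n => by simpa using hf n)
  refine ⟨(InnerProductSpace.toDual ℂ H).symm (WeakDual.toStrongDual a), by simpa using ha,
    φ, hφ, fun g => ?_⟩
  have h := (Complex.continuous_conj.tendsto _).comp
    (((WeakDual.eval_continuous g).tendsto a).comp hlim)
  convert h using 2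
  · simp
  · rw [← inner_conj_symm, InnerProductSpace.toDual_symm_apply]
    rfl

theorem isCompactOperator_of_tendsto_of_weakly {T : H →L[ℂ] F}
    (hT : ∀ (f : ℕ → H) (r : ℝ), (∀ n, ‖f n‖ ≤ r) →
      (∀ g, Tendsto (fun n => inner ℂ g (f n)) atTop (𝓝 0)) →
        Tendsto (fun n => T (f n)) atTop (𝓝 0)) :
    IsCompactOperator T := by
  refine (isCompactOperator_iff_image_closedBall_subset_compact (T : H →ₗ[ℂ] F) one_pos).2
    ⟨_, IsSeqCompact.isCompact ?_, Subset.rfl⟩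
  intro v hv
  choose f hf hfv using hv
  have hf1 : ∀ n, ‖f n‖ ≤ 1 := fun n => by simpa using hf n
  obtain ⟨f₀, hf₀, φ, hφ, hlim⟩ := exists_weakly_convergent_subseq hf1
  refine ⟨T f₀, ⟨f₀, by simpa using hf₀, rfl⟩, φ, hφ, ?_⟩
  have h0 := hT (fun n => f (φ n) - f₀) (1 + 1)
    (fun n => (norm_sub_le _ _).trans (add_le_add (hf1 _) hf₀)) fun g => by
      simpa only [inner_sub_right, sub_self] using (hlim g).sub_const (inner ℂ g f₀)
  rw [show v ∘ φ = fun n => T (f (φ n)) from funext fun n => (hfv (φ n)).symm,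
    ← tendsto_sub_nhds_zero_iff]
  simpa only [map_sub] using h0

theorem norm_sq_eq_integral_norm_sq (f : Lp ℂ 2 μ) : ‖f‖ ^ 2 = ∫ x, ‖f x‖ ^ 2 ∂μ := by
  rw [← inner_self_eq_norm_sq (𝕜 := ℂ) f, L2.inner_def, ← integral_re (L2.integrable_inner f f)]
  simp_rw [inner_self_eq_norm_sq]

/-- A weakly null sequence has pointwise null images, and `w` dominates these in `L²`. -/
theorem isCompactOperator_of_coeFn_ae_eq_inner {T : H →L[ℂ] Lp ℂ 2 μ} {κ : X → H} {w : X → ℝ}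
    (hw : MemLp w 2 μ) (hκ : ∀ x, ‖κ x‖ ≤ w x) (hT : ∀ f, T f =ᵐ[μ] fun x => inner ℂ (κ x) f) :
    IsCompactOperator T := by
  refine isCompactOperator_of_tendsto_of_weakly fun f r hr hf => ?_
  have hlim : Tendsto (fun n => ‖T (f n)‖ ^ 2) atTop (𝓝 (∫ _, (0 : ℝ) ∂μ)) := by
    simp_rw [norm_sq_eq_integral_norm_sq]
    refine tendsto_integral_of_dominated_convergence (fun x => w x ^ 2 * r ^ 2)
      (fun n => (Lp.memLp _).1.norm.pow 2) (hw.integrable_sq.mul_const _) (fun n => ?_) ?_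
    · filter_upwards [hT (f n)] with x hx
      rw [hx, norm_pow, norm_norm, ← mul_pow]
      have := (norm_nonneg _).trans (hκ x)
      gcongr
      exact (norm_inner_le_norm _ _).trans (by gcongr; exacts [hκ x, hr n])
    · filter_upwards [ae_all_iff.2 fun n => hT (f n)] with x hx
      simp_rw [hx]
      simpa using (hf (κ x)).norm.pow 2
  rw [tendsto_zero_iff_norm_tendsto_zero]
  simpa [Real.sqrt_sq (norm_nonneg _)] using hlim.sqrt

end Compactness

section CompactOperators

variable {E F : Type*} [NormedAddCommGroup E] [NormedSpace ℂ E]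
  [NormedAddCommGroup F] [NormedSpace ℂ F]

theorem exists_tendsto_subseq_of_isCompactOperator {T : E →L[ℂ] F} (hT : IsCompactOperator T)
    {f : ℕ → E} {r : ℝ} (hf : ∀ n, ‖f n‖ ≤ r) :
    ∃ w, ∃ φ : ℕ → ℕ, StrictMono φ ∧ Tendsto (fun n => T (f (φ n))) atTop (𝓝 w) := by
  obtain ⟨K, hK, hKs⟩ := IsCompactOperator.image_subset_compact_of_bounded
    (f := (T : E →ₗ[ℂ] F)) hT (Metric.isBounded_closedBall (x := (0 : E)) (r := r))
  obtain ⟨w, -, h⟩ := hK.tendsto_subseq (x := fun n => T (f n)) fun n =>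
    hKs ⟨f n, by simpa using hf n, rfl⟩
  exact ⟨w, h⟩

theorem isUnit_one_add_of_isCompactOperator [CompleteSpace E] {K : E →L[ℂ] E}
    (hK : IsCompactOperator K) (h : ∀ v, K v = -v → v = 0) : IsUnit (1 + K) := by
  rcases hK.hasEigenvalue_or_mem_resolventSet (μ := -1) (by simp) with he | he
  · obtain ⟨v, hv, hv0⟩ := he.exists_hasEigenvector
    rw [Module.End.mem_eigenspace_iff] at hv
    exact absurd (h v (by simpa using hv)) hv0
  · rw [_root_.spectrum.mem_resolventSet_iff, map_neg, map_one, ← neg_add'] at he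
    exact (IsUnit.neg_iff _).1 he

end CompactOperators

section Fredholm

variable {W : ℝ → ℝ} {c : ℝ}

theorem isCompactOperator_mulOperator_freeResolvent (hW : MemLp W ⊤) (hW2 : MemLp W 2) {k : ℂ}
    (hk : 0 < k.re) : IsCompactOperator (mulOperator hW ∘L freeResolvent hk) := by
  have hR := integrable_greenKernel hk
  have hR2 := memLp_greenKernel hk
  have : Fact ((2 : ENNReal) ≠ ⊤) := ⟨by norm_num⟩
  refine isCompactOperator_of_coeFn_ae_eq_inner
    (κ := fun x => (W x : ℂ) • (memLp_comp_sub_left hR2 x).star.toLp _)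
    (w := fun x => ‖W x‖ * (eLpNorm (greenKernel k) 2 volume).toReal)
    (hW2.norm.mul_const _) (fun x => ?_) fun f => ?_
  · rw [norm_smul, norm_toLp_star_comp_sub_left hR2, Complex.norm_real]
  · filter_upwards [coeFn_mulOperator hW (freeResolvent hk f), coeFn_convolutionOperator hR hR2 f]
      with x hx hx'
    rw [ContinuousLinearMap.comp_apply, hx, freeResolvent, hx', convolution_eq_inner hR2,
      inner_smul_left, Complex.conj_ofReal]

theorem exists_re_pos_sq_eq {z : ℂ} (hz : z ∉ Complex.ofReal '' Ici c) :
    ∃ k : ℂ, 0 < k.re ∧ c - k ^ 2 = z := by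
  obtain ⟨w, hw⟩ := IsAlgClosed.exists_pow_nat_eq (c - z) (n := 2) (by norm_num)
  rcases lt_trichotomy w.re 0 with h | h | h
  · exact ⟨-w, by simpa using h, by rw [neg_sq, hw]; ring⟩
  · refine absurd ⟨c + w.im ^ 2, by simp [sq_nonneg], ?_⟩ hz
    have hwi : w = w.im * Complex.I := by
      apply Complex.ext <;> simp [h]
    rw [hwi, mul_pow, Complex.I_sq] at hw
    push_cast
    linear_combination -hw
  · exact ⟨w, h, by rw [hw]; ring⟩

theorem mem_resolventSet_of_not_isEigenvalue (hW : MemLp W ⊤) (hW2 : MemLp W 2) {z : ℂ}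
    (hz : z ∉ Complex.ofReal '' Ici c) (he : ¬ IsEigenvalue (fun x => c + W x) z) :
    z ∈ resolventSet (schrodinger fun x => c + W x) := by
  obtain ⟨k, hk, rfl⟩ := exists_re_pos_sq_eq hz
  set R₀ := freeResolvent hk
  set M := mulOperator hW
  have hiff : ∀ u f, _ ↔ _ := fun u f =>
    mem_schrodingerGraph_iff_eq_freeResolvent hW (c := c) hk (u := u) (f := f)
  have hu : IsUnit (1 + M ∘L R₀) := by
    refine isUnit_one_add_of_isCompactOperator
      (isCompactOperator_mulOperator_freeResolvent hW hW2 hk) fun v hv => ?_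
    replace hv : M (R₀ v) = -v := hv
    have hRv : R₀ v = 0 := by
      by_contra hne
      refine he ⟨R₀ v, hne, ?_⟩
      rw [hiff, hv]
      congr 1
      abel
    rw [hRv, map_zero] at hv
    exact neg_eq_zero.1 hv.symm
  obtain ⟨S, hS⟩ := hu.exists_right_inv
  have hgraph : ∀ y, (R₀ (S y), y + (c - k ^ 2) • R₀ (S y)) ∈
      schrodingerGraph fun x => c + W x := fun y => by
    rw [hiff]
    have hSy : S y + M (R₀ (S y)) = y := by simpa using DFunLike.congr_fun hS y
    congr 1
    nth_rewrite 2 [← hSy]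
    abel
  refine mem_resolventSet_iff.2 ⟨R₀ ∘L S, hgraph, fun u f huf => ?_⟩
  have hsub := (schrodingerGraph _).sub_mem (hgraph (f - (c - k ^ 2) • u)) huf
  by_contra hne
  refine he ⟨R₀ (S (f - (c - k ^ 2) • u)) - u, sub_ne_zero.2 hne, ?_⟩
  rw [Prod.mk_sub_mk] at hsub
  convert! hsub using 2
  rw [smul_sub]
  abel

end Fredholm

/-! ### Symmetry and the discrete spectrum -/

section Symmetry

open scoped ComplexConjugate

variable {W : ℝ → ℝ} {c : ℝ}

theorem greenKernel_apply (k : ℂ) (s : ℝ) :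
    greenKernel k s = (2 * k)⁻¹ * Complex.exp (-k * |s|) := by
  rcases le_or_gt s 0 with hs | hs
  · simp [greenKernel, expKernel, piecewise, hs, abs_of_nonpos]
  · simp [greenKernel, expKernel, piecewise, hs.not_ge, abs_of_pos hs]

theorem inner_freeResolvent {k : ℂ} (hk : 0 < k.re) (hk' : conj k = k) (f g : L2) :
    inner ℂ f (freeResolvent hk g) = inner ℂ (freeResolvent hk f) g := by
  refine inner_convolutionOperator _ _ _ _ (fun s => ?_) f g
  simp [greenKernel_apply, ← Complex.exp_conj, hk']

theorem inner_mulOperator (hW : MemLp W ⊤) (f g : L2) :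
    inner ℂ f (mulOperator hW g) = inner ℂ (mulOperator hW f) g := by
  rw [L2.inner_def, L2.inner_def]
  refine integral_congr_ae ?_
  filter_upwards [coeFn_mulOperator hW f, coeFn_mulOperator hW g] with x h1 h2
  rw [h1, h2]
  simp [mul_left_comm, mul_assoc]

theorem inner_schrodingerGraph (hW : MemLp W ⊤) {u f v g : L2}
    (h : (u, f) ∈ schrodingerGraph fun x => c + W x)
    (h' : (v, g) ∈ schrodingerGraph fun x => c + W x) : inner ℂ u g = inner ℂ f v := by
  have hk : 0 < (1 : ℂ).re := by norm_num
  have hu := (mem_schrodingerGraph_iff_eq_freeResolvent hW hk).1 h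
  have hv := (mem_schrodingerGraph_iff_eq_freeResolvent hW hk).1 h'
  have hR := inner_freeResolvent hk (map_one _) (f - (c - 1 ^ 2 : ℂ) • u - mulOperator hW u)
    (g - (c - 1 ^ 2 : ℂ) • v - mulOperator hW v)
  rw [← hu, ← hv] at hR
  simp only [inner_sub_left, inner_sub_right, inner_smul_left, inner_smul_right,
    inner_mulOperator hW u v, map_sub, map_pow, map_one, Complex.conj_ofReal] at hR
  linear_combination -hR

theorem IsEigenvalue.conj_eq (hW : MemLp W ⊤) {z : ℂ}
    (h : IsEigenvalue (fun x => c + W x) z) : conj z = z := by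
  obtain ⟨u, hu, hg⟩ := h
  have hsymm := inner_schrodingerGraph hW hg hg
  rw [inner_smul_left, inner_smul_right] at hsymm
  exact (mul_right_cancel₀ (inner_self_ne_zero.2 hu) hsymm).symm

theorem inner_eq_zero_of_ne (hW : MemLp W ⊤) {z ζ : ℂ} (hne : z ≠ ζ) {u v : L2}
    (hu : (u, z • u) ∈ schrodingerGraph fun x => c + W x)
    (hv : (v, ζ • v) ∈ schrodingerGraph fun x => c + W x) : inner ℂ u v = 0 := by
  by_cases hu0 : u = 0
  · rw [hu0, inner_zero_left]
  have hsymm := inner_schrodingerGraph hW hu hv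
  rw [inner_smul_left, inner_smul_right, IsEigenvalue.conj_eq hW ⟨u, hu0, hu⟩, ← sub_eq_zero,
    ← sub_mul] at hsymm
  exact (mul_eq_zero.1 hsymm).resolve_left (sub_ne_zero.2 hne.symm)

theorem IsEigenvalue.exists_norm_eq_one {U : ℝ → ℝ} {z : ℂ} (h : IsEigenvalue U z) :
    ∃ u : L2, ‖u‖ = 1 ∧ (u, z • u) ∈ schrodingerGraph U := by
  obtain ⟨u, hu, hg⟩ := h
  refine ⟨(‖u‖ : ℂ)⁻¹ • u, by simp [norm_smul, norm_ne_zero_iff.2 hu], ?_⟩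
  rw [smul_comm]
  exact (schrodingerGraph U).smul_mem _ hg

theorem exists_tendsto_subseq_of_eigenvectors (hW : MemLp W ⊤) (hW2 : MemLp W 2) {z : ℂ}
    (hz : z ∉ Complex.ofReal '' Ici c) {ζ : ℕ → ℂ} (hζ : Tendsto ζ atTop (𝓝 z))
    {u : ℕ → L2} (hu : ∀ n, ‖u n‖ ≤ 1)
    (hg : ∀ n, (u n, ζ n • u n) ∈ schrodingerGraph fun x => c + W x) :
    ∃ v : L2, (v, z • v) ∈ (schrodingerGraph fun x => c + W x) ∧
      ∃ φ : ℕ → ℕ, StrictMono φ ∧ Tendsto (fun n => u (φ n)) atTop (𝓝 v) := by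
  obtain ⟨k, hk, rfl⟩ := exists_re_pos_sq_eq hz
  let R₀ := freeResolvent hk
  let M := mulOperator hW
  let g : ℕ → L2 := fun n => ζ n • u n - (c - k ^ 2 : ℂ) • u n - M (u n)
  have hug : ∀ n, u n = R₀ (g n) := fun n =>
    (mem_schrodingerGraph_iff_eq_freeResolvent hW hk).1 (hg n)
  have hsub : ∀ n, g n = (ζ n - (c - k ^ 2)) • u n - M (u n) := fun n => by
    rw [sub_smul]
  have hζ0 : Tendsto (fun n => ‖ζ n - (c - k ^ 2)‖) atTop (𝓝 0) :=
    tendsto_iff_norm_sub_tendsto_zero.1 hζ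
  have hsmul : ∀ n, ‖(ζ n - (c - k ^ 2)) • u n‖ ≤ ‖ζ n - (c - k ^ 2)‖ := fun n => by
    rw [norm_smul]
    exact mul_le_of_le_one_right (norm_nonneg _) (hu n)
  obtain ⟨B, hB⟩ := hζ0.bddAbove_range
  obtain ⟨w, φ, hφ, hlim⟩ := exists_tendsto_subseq_of_isCompactOperator
    (isCompactOperator_mulOperator_freeResolvent hW hW2 hk) (f := g) (r := B + ‖M‖) fun n => by
      rw [hsub]
      exact (norm_sub_le _ _).trans (add_le_add ((hsmul n).trans (hB (mem_range_self n)))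
        ((M.le_opNorm _).trans (mul_le_of_le_one_right (norm_nonneg _) (hu n))))
  replace hlim : Tendsto (fun n => M (u (φ n))) atTop (𝓝 w) :=
    hlim.congr fun n => congrArg M (hug (φ n)).symm
  have hul : Tendsto (fun n => u (φ n)) atTop (𝓝 (R₀ (0 - w))) := by
    have hgl := ((squeeze_zero_norm hsmul hζ0).comp hφ.tendsto_atTop).sub hlim
    refine ((R₀.continuous.tendsto _).comp hgl).congr fun n => ?_
    rw [hug (φ n), hsub]
    rfl
  refine ⟨_, ?_, φ, hφ, hul⟩
  rw [mem_schrodingerGraph_iff_eq_freeResolvent hW hk, sub_self,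
    tendsto_nhds_unique ((M.continuous.tendsto _).comp hul) hlim]

theorem finiteDimensional_ker_shift (hW : MemLp W ⊤) (hW2 : MemLp W 2) {z : ℂ}
    (hz : z ∉ Complex.ofReal '' Ici c) :
    FiniteDimensional ℂ (LinearMap.ker (shift (schrodinger fun x => c + W x) z)) := by
  refine FiniteDimensional.of_isCompact_closedBall₀ ℂ one_pos (IsSeqCompact.isCompact ?_)
  intro x hx
  obtain ⟨v, hv, φ, hφ, hlim⟩ := exists_tendsto_subseq_of_eigenvectors hW hW2 hz
    (tendsto_const_nhds (x := z)) (u := fun n => ((x n : (schrodinger _).domain) : L2))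
    (fun n => by simpa using hx n) fun n => mem_ker_shift_iff.1 (x n).2
  obtain ⟨y, rfl, -⟩ := exists_domain_of_mem_graph hv
  have hlim' : Tendsto (x ∘ φ) atTop (𝓝 ⟨y, mem_ker_shift_iff.2 hv⟩) :=
    tendsto_subtype_rng.2 (tendsto_subtype_rng.2 hlim)
  exact ⟨_, Metric.isClosed_closedBall.mem_of_tendsto hlim' (.of_forall fun n => hx _),
    φ, hφ, hlim'⟩

theorem isClosed_ofReal_image_Ici (c : ℝ) : IsClosed (Complex.ofReal '' Ici c) :=
  Complex.isometry_ofReal.isClosedEmbedding.isClosedMap _ isClosed_Ici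

theorem not_tendsto_of_isEigenvalue (hW : MemLp W ⊤) (hW2 : MemLp W 2) {z : ℂ}
    (hz : z ∉ Complex.ofReal '' Ici c) {ζ : ℕ → ℂ} (hne : ∀ n, ζ n ≠ z)
    (hζ : ∀ n, IsEigenvalue (fun x => c + W x) (ζ n)) : ¬ Tendsto ζ atTop (𝓝 z) := by
  intro hlim
  choose u hu hg using fun n => (hζ n).exists_norm_eq_one
  obtain ⟨v, hv, φ, -, huv⟩ :=
    exists_tendsto_subseq_of_eigenvectors hW hW2 hz hlim (fun n => (hu n).le) hg
  have hnorm : ‖v‖ = 1 := tendsto_nhds_unique huv.norm (by simp [hu])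
  have h0 : Tendsto (fun n => inner ℂ v (u (φ n))) atTop (𝓝 (inner ℂ v v)) :=
    (tendsto_const_nhds (x := v)).inner huv
  simp only [inner_eq_zero_of_ne hW (hne _).symm hv (hg _)] at h0
  have hv0 := inner_self_eq_zero.1 (tendsto_nhds_unique h0 tendsto_const_nhds)
  simp [hv0] at hnorm

theorem exists_spectrum_inter_ball_subset (hW : MemLp W ⊤) (hW2 : MemLp W 2) {z : ℂ}
    (hz : z ∉ Complex.ofReal '' Ici c) :
    ∃ ε > 0, spectrum (schrodinger fun x => c + W x) ∩ Metric.ball z ε ⊆ {z} := by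
  obtain ⟨δ, hδ, hball⟩ := Metric.isOpen_iff.1 (isClosed_ofReal_image_Ici c).isOpen_compl z hz
  by_contra! hcon
  have hex : ∀ n : ℕ, ∃ ζ : ℂ, dist ζ z < 1 / ((n : ℝ) + 1) ∧ ζ ≠ z ∧
      IsEigenvalue (fun x => c + W x) ζ := fun n => by
    obtain ⟨ζ, ⟨hs, hζ⟩, hne⟩ := not_subset.1
      (hcon (min δ (1 / ((n : ℝ) + 1))) (lt_min hδ (by positivity)))
    refine ⟨ζ, hζ.trans_le (min_le_right _ _), hne, ?_⟩
    by_contra he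
    exact hs (mem_resolventSet_of_not_isEigenvalue hW hW2
      (hball (Metric.ball_subset_ball (min_le_left _ _) hζ)) he)
  choose ζ hd hne he using hex
  refine not_tendsto_of_isEigenvalue hW hW2 hz hne he ?_
  rw [tendsto_iff_dist_tendsto_zero]
  exact squeeze_zero (fun _ => dist_nonneg) (fun n => (hd n).le)
    tendsto_one_div_add_atTop_nhds_zero_nat

theorem mem_discreteSpectrum_of_isEigenvalue (hW : MemLp W ⊤) (hW2 : MemLp W 2) {z : ℂ}
    (hz : z ∉ Complex.ofReal '' Ici c) (h : IsEigenvalue (fun x => c + W x) z) :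
    z ∈ discreteSpectrum (schrodinger fun x => c + W x) :=
  ⟨h.mem_spectrum, exists_spectrum_inter_ball_subset hW hW2 hz, ker_shift_ne_bot_iff.2 h,
    finiteDimensional_ker_shift hW hW2 hz⟩

theorem denseRange_shift (hW : MemLp W ⊤) {z μ : ℂ} (hz : conj z = z) (hμ : conj μ = μ)
    (hμr : μ ∈ resolventSet (schrodinger fun x => c + W x))
    (he : ¬ IsEigenvalue (fun x => c + W x) z) :
    DenseRange (shift (schrodinger fun x => c + W x) z) := by
  obtain ⟨R, hR, -⟩ := mem_resolventSet_iff.1 hμr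
  rw [DenseRange, ← LinearMap.coe_range, Submodule.dense_iff_topologicalClosure_eq_top,
    Submodule.topologicalClosure_eq_top_iff, Submodule.eq_bot_iff]
  intro g hg
  have hgz : ∀ u f, (u, f) ∈ (schrodingerGraph fun x => c + W x) →
      inner ℂ (f - z • u) g = 0 := fun u f huf => by
    obtain ⟨x, rfl, rfl⟩ := exists_domain_of_mem_graph huf
    exact (Submodule.mem_orthogonal _ _).1 hg _ ⟨x, rfl⟩
  have horth : ∀ y, inner ℂ y (g - (z - μ) • R g) = 0 := fun y => by
    have h1 := hgz _ _ (hR y)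
    have h2 := inner_schrodingerGraph hW (hR y) (hR g)
    simp only [inner_sub_left, inner_add_left, inner_smul_left, inner_sub_right,
      inner_add_right, inner_smul_right, hz, hμ] at h1 h2 ⊢
    linear_combination h1 + (z - μ) * h2
  have hgR : g = (z - μ) • R g := sub_eq_zero.1 (inner_self_eq_zero.1 (horth _))
  by_contra hg0
  refine he ⟨g, hg0, ?_⟩
  have hmem := (schrodingerGraph _).smul_mem (z - μ) (hR g)
  rwa [Prod.smul_mk, smul_add, smul_comm (z - μ) μ, ← hgR, ← add_smul, sub_add_cancel] at hmem

end Symmetry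

/-! ### Classical solutions -/

section Classical

variable {U : ℝ → ℝ} {u f : L2} {F F₁ F₂ : ℝ → ℂ}

theorem exists_hasDerivAt_of_mem_schrodingerGraph (hU : Continuous U) {z : ℂ}
    (h : (u, z • u) ∈ schrodingerGraph U) :
    ∃ F F₁ : ℝ → ℂ, u =ᵐ[volume] F ∧ (∀ x, HasDerivAt F (F₁ x) x) ∧
      (∀ x, HasDerivAt F₁ ((U x - z) * F x) x) ∧ MemLp F 2 ∧ MemLp F₁ 2 := by
  obtain ⟨g, h, hg, hh, hf⟩ := h
  obtain ⟨F, hF, hFc, hFg⟩ := hg.exists_isPrimitive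
  obtain ⟨F₁, hF₁, hF₁c, hF₁h⟩ := hh.exists_isPrimitive
  have hh' : h =ᵐ[volume] fun x => (U x - z) * F x := by
    filter_upwards [hF, hf, Lp.coeFn_smul z u] with x h1 h2 h3
    rw [h3, Pi.smul_apply, smul_eq_mul, h1] at h2
    linear_combination h2
  exact ⟨F, F₁, hF, (hFg.congr_ae hF₁).hasDerivAt hF₁c,
    (hF₁h.congr_ae hh').hasDerivAt (by fun_prop),
    (memLp_congr_ae hF).1 (Lp.memLp u), (memLp_congr_ae hF₁).1 (Lp.memLp g)⟩

theorem isWeakDeriv_of_hasDerivAt (hu : u =ᵐ[volume] F) (hf : f =ᵐ[volume] F₁)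
    (hF : ∀ x, HasDerivAt F (F₁ x) x) (hF₁ : Continuous F₁) : IsWeakDeriv u f :=
  ((isPrimitive_of_hasDerivAt hF hF₁).congr_ae hf.symm).isWeakDeriv hu

theorem mem_schrodingerGraph_of_hasDerivAt (hu : u =ᵐ[volume] F)
    (hF : ∀ x, HasDerivAt F (F₁ x) x) (hF₁ : ∀ x, HasDerivAt F₁ (F₂ x) x) (hF₂ : Continuous F₂)
    (h₁ : MemLp F₁ 2) (h₂ : MemLp F₂ 2) (hf : f =ᵐ[volume] fun x => -F₂ x + U x * F x) :
    (u, f) ∈ schrodingerGraph U := by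
  have hF₁c : Continuous F₁ := continuous_iff_continuousAt.2 fun x => (hF₁ x).continuousAt
  refine ⟨h₁.toLp, h₂.toLp, isWeakDeriv_of_hasDerivAt hu h₁.coeFn_toLp hF hF₁c,
    isWeakDeriv_of_hasDerivAt h₁.coeFn_toLp h₂.coeFn_toLp hF₁ hF₂, ?_⟩
  filter_upwards [hu, hf, h₂.coeFn_toLp] with x h1 h2 h3
  rw [h1, h2, h3]

theorem eq_zero_of_hasDerivAt_of_eq_zero {𝕜 : Type*} [RCLike 𝕜] {q F F₁ : ℝ → 𝕜} {K : ℝ}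
    (hq : ∀ x, ‖q x‖ ≤ K) (hF : ∀ x, HasDerivAt F (F₁ x) x)
    (hF₁ : ∀ x, HasDerivAt F₁ (q x * F x) x) {a : ℝ} (h0 : F a = 0) (h1 : F₁ a = 0) (x : ℝ) :
    F x = 0 := by
  have hlip : ∀ t, LipschitzWith (max 1 K).toNNReal fun p : 𝕜 × 𝕜 => (p.2, q t * p.1) := by
    refine fun t => LipschitzWith.of_dist_le_mul fun p p' => ?_
    rw [dist_eq_norm, dist_eq_norm, Real.coe_toNNReal _ (by positivity)]
    refine norm_prod_le_iff.2 ⟨?_, ?_⟩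
    · exact (norm_snd_le (p - p')).trans
        (le_mul_of_one_le_left (norm_nonneg _) (le_max_left _ _))
    · simp only [Prod.snd_sub, ← mul_sub, norm_mul]
      exact mul_le_mul ((hq t).trans (le_max_right _ _)) (norm_fst_le (p - p'))
        (norm_nonneg _) (by positivity)
  have h := ODE_solution_unique_univ (s := fun _ => univ) (f := fun t => (F t, F₁ t))
    (g := fun _ => (0 : 𝕜 × 𝕜)) (t₀ := a) (fun t => (hlip t).lipschitzOnWith)
    (fun t => ⟨(hF t).prodMk (hF₁ t), mem_univ _⟩)
    (fun t => ⟨(hasDerivAt_const t (0 : 𝕜 × 𝕜)).congr_deriv (by ext <;> simp), mem_univ _⟩)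
    (by simp [h0, h1])
  exact congrArg Prod.fst (congrFun h x)

theorem tendsto_zero_atTop_of_memLp_two (hF : ∀ x, HasDerivAt F (F₁ x) x) (h : MemLp F 2)
    (h₁ : MemLp F₁ 2) : Tendsto F atTop (𝓝 0) := by
  have hint : Integrable fun x => 2 * inner ℝ (F x) (F₁ x) := by
    refine Integrable.const_mul ((h.integrable_mul h₁.star).re.congr (.of_forall fun x => ?_)) 2
    simp [Complex.inner]
    ring
  have hsq : Tendsto (fun x => ‖F x‖ ^ 2) atTop (𝓝 0) :=
    tendsto_zero_of_hasDerivAt_of_integrableOn_Ioi (a := 0) (fun x _ => (hF x).norm_sq)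
      hint.integrableOn ((memLp_two_iff_integrable_sq_norm h.1).1 h).integrableOn
  rw [tendsto_zero_iff_norm_tendsto_zero]
  simpa [Real.sqrt_sq (norm_nonneg _)] using hsq.sqrt

end Classical

/-! ### Absence of embedded eigenvalues -/

/-- Short-range potentials: bounded continuous functions with finite first moment. Boundedness
keeps the multiplication operator bounded, the moment excludes an eigenvalue at the threshold of
the continuous spectrum. -/
structure IsShortRange (W : ℝ → ℝ) : Prop where
  continuous : Continuous W
  exists_bound : ∃ C, ∀ x, |W x| ≤ C
  integrable_weight_mul : Integrable fun x => (1 + |x|) * W x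

namespace IsShortRange

variable {W : ℝ → ℝ}

theorem integrable (hW : IsShortRange W) : Integrable W :=
  hW.integrable_weight_mul.mono hW.continuous.aestronglyMeasurable <| .of_forall fun x => by
    rw [norm_mul, Real.norm_of_nonneg (by positivity : (0 : ℝ) ≤ 1 + |x|)]
    exact le_mul_of_one_le_left (norm_nonneg _) (le_add_of_nonneg_right (abs_nonneg x))

theorem memLp_top (hW : IsShortRange W) : MemLp W ⊤ := by
  obtain ⟨C, hC⟩ := hW.exists_bound
  exact memLp_top_of_bound hW.continuous.aestronglyMeasurable C (.of_forall hC)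

theorem memLp_two (hW : IsShortRange W) : MemLp W 2 := by
  obtain ⟨C, hC⟩ := hW.exists_bound
  refine (memLp_two_iff_integrable_sq hW.continuous.aestronglyMeasurable).2 ?_
  simp only [sq]
  exact hW.integrable.bdd_mul hW.continuous.aestronglyMeasurable (.of_forall hC)

end IsShortRange

section Embedded

variable {W : ℝ → ℝ} {κ : ℝ} {F F₁ : ℝ → ℂ}

theorem sq_norm_add_sq_norm_le_mul_exp (hWc : Continuous W) (hWi : Integrable W) (hκ : 0 < κ)
    (hF : ∀ x, HasDerivAt F (F₁ x) x)
    (hF₁ : ∀ x, HasDerivAt F₁ (((W x - κ ^ 2 : ℝ) : ℂ) * F x) x) {x y : ℝ} (hxy : x ≤ y) :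
    ‖F₁ x‖ ^ 2 + κ ^ 2 * ‖F x‖ ^ 2 ≤
      (‖F₁ y‖ ^ 2 + κ ^ 2 * ‖F y‖ ^ 2) * Real.exp ((∫ t, |W t|) / κ) := by
  set e : ℝ → ℝ := fun y => ‖F₁ y‖ ^ 2 + κ ^ 2 * ‖F y‖ ^ 2 with he
  set w : ℝ → ℝ := fun y => Real.exp ((∫ t in x..y, |W t|) / κ)
  have he' : ∀ y, HasDerivAt e (2 * W y * inner ℝ (F y) (F₁ y)) y := fun y => by
    refine ((hF₁ y).norm_sq.add ((hF y).norm_sq.const_mul (κ ^ 2))).congr_deriv ?_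
    rw [← Complex.real_smul, inner_smul_right, real_inner_comm]
    ring
  have hw' : ∀ y, HasDerivAt w (w y * (|W y| / κ)) y := fun y =>
    ((hWc.abs.integral_hasStrictDerivAt x y).hasDerivAt.div_const κ).exp
  have hbound : ∀ y, |2 * W y * inner ℝ (F y) (F₁ y)| ≤ e y * (|W y| / κ) := fun y => by
    have hAMGM : 2 * (‖F y‖ * ‖F₁ y‖) * κ ≤ e y := by
      simp only [he]
      nlinarith [sq_nonneg (‖F₁ y‖ - κ * ‖F y‖)]
    rw [← mul_div_assoc, le_div_iff₀ hκ, abs_mul, abs_mul, abs_two]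
    calc 2 * |W y| * |inner ℝ (F y) (F₁ y)| * κ ≤ 2 * |W y| * (‖F y‖ * ‖F₁ y‖) * κ := by
          gcongr
          exact abs_real_inner_le_norm _ _
      _ = 2 * (‖F y‖ * ‖F₁ y‖) * κ * |W y| := by ring
      _ ≤ e y * |W y| := by gcongr
  have hmono : Monotone fun y => e y * w y :=
    monotone_of_hasDerivAt_nonneg (fun y => (he' y).mul (hw' y)) fun y => by
      have hnonneg := mul_nonneg (neg_le_iff_add_nonneg.1 (neg_le_of_abs_le (hbound y)))
        (Real.exp_pos ((∫ t in x..y, |W t|) / κ)).le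
      exact hnonneg.trans_eq (by ring)
  calc e x = e x * w x := by simp [w]
    _ ≤ e y * w y := hmono hxy
    _ ≤ e y * Real.exp ((∫ t, |W t|) / κ) := by
      simp only [w, intervalIntegral.integral_of_le hxy]
      gcongr e y * Real.exp (?_ / κ)
      exact setIntegral_le_integral hWi.abs (.of_forall fun t => abs_nonneg _)

theorem eq_zero_of_memLp_two_of_pos (hWc : Continuous W) (hWi : Integrable W) (hκ : 0 < κ)
    (hF : ∀ x, HasDerivAt F (F₁ x) x)
    (hF₁ : ∀ x, HasDerivAt F₁ (((W x - κ ^ 2 : ℝ) : ℂ) * F x) x) (h : MemLp F 2)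
    (h₁ : MemLp F₁ 2) (x : ℝ) : F x = 0 := by
  set e : ℝ → ℝ := fun y => ‖F₁ y‖ ^ 2 + κ ^ 2 * ‖F y‖ ^ 2
  have hint : Integrable fun y => e y * Real.exp ((∫ t, |W t|) / κ) :=
    (((memLp_two_iff_integrable_sq_norm h₁.1).1 h₁).add
      (((memLp_two_iff_integrable_sq_norm h.1).1 h).const_mul _)).mul_const _
  have hconst : IntegrableOn (fun _ => e x) (Ioi x) :=
    Integrable.mono hint.integrableOn aestronglyMeasurable_const <| by
      filter_upwards [ae_restrict_mem measurableSet_Ioi] with y hy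
      have hle := sq_norm_add_sq_norm_le_mul_exp hWc hWi hκ hF hF₁ (mem_Ioi.1 hy).le
      rwa [Real.norm_of_nonneg (by positivity), Real.norm_of_nonneg (by positivity)]
  have he : e x = 0 := by simpa using (integrableOn_const_iff).1 hconst
  have hκF : κ ^ 2 * ‖F x‖ ^ 2 = 0 :=
    ((add_eq_zero_iff_of_nonneg (sq_nonneg _) (by positivity)).1 he).2
  simpa [hκ.ne'] using hκF

theorem norm_deriv_le_of_norm_le (hWc : Continuous W) (hWi : Integrable W)
    (hFc : Continuous F) (hF₁ : ∀ x, HasDerivAt F₁ (W x * F x) x)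
    (hlim : Tendsto F₁ atTop (𝓝 0)) {M y : ℝ} (hM : ∀ x, y ≤ x → ‖F x‖ ≤ M) :
    ‖F₁ y‖ ≤ M * ∫ t in Ioi y, |W t| := by
  have hle : ∀ z, y ≤ z → ‖F₁ z - F₁ y‖ ≤ M * ∫ t in Ioi y, |W t| := fun z hyz => by
    have hint : IntervalIntegrable (fun t => M * |W t|) volume y z :=
      (hWi.abs.const_mul M).intervalIntegrable
    rw [isPrimitive_of_hasDerivAt hF₁ (by fun_prop) y z]
    refine (intervalIntegral.norm_integral_le_of_norm_le hyz (.of_forall fun t ht => ?_)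
      hint).trans ?_
    · rw [norm_mul, Complex.norm_real, Real.norm_eq_abs, mul_comm]
      gcongr
      exact hM t ht.1.le
    · rw [intervalIntegral.integral_const_mul, intervalIntegral.integral_of_le hyz]
      gcongr
      · exact (norm_nonneg _).trans (hM y le_rfl)
      · exact .of_forall fun t => abs_nonneg _
      · exact hWi.abs.integrableOn
      · exact Ioc_subset_Ioi_self
  have hlim' : Tendsto (fun z => ‖F₁ z - F₁ y‖) atTop (𝓝 ‖0 - F₁ y‖) :=
    (hlim.sub_const _).norm
  simpa using le_of_tendsto hlim' ((eventually_ge_atTop y).mono hle)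

theorem eq_sub_mul_deriv_add_integral {F₂ : ℝ → ℂ} (hF : ∀ x, HasDerivAt F (F₁ x) x)
    (hF₁ : ∀ x, HasDerivAt F₁ (F₂ x) x) (hF₂ : Continuous F₂) (x y : ℝ) :
    F x = F y - ((y - x : ℝ) : ℂ) * F₁ y + ∫ t in x..y, ((t - x : ℝ) : ℂ) * F₂ t := by
  have hG : ∀ t : ℝ, HasDerivAt (fun t : ℝ => F t - ((t - x : ℝ) : ℂ) * F₁ t)
      (-(((t - x : ℝ) : ℂ) * F₂ t)) t := fun t => by
    have hx := ((hasDerivAt_id' t).sub_const x).ofReal_comp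
    refine ((hF t).sub (hx.mul (hF₁ t))).congr_deriv ?_
    push_cast
    ring
  have hint := isPrimitive_of_hasDerivAt hG (by fun_prop) x y
  simp only [intervalIntegral.integral_neg, sub_self, Complex.ofReal_zero, zero_mul,
    sub_zero] at hint
  linear_combination -hint

theorem mul_abs_le_abs_weight_mul {r t : ℝ} (hrt : r ≤ t) :
    r * |W t| ≤ |(1 + |t|) * W t| := by
  rw [abs_mul, abs_of_nonneg (by positivity : (0 : ℝ) ≤ 1 + |t|)]
  gcongr
  linarith [le_abs_self t]

theorem norm_le_mul_integral_of_norm_le (hW : IsShortRange W)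
    (hF : ∀ x, HasDerivAt F (F₁ x) x) (hF₁ : ∀ x, HasDerivAt F₁ (W x * F x) x)
    (hlim : Tendsto F atTop (𝓝 0)) (hlim₁ : Tendsto F₁ atTop (𝓝 0)) {M x : ℝ} (hx : 0 ≤ x)
    (hM : ∀ y, x ≤ y → ‖F y‖ ≤ M) :
    ‖F x‖ ≤ M * ∫ t in Ioi x, |(1 + |t|) * W t| := by
  have hWc := hW.continuous
  have hFc : Continuous F := continuous_iff_continuousAt.2 fun x => (hF x).continuousAt
  have hM0 : 0 ≤ M := (norm_nonneg _).trans (hM x le_rfl)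
  have hi := hW.integrable_weight_mul.abs
  have hle : ∀ y, x ≤ y → ‖F x‖ ≤ ‖F y‖ + M * ∫ t in Ioi x, |(1 + |t|) * W t| := by
    intro y hxy
    have hyx := sub_nonneg.2 hxy
    have htail : ‖((y - x : ℝ) : ℂ) * F₁ y‖ ≤ M * ∫ t in Ioi y, |(1 + |t|) * W t| := by
      rw [norm_mul, Complex.norm_real, Real.norm_of_nonneg hyx]
      calc (y - x) * ‖F₁ y‖ ≤ (y - x) * (M * ∫ t in Ioi y, |W t|) := by
            gcongr
            exact norm_deriv_le_of_norm_le hWc hW.integrable hFc hF₁ hlim₁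
              fun t ht => hM t (hxy.trans ht)
        _ = M * ∫ t in Ioi y, (y - x) * |W t| := by
            rw [integral_const_mul]
            ring
        _ ≤ _ := by
            gcongr M * ?_
            exact setIntegral_mono_on (hW.integrable.abs.const_mul _).integrableOn
              hi.integrableOn measurableSet_Ioi fun t ht =>
                mul_abs_le_abs_weight_mul (by linarith [mem_Ioi.1 ht])
    have hbulk : ‖∫ t in x..y, ((t - x : ℝ) : ℂ) * (W t * F t)‖ ≤
        M * ∫ t in x..y, |(1 + |t|) * W t| := by
      rw [← intervalIntegral.integral_const_mul]
      refine intervalIntegral.norm_integral_le_of_norm_le hxy (.of_forall fun t ht => ?_)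
        (hi.const_mul M).intervalIntegrable
      have htx := sub_nonneg.2 ht.1.le
      rw [norm_mul, norm_mul, Complex.norm_real, Complex.norm_real, ← mul_assoc, mul_comm,
        Real.norm_of_nonneg htx, Real.norm_eq_abs]
      exact mul_le_mul (hM t ht.1.le) (mul_abs_le_abs_weight_mul (by linarith))
        (mul_nonneg htx (abs_nonneg _)) hM0
    rw [← intervalIntegral.integral_interval_add_Ioi (b := y) hi.integrableOn hi.integrableOn,
      mul_add, eq_sub_mul_deriv_add_integral hF hF₁ (by fun_prop) x y]
    refine (norm_add_le _ _).trans ?_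
    linarith [norm_sub_le (F y) (((y - x : ℝ) : ℂ) * F₁ y)]
  have hright := hlim.norm.add_const (M * ∫ t in Ioi x, |(1 + |t|) * W t|)
  simpa using ge_of_tendsto hright ((eventually_ge_atTop x).mono hle)

/-- Beyond `x₀` the half moment of `W` is at most `1 / 2`, which forces the supremum of `‖F‖` on
`[x₀, ∞)` to be at most half of itself. -/
theorem eq_zero_of_memLp_two_of_zero (hW : IsShortRange W) (hF : ∀ x, HasDerivAt F (F₁ x) x)
    (hF₁ : ∀ x, HasDerivAt F₁ (W x * F x) x) (h : MemLp F 2) (h₁ : MemLp F₁ 2) (x : ℝ) :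
    F x = 0 := by
  obtain ⟨C, hC⟩ := hW.exists_bound
  have hC' : ∀ x, ‖(W x : ℂ)‖ ≤ C := fun x => by simpa using hC x
  have hWc := hW.continuous
  have hFc : Continuous F := continuous_iff_continuousAt.2 fun x => (hF x).continuousAt
  have hF₂ : MemLp (fun x => (W x : ℂ) * F x) 2 := by
    refine h.of_le_mul (c := C) (by fun_prop) (.of_forall fun x => ?_)
    rw [norm_mul]
    gcongr
    exact hC' x
  have hlim := tendsto_zero_atTop_of_memLp_two hF h h₁
  have hlim₁ := tendsto_zero_atTop_of_memLp_two hF₁ h₁ hF₂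
  have hmoment : ∀ᶠ x in atTop, ∫ t in Ioi x, |(1 + |t|) * W t| ≤ 1 / 2 :=
    (tendsto_integral_Ioi_zero tendsto_id).eventually_le_const one_half_pos
  have hbdd : ∀ᶠ x in atTop, ‖F x‖ ≤ 1 := hlim.norm.eventually_le_const (by simp)
  obtain ⟨x₀, hx₀⟩ :=
    ((eventually_ge_atTop 0).and (hmoment.and hbdd)).exists_forall_of_atTop
  set M := sSup ((fun x => ‖F x‖) '' Ici x₀)
  have hM : ∀ x, x₀ ≤ x → ‖F x‖ ≤ M := fun x hx =>
    le_csSup ⟨1, forall_mem_image.2 fun x hx => (hx₀ x hx).2.2⟩ (mem_image_of_mem _ hx)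
  have hM0 : 0 ≤ M := (norm_nonneg _).trans (hM x₀ le_rfl)
  have hhalf : M ≤ M * (1 / 2) :=
    csSup_le (nonempty_Ici.image _) <| forall_mem_image.2 fun x hx =>
      (norm_le_mul_integral_of_norm_le hW hF hF₁ hlim hlim₁ (hx₀ x hx).1
        fun y hy => hM y (le_trans hx hy)).trans (by gcongr; exact (hx₀ x hx).2.1)
  have hFx : ∀ x, x₀ ≤ x → F x = 0 := fun x hx =>
    norm_le_zero_iff.1 ((hM x hx).trans (by linarith))
  have hF₁x : ‖F₁ x₀‖ ≤ 0 * ∫ t in Ioi x₀, |W t| :=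
    norm_deriv_le_of_norm_le hWc hW.integrable hFc hF₁ hlim₁ fun x hx => by simp [hFx x hx]
  exact eq_zero_of_hasDerivAt_of_eq_zero hC' hF hF₁ (hFx x₀ le_rfl) (by simpa using hF₁x) x

theorem not_isEigenvalue_of_le (hW : IsShortRange W) {c r : ℝ} (hr : c ≤ r) :
    ¬ IsEigenvalue (fun x => c + W x) r := by
  rintro ⟨u, hu, hg⟩
  have hWc := hW.continuous
  obtain ⟨F, F₁, huF, hF, hF₁, h, h₁⟩ :=
    exists_hasDerivAt_of_mem_schrodingerGraph (by fun_prop) hg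
  refine hu ((Lp.eq_zero_iff_ae_eq_zero).2 (huF.trans (.of_forall fun x => ?_)))
  obtain rfl | hlt := hr.eq_or_lt
  · exact eq_zero_of_memLp_two_of_zero hW hF (fun x => by simpa using hF₁ x) h h₁ x
  · refine eq_zero_of_memLp_two_of_pos hWc hW.integrable (Real.sqrt_pos.2 (sub_pos.2 hlt)) hF
      (fun x => (hF₁ x).congr_deriv ?_) h h₁ x
    rw [Real.sq_sqrt (sub_nonneg.2 hr)]
    push_cast
    ring

end Embedded

/-! ### Weyl sequences -/

section Weyl

variable {U W : ℝ → ℝ} {c κ ε : ℝ} {ψ ψ₁ : ℝ → ℂ}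

theorem mem_spectrum_of_forall_exists_norm_lt {z : ℂ} (h : ∀ δ > 0, ∃ u f : L2,
    (u, f) ∈ schrodingerGraph U ∧ ‖f - z • u‖ < δ * ‖u‖) :
    z ∈ spectrum (schrodinger U) := by
  intro hz
  obtain ⟨R, -, hR⟩ := mem_resolventSet_iff.1 hz
  obtain ⟨u, f, huf, hlt⟩ := h (‖R‖ + 1)⁻¹ (by positivity)
  have hle : ‖u‖ ≤ ‖R‖ * ‖f - z • u‖ := by simpa only [hR u f huf] using R.le_opNorm (f - z • u)
  rw [inv_mul_eq_div, lt_div_iff₀ (by positivity)] at hlt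
  linarith [norm_nonneg (f - z • u)]

/-- The wave packet of frequency `κ` with envelope `ψ` spread out over the length scale `ε⁻¹`; as
`ε → 0` these packets form a Weyl sequence for the point `c + κ²` of the spectrum. -/
def wavePacket (ψ : ℝ → ℂ) (κ ε x : ℝ) : ℂ := ψ (ε * x) * Complex.exp (κ * x * Complex.I)

theorem norm_wavePacket (ψ : ℝ → ℂ) (κ ε x : ℝ) : ‖wavePacket ψ κ ε x‖ = ‖ψ (ε * x)‖ := by
  rw [wavePacket, norm_mul, ← Complex.ofReal_mul, Complex.norm_exp_ofReal_mul_I, mul_one]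

theorem continuous_wavePacket (hψ : Continuous ψ) : Continuous (wavePacket ψ κ ε) := by
  unfold wavePacket
  fun_prop

theorem hasDerivAt_wavePacket (hψ : ∀ x, HasDerivAt ψ (ψ₁ x) x) (κ ε x : ℝ) :
    HasDerivAt (wavePacket ψ κ ε)
      (ε * wavePacket ψ₁ κ ε x + κ * Complex.I * wavePacket ψ κ ε x) x := by
  have hdil := (hψ (ε * x)).scomp x ((hasDerivAt_id' x).const_mul ε)
  have hexp := (((hasDerivAt_id' x).ofReal_comp.const_mul (κ : ℂ)).mul_const Complex.I).cexp
  refine (hdil.mul hexp).congr_deriv ?_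
  simp only [wavePacket, Complex.real_smul, Function.comp_apply]
  push_cast
  ring

theorem integral_sq_norm_wavePacket (hε : 0 < ε) :
    ∫ x, ‖wavePacket ψ κ ε x‖ ^ 2 = ε⁻¹ * ∫ x, ‖ψ x‖ ^ 2 := by
  simp only [norm_wavePacket]
  rw [Measure.integral_comp_mul_left (fun x => ‖ψ x‖ ^ 2), abs_of_pos (inv_pos.2 hε), smul_eq_mul]

theorem memLp_wavePacket (hψc : Continuous ψ) (hψ : MemLp ψ 2) (κ : ℝ) (hε : ε ≠ 0) :
    MemLp (wavePacket ψ κ ε) 2 := by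
  rw [memLp_two_iff_integrable_sq_norm (continuous_wavePacket hψc).aestronglyMeasurable]
  simp only [norm_wavePacket]
  exact ((memLp_two_iff_integrable_sq_norm hψ.1).1 hψ).comp_mul_left' hε

theorem norm_toLp_eq_sqrt {f : ℝ → ℂ} (hf : MemLp f 2) :
    ‖hf.toLp‖ = Real.sqrt (∫ x, ‖f x‖ ^ 2) := by
  rw [← Real.sqrt_sq (norm_nonneg hf.toLp), norm_sq_eq_integral_norm_sq]
  congr 1
  exact integral_congr_ae (hf.coeFn_toLp.mono fun x hx => by simp only [hx])

theorem sqrt_mul_norm_toLp_wavePacket (hψ : MemLp ψ 2) (hε : 0 < ε)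
    (h : MemLp (wavePacket ψ κ ε) 2 volume) : Real.sqrt ε * ‖h.toLp‖ = ‖hψ.toLp‖ := by
  rw [norm_toLp_eq_sqrt, norm_toLp_eq_sqrt, integral_sq_norm_wavePacket hε,
    ← Real.sqrt_mul hε.le, mul_inv_cancel_left₀ hε.ne']

theorem isWeakDeriv_wavePacket (hψ : ∀ x, HasDerivAt ψ (ψ₁ x) x) (hψ₁ : Continuous ψ₁)
    (h : MemLp (wavePacket ψ κ ε) 2 volume) (h₁ : MemLp (wavePacket ψ₁ κ ε) 2 volume) :
    IsWeakDeriv h.toLp ((ε : ℂ) • h₁.toLp + (κ * Complex.I) • h.toLp) := by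
  have hψc : Continuous ψ := continuous_iff_continuousAt.2 fun x => (hψ x).continuousAt
  have hc := continuous_wavePacket (κ := κ) (ε := ε) hψc
  have hc₁ := continuous_wavePacket (κ := κ) (ε := ε) hψ₁
  refine isWeakDeriv_of_hasDerivAt h.coeFn_toLp ?_ (hasDerivAt_wavePacket hψ κ ε) (by fun_prop)
  filter_upwards [Lp.coeFn_add ((ε : ℂ) • h₁.toLp) ((κ * Complex.I) • h.toLp),
    Lp.coeFn_smul (ε : ℂ) h₁.toLp, Lp.coeFn_smul (κ * Complex.I) h.toLp, h.coeFn_toLp,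
    h₁.coeFn_toLp] with x e1 e2 e3 e4 e5
  rw [e1, Pi.add_apply, e2, e3, Pi.smul_apply, Pi.smul_apply, e4, e5, smul_eq_mul, smul_eq_mul]

theorem norm_mulOperator_le_of_ae_norm_le (hW : MemLp W ⊤) (hW2 : MemLp W 2) {f : L2} {B : ℝ}
    (hf : ∀ᵐ x, ‖f x‖ ≤ B) : ‖mulOperator hW f‖ ≤ B * ‖hW2.toLp‖ := by
  refine Lp.norm_le_mul_norm_of_ae_le_mul ?_
  filter_upwards [hf, coeFn_mulOperator hW f, hW2.coeFn_toLp] with x h1 h2 h3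
  rw [h2, h3, norm_mul, Complex.norm_real, mul_comm]
  gcongr

theorem wavePacket_mem_schrodingerGraph (hW : MemLp W ⊤) {ψ₂ : ℝ → ℂ}
    (hψ : ∀ x, HasDerivAt ψ (ψ₁ x) x) (hψ₁ : ∀ x, HasDerivAt ψ₁ (ψ₂ x) x) (hψ₂ : Continuous ψ₂)
    (h : MemLp (wavePacket ψ κ ε) 2 volume) (h₁ : MemLp (wavePacket ψ₁ κ ε) 2 volume)
    (h₂ : MemLp (wavePacket ψ₂ κ ε) 2 volume) :
    (h.toLp, ((c + κ ^ 2 : ℝ) : ℂ) • h.toLp - (ε ^ 2 : ℂ) • h₂.toLp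
        - (2 * κ * ε * Complex.I) • h₁.toLp + mulOperator hW h.toLp) ∈
      schrodingerGraph fun x => c + W x := by
  have hψ₁c : Continuous ψ₁ := continuous_iff_continuousAt.2 fun x => (hψ₁ x).continuousAt
  have hd := isWeakDeriv_wavePacket hψ hψ₁c h h₁
  have hd₁ := isWeakDeriv_wavePacket hψ₁ hψ₂ h₁ h₂
  refine (mem_schrodingerGraph_iff_isWeakDeriv hW).2 ⟨_, hd, ?_⟩
  convert (hd₁.const_smul (ε : ℂ)).add (hd.const_smul (κ * Complex.I)) using 1
  have hI : (κ * Complex.I) • (κ * Complex.I) • h.toLp = -(κ ^ 2 : ℂ) • h.toLp := by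
    rw [smul_smul, ← sq, mul_pow, Complex.I_sq, mul_neg_one]
  push_cast
  linear_combination (norm := module) -hI

theorem sqrt_mul_norm_defect_le (hW : MemLp W ⊤) (hW2 : MemLp W 2) {ψ₂ : ℝ → ℂ}
    (hψ₁ : MemLp ψ₁ 2) (hψ₂ : MemLp ψ₂ 2) (hψb : ∀ x, ‖ψ x‖ ≤ 1)
    (hκ : 0 ≤ κ) (hε : 0 < ε) (h : MemLp (wavePacket ψ κ ε) 2 volume)
    (h₁ : MemLp (wavePacket ψ₁ κ ε) 2 volume) (h₂ : MemLp (wavePacket ψ₂ κ ε) 2 volume) :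
    Real.sqrt ε * ‖mulOperator hW h.toLp - (ε ^ 2 : ℂ) • h₂.toLp
        - (2 * κ * ε * Complex.I) • h₁.toLp‖
      ≤ ε ^ 2 * ‖hψ₂.toLp‖ + 2 * κ * ε * ‖hψ₁.toLp‖ + Real.sqrt ε * ‖hW2.toLp‖ := by
  have hmul : ‖mulOperator hW h.toLp‖ ≤ ‖hW2.toLp‖ := by
    refine (norm_mulOperator_le_of_ae_norm_le hW hW2 ?_).trans_eq (one_mul _)
    filter_upwards [h.coeFn_toLp] with x hx
    rw [hx, norm_wavePacket]
    exact hψb _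
  have h1 : ‖(2 * κ * ε * Complex.I) • h₁.toLp‖ = 2 * κ * ε * ‖h₁.toLp‖ := by
    rw [norm_smul, norm_mul, norm_mul, norm_mul, Complex.norm_I, Complex.norm_two,
      Complex.norm_of_nonneg hκ, Complex.norm_of_nonneg hε.le, mul_one]
  have h2 : ‖(ε ^ 2 : ℂ) • h₂.toLp‖ = ε ^ 2 * ‖h₂.toLp‖ := by
    rw [norm_smul, norm_pow, Complex.norm_of_nonneg hε.le]
  calc _ ≤ Real.sqrt ε * (‖hW2.toLp‖ + ε ^ 2 * ‖h₂.toLp‖ + 2 * κ * ε * ‖h₁.toLp‖) := by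
        gcongr
        refine (norm_sub_le _ _).trans (add_le_add ((norm_sub_le _ _).trans ?_) h1.le)
        exact add_le_add hmul h2.le
    _ = _ := by
        rw [← sqrt_mul_norm_toLp_wavePacket hψ₁ hε h₁, ← sqrt_mul_norm_toLp_wavePacket hψ₂ hε h₂]
        ring

theorem add_sq_mem_spectrum (hW : MemLp W ⊤) (hW2 : MemLp W 2) (hκ : 0 ≤ κ) {ψ₂ : ℝ → ℂ}
    (hd : ∀ x, HasDerivAt ψ (ψ₁ x) x) (hd₁ : ∀ x, HasDerivAt ψ₁ (ψ₂ x) x) (hψ₂c : Continuous ψ₂)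
    (hψ : MemLp ψ 2) (hψ₁ : MemLp ψ₁ 2) (hψ₂ : MemLp ψ₂ 2) (hψb : ∀ x, ‖ψ x‖ ≤ 1)
    (hψ0 : hψ.toLp ≠ 0) :
    ((c + κ ^ 2 : ℝ) : ℂ) ∈ spectrum (schrodinger fun x => c + W x) := by
  have hψc : Continuous ψ := continuous_iff_continuousAt.2 fun x => (hd x).continuousAt
  have hψ₁c : Continuous ψ₁ := continuous_iff_continuousAt.2 fun x => (hd₁ x).continuousAt
  refine mem_spectrum_of_forall_exists_norm_lt fun δ hδ => ?_
  have hlim : Tendsto (fun ε : ℝ => ε ^ 2 * ‖hψ₂.toLp‖ + 2 * κ * ε * ‖hψ₁.toLp‖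
      + Real.sqrt ε * ‖hW2.toLp‖) (𝓝[>] 0) (𝓝 0) := by
    refine (Continuous.tendsto' ?_ 0 0 (by simp)).mono_left nhdsWithin_le_nhds
    fun_prop
  obtain ⟨ε, hlt, hε : 0 < ε⟩ := ((hlim.eventually_lt_const
    (mul_pos hδ (norm_pos_iff.2 hψ0))).and self_mem_nhdsWithin).exists
  have h := memLp_wavePacket hψc hψ κ hε.ne'
  have h₁ := memLp_wavePacket hψ₁c hψ₁ κ hε.ne'
  have h₂ := memLp_wavePacket hψ₂c hψ₂ κ hε.ne'
  refine ⟨_, _, wavePacket_mem_schrodingerGraph hW hd hd₁ hψ₂c h h₁ h₂, ?_⟩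
  refine lt_of_mul_lt_mul_left ?_ (Real.sqrt_nonneg ε)
  have hdefect := sqrt_mul_norm_defect_le hW hW2 hψ₁ hψ₂ hψb hκ hε h h₁ h₂
  rw [mul_left_comm, sqrt_mul_norm_toLp_wavePacket hψ hε h]
  refine (le_of_eq ?_).trans_lt (hdefect.trans_lt hlt)
  congr 2
  module

theorem mem_spectrum_of_le (hW : MemLp W ⊤) (hW2 : MemLp W 2) {r : ℝ} (hr : c ≤ r) :
    (r : ℂ) ∈ spectrum (schrodinger fun x => c + W x) := by
  let χ : ContDiffBump (0 : ℝ) := ⟨1, 2, one_pos, one_lt_two⟩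
  let ψ : ℝ → ℂ := fun x => χ x
  have hψ : ContDiff ℝ 2 ψ := Complex.ofRealCLM.contDiff.comp χ.contDiff
  have hc : HasCompactSupport ψ := χ.hasCompactSupport.comp_left (g := Complex.ofReal) rfl
  have hψ1 : ContDiff ℝ 1 (deriv ψ) := (contDiff_succ_iff_deriv.1 hψ).2.2
  have hψ2 : Continuous (deriv (deriv ψ)) := hψ1.continuous_deriv le_rfl
  have hL := hψ.continuous.memLp_of_hasCompactSupport (p := 2) (μ := volume) hc
  have hne : hL.toLp ≠ 0 := fun h0 => by
    have hae : ψ =ᵐ[volume] 0 := (MemLp.toLp_eq_toLp_iff hL MemLp.zero).1 h0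
    have hψ0 : ψ 0 = 1 := Complex.ofReal_eq_one.2 (χ.one_of_mem_closedBall (by simp [χ]))
    have hzero : ψ = 0 := (hψ.continuous.ae_eq_iff_eq volume continuous_const).1 hae
    exact one_ne_zero (hψ0.symm.trans (congrFun hzero 0))
  have hb : ∀ x, ‖ψ x‖ ≤ 1 := fun x => (Complex.norm_of_nonneg χ.nonneg).trans_le χ.le_one
  have hmem := add_sq_mem_spectrum (c := c) hW hW2 (Real.sqrt_nonneg (r - c))
    (fun x => (hψ.differentiable two_ne_zero x).hasDerivAt)
    (fun x => (hψ1.differentiable one_ne_zero x).hasDerivAt) hψ2 hL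
    (hψ1.continuous.memLp_of_hasCompactSupport hc.deriv)
    (hψ2.memLp_of_hasCompactSupport hc.deriv.deriv) hb hne
  rwa [Real.sq_sqrt (sub_nonneg.2 hr), add_sub_cancel] at hmem

end Weyl

/-! ### Positivity of the resolvent -/

section Domination

/-- `f` is dominated by `g`, that is `|f| ≤ Re g` almost everywhere. -/
def Dominated (f g : L2) : Prop := ∀ᵐ x, ‖f x‖ ≤ (g x).re

/-- The absolute value of a function in `L²`. -/
def absL2 (f : L2) : L2 := ((Lp.memLp f).norm.ofReal (K := ℂ)).toLp

theorem coeFn_absL2 (f : L2) : absL2 f =ᵐ[volume] fun x => (‖f x‖ : ℂ) :=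
  ((Lp.memLp f).norm.ofReal (K := ℂ)).coeFn_toLp

theorem norm_absL2 (f : L2) : ‖absL2 f‖ = ‖f‖ := by
  have hae : ∀ᵐ x, ‖absL2 f x‖ = ‖f x‖ :=
    (coeFn_absL2 f).mono fun x hx => by rw [hx, Complex.norm_real, norm_norm]
  exact (Lp.norm_le_norm_of_ae_le (hae.mono fun _ => le_of_eq)).antisymm
    (Lp.norm_le_norm_of_ae_le (hae.mono fun _ => ge_of_eq))

theorem dominated_absL2 (f : L2) : Dominated f (absL2 f) :=
  (coeFn_absL2 f).mono fun x hx => by rw [hx, Complex.ofReal_re]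

theorem dominated_zero : Dominated 0 0 := by
  filter_upwards [Lp.coeFn_zero ℂ 2 (volume : Measure ℝ)] with x hx
  rw [hx, Pi.zero_apply, norm_zero, Complex.zero_re]

theorem Dominated.add {f g f' g' : L2} (h : Dominated f g) (h' : Dominated f' g') :
    Dominated (f + f') (g + g') := by
  filter_upwards [h, h', Lp.coeFn_add f f', Lp.coeFn_add g g'] with x h1 h2 h3 h4
  rw [h3, h4]
  exact (norm_add_le _ _).trans (add_le_add h1 h2)

theorem Dominated.sum {ι : Type*} {f g : ι → L2} (h : ∀ i, Dominated (f i) (g i))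
    (s : Finset ι) : Dominated (∑ i ∈ s, f i) (∑ i ∈ s, g i) := by
  classical
  induction s using Finset.induction_on with
  | empty => exact dominated_zero
  | insert i s hi ih =>
    rw [Finset.sum_insert hi, Finset.sum_insert hi]
    exact (h i).add ih

theorem re_inner_eq_integral (f g : L2) : (inner ℂ f g).re = ∫ x, (inner ℂ (f x) (g x)).re := by
  rw [L2.inner_def]
  exact (integral_re (L2.integrable_inner (𝕜 := ℂ) f g)).symm

theorem Dominated.re_inner_le {f g : L2} (h : Dominated f g) (v : L2) :
    (inner ℂ f v).re ≤ (inner ℂ g (absL2 v)).re := by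
  rw [re_inner_eq_integral, re_inner_eq_integral]
  refine integral_mono_ae (L2.integrable_inner (𝕜 := ℂ) f v).re
    (L2.integrable_inner (𝕜 := ℂ) g (absL2 v)).re ?_
  filter_upwards [h, coeFn_absL2 v] with x h1 h2
  calc (inner ℂ (f x) (v x)).re ≤ ‖f x‖ * ‖v x‖ :=
        (Complex.re_le_norm _).trans (norm_inner_le_norm (𝕜 := ℂ) (f x) (v x))
    _ ≤ (g x).re * ‖v x‖ := by gcongr
    _ = (inner ℂ (g x) (absL2 v x)).re := by
        rw [h2, RCLike.inner_apply, Complex.re_ofReal_mul, Complex.conj_re, mul_comm]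

theorem Dominated.convolutionOperator {K : ℝ → ℂ} (h1 : Integrable K) (h2 : MemLp K 2)
    (hK : ∀ s, K s = (‖K s‖ : ℂ)) {f g : L2} (h : Dominated f g) :
    Dominated (convolutionOperator h1 h2 f) (convolutionOperator h1 h2 g) := by
  have hint : ∀ x, Integrable fun y => g y * K (x - y) := fun x =>
    (Lp.memLp g).integrable_mul (memLp_comp_sub_left h2 x)
  filter_upwards [coeFn_convolutionOperator h1 h2 f, coeFn_convolutionOperator h1 h2 g]
    with x hf hg
  rw [hf, hg, convolution_mul, convolution_mul]
  refine (norm_integral_le_of_norm_le (hint x).re ?_).trans_eq (integral_re (hint x))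
  filter_upwards [h] with y hy
  rw [hK (x - y), norm_mul, Complex.norm_real, norm_norm]
  simp only [RCLike.re_eq_complex_re, Complex.re_mul_ofReal]
  gcongr

theorem greenKernel_eq_norm {k : ℝ} (hk : 0 < k) (s : ℝ) :
    greenKernel k s = (‖greenKernel k s‖ : ℂ) := by
  have hreal : greenKernel k s = (((2 * k)⁻¹ * Real.exp (-k * |s|) : ℝ) : ℂ) := by
    rw [greenKernel_apply]
    push_cast
    rfl
  rw [hreal, Complex.norm_of_nonneg (by positivity)]

theorem Dominated.freeResolvent {k : ℝ} (hk : 0 < (k : ℂ).re) {f g : L2} (h : Dominated f g) :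
    Dominated (freeResolvent hk f) (freeResolvent hk g) :=
  h.convolutionOperator _ _ (greenKernel_eq_norm hk)

theorem Dominated.neg_mulOperator {W : ℝ → ℝ} (hW : MemLp W ⊤) (hneg : ∀ x, W x ≤ 0) {f g : L2}
    (h : Dominated f g) : Dominated (-mulOperator hW f) (-mulOperator hW g) := by
  filter_upwards [h, coeFn_mulOperator hW f, coeFn_mulOperator hW g,
    Lp.coeFn_neg (mulOperator hW f), Lp.coeFn_neg (mulOperator hW g)] with x h1 h2 h3 h4 h5
  rw [h4, h5, Pi.neg_apply, Pi.neg_apply, h2, h3, norm_neg, norm_mul, Complex.norm_real,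
    Real.norm_of_nonpos (hneg x), Complex.neg_re, Complex.re_ofReal_mul, ← neg_mul]
  exact mul_le_mul_of_nonneg_left h1 (neg_nonneg.2 (hneg x))

theorem Dominated.pow {T : L2 →L[ℂ] L2} (hT : ∀ f g, Dominated f g → Dominated (T f) (T g))
    {f g : L2} (h : Dominated f g) (n : ℕ) : Dominated ((T ^ n) f) ((T ^ n) g) := by
  induction n with
  | zero => exact h
  | succ n ih =>
    rw [pow_succ']
    exact hT _ _ ih

end Domination

section Neumann

variable {W : ℝ → ℝ} {c C k : ℝ}

theorem norm_freeResolvent_le (hk : 0 < (k : ℂ).re) : ‖freeResolvent hk‖ ≤ (k ^ 2)⁻¹ := by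
  have hk' : 0 < k := hk
  refine (norm_convolutionOperator_le _ _).trans_eq ?_
  rw [greenKernel, integral_norm_expKernel hk, norm_inv, norm_mul, Complex.norm_two,
    Complex.norm_of_nonneg hk'.le, Complex.ofReal_re]
  field

theorem norm_mulOperator_comp_freeResolvent_le (hW : MemLp W ⊤) (hC : ∀ x, |W x| ≤ C)
    (hk : 0 < (k : ℂ).re) : ‖mulOperator hW ∘L freeResolvent hk‖ ≤ C / k ^ 2 := by
  have hC0 : 0 ≤ C := (abs_nonneg _).trans (hC 0)
  rw [div_eq_mul_inv]
  exact (ContinuousLinearMap.opNorm_comp_le _ _).trans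
    (mul_le_mul (norm_mulOperator_le hW hC0 hC) (norm_freeResolvent_le hk) (norm_nonneg _) hC0)

theorem hasSum_freeResolvent_pow (hW : MemLp W ⊤) (hC : ∀ x, |W x| ≤ C) (hk : 0 < (k : ℂ).re)
    (hkC : C < k ^ 2) {u y : L2}
    (hu : (u, y + (c - (k : ℂ) ^ 2) • u) ∈ schrodingerGraph fun x => c + W x) :
    HasSum (fun n : ℕ => freeResolvent hk (((-(mulOperator hW ∘L freeResolvent hk)) ^ n) y)) u := by
  let R₀ := freeResolvent hk
  let Q : L2 →L[ℂ] L2 := -(mulOperator hW ∘L R₀)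
  have hQ : ‖Q‖ < 1 := by
    rw [norm_neg]
    refine (norm_mulOperator_comp_freeResolvent_le hW hC hk).trans_lt ?_
    rwa [div_lt_one (((abs_nonneg _).trans (hC 0)).trans_lt hkC)]
  rw [mem_schrodingerGraph_iff_eq_freeResolvent hW hk, add_sub_cancel_right] at hu
  have hs : (1 - Q) (y - mulOperator hW u) = y := by
    change y - mulOperator hW u - -mulOperator hW (R₀ (y - mulOperator hW u)) = y
    rw [← hu, sub_neg_eq_add, sub_add_cancel]
  have hgeom : (∑' n : ℕ, Q ^ n) y = y - mulOperator hW u := by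
    conv_lhs => rw [← hs]
    exact DFunLike.congr_fun (geom_series_mul_neg Q hQ) (y - mulOperator hW u)
  have hsum := (summable_geometric_of_norm_lt_one hQ).hasSum
  have := (hsum.mapL (ContinuousLinearMap.apply ℂ L2 y)).mapL R₀
  rw [ContinuousLinearMap.apply_apply, hgeom] at this
  exact hu ▸ this

theorem re_inner_le_re_inner_absL2 (hW : MemLp W ⊤) (hneg : ∀ x, W x ≤ 0)
    (hC : ∀ x, |W x| ≤ C) (hk : 0 < k) (hkC : C < k ^ 2) {R : L2 →L[ℂ] L2}
    (hR : ∀ y, (R y, y + (c - (k : ℂ) ^ 2) • R y) ∈ schrodingerGraph fun x => c + W x)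
    (f : L2) : (inner ℂ (R f) f).re ≤ (inner ℂ (R (absL2 f)) (absL2 f)).re := by
  have hk' : 0 < (k : ℂ).re := hk
  let Q : L2 →L[ℂ] L2 := -(mulOperator hW ∘L freeResolvent hk')
  have hlim : ∀ y, Tendsto (fun n => (inner ℂ
      (∑ i ∈ Finset.range n, freeResolvent hk' ((Q ^ i) y)) y).re) atTop
      (𝓝 (inner ℂ (R y) y).re) := fun y =>
    (Complex.continuous_re.tendsto _).comp
      ((hasSum_freeResolvent_pow hW hC hk' hkC (hR y)).tendsto_sum_nat.inner tendsto_const_nhds)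
  have hQ : ∀ g h : L2, Dominated g h → Dominated (Q g) (Q h) := fun g h hgh =>
    (hgh.freeResolvent hk').neg_mulOperator hW hneg
  have hsum (n : ℕ) := Dominated.sum
    (fun i => ((dominated_absL2 f).pow hQ i).freeResolvent hk') (Finset.range n)
  exact le_of_tendsto_of_tendsto' (hlim f) (hlim (absL2 f)) fun n => (hsum n).re_inner_le f

end Neumann

/-! ### The ground state -/

section Resolvent

variable {U W : ℝ → ℝ} {c : ℝ}

theorem apply_eq_norm_smul_of_le_re_inner {H : Type*} [NormedAddCommGroup H]
    [InnerProductSpace ℂ H] {T : H →L[ℂ] H} {v : H} (h : ‖T‖ * ‖v‖ ^ 2 ≤ (inner ℂ (T v) v).re) :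
    T v = (‖T‖ : ℂ) • v := by
  have hT : ‖T v‖ ^ 2 ≤ (‖T‖ * ‖v‖) ^ 2 := pow_le_pow_left₀ (norm_nonneg _) (T.le_opNorm v) 2
  have hsub : ‖T v - (‖T‖ : ℂ) • v‖ ^ 2 ≤ 0 := by
    rw [@norm_sub_sq ℂ, inner_smul_right, norm_smul, Complex.norm_real, norm_norm,
      RCLike.re_eq_complex_re, Complex.re_ofReal_mul]
    nlinarith [mul_le_mul_of_nonneg_left h (norm_nonneg T)]
  exact sub_eq_zero.1 (norm_eq_zero.1 (pow_eq_zero_iff two_ne_zero |>.1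
    (hsub.antisymm (sq_nonneg _))))

theorem add_inv_mem_spectrum {μ s : ℂ} {R : L2 →L[ℂ] L2}
    (hR : ∀ y, (R y, y + μ • R y) ∈ schrodingerGraph U)
    (hR' : ∀ u f, (u, f) ∈ schrodingerGraph U → R (f - μ • u) = u) (hs0 : s ≠ 0)
    (hs : s ∈ _root_.spectrum ℂ R) : μ + s⁻¹ ∈ spectrum (schrodinger U) := by
  intro hz
  obtain ⟨S, hS, hS'⟩ := mem_resolventSet_iff.1 hz
  have hSR : ∀ y, S (y - s⁻¹ • R y) = R y := fun y => by
    convert! hS' _ _ (hR y) using 2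
    module
  have hRS : ∀ y, R (y + s⁻¹ • S y) = S y := fun y => by
    convert! hR' _ _ (hS y) using 2
    module
  have hleft : (1 + s⁻¹ • S) * (1 - s⁻¹ • R) = 1 := by
    ext1 y
    change (y - s⁻¹ • R y) + s⁻¹ • S (y - s⁻¹ • R y) = y
    rw [hSR, sub_add_cancel]
  have hright : (1 - s⁻¹ • R) * (1 + s⁻¹ • S) = 1 := by
    ext1 y
    change (y + s⁻¹ • S y) - s⁻¹ • R (y + s⁻¹ • S y) = y
    rw [hRS, add_sub_cancel_right]
  refine hs (_root_.spectrum.mem_resolventSet_iff.2 ?_)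
  have hunit : IsUnit (1 - s⁻¹ • R) := ⟨⟨_, _, hright, hleft⟩, rfl⟩
  convert! (hunit.smul (Units.mk0 s hs0)) using 1
  rw [Units.smul_mk0, smul_sub, smul_inv_smul₀ hs0, Algebra.algebraMap_eq_smul_one]

theorem isSelfAdjoint_of_mem_schrodingerGraph (hW : MemLp W ⊤) {μ : ℝ} {R : L2 →L[ℂ] L2}
    (hR : ∀ y, (R y, y + (μ : ℂ) • R y) ∈ schrodingerGraph fun x => c + W x) :
    IsSelfAdjoint R := by
  rw [ContinuousLinearMap.isSelfAdjoint_iff_isSymmetric]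
  intro f g
  have h := inner_schrodingerGraph hW (hR f) (hR g)
  rw [inner_add_right, inner_add_left, inner_smul_left, inner_smul_right,
    Complex.conj_ofReal] at h
  exact add_right_cancel h

theorem exists_mem_spectrum_norm_eq {A : Type*} [CStarAlgebra A] [Nontrivial A] {a : A}
    (ha : IsSelfAdjoint a) : ∃ s ∈ _root_.spectrum ℂ a, ‖s‖ = ‖a‖ := by
  obtain ⟨s, hs, hsn⟩ := _root_.spectrum.exists_nnnorm_eq_spectralRadius a
  rw [ha.spectralRadius_eq_nnnorm] at hsn
  exact ⟨s, hs, congrArg NNReal.toReal (ENNReal.coe_injective hsn)⟩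

end Resolvent

section GroundState

variable {U W : ℝ → ℝ} {c C k : ℝ}

theorem IsEigenvalue.sub_le (hW : MemLp W ⊤) (hC : ∀ x, |W x| ≤ C) {r : ℝ}
    (h : IsEigenvalue (fun x => c + W x) r) : c - C ≤ r := by
  by_contra! hr
  obtain ⟨u, hu, hg⟩ := h
  have hC0 : 0 ≤ C := (abs_nonneg _).trans (hC 0)
  have hk2 : Real.sqrt (c - r) ^ 2 = c - r := Real.sq_sqrt (by linarith)
  have hk : 0 < (Real.sqrt (c - r) : ℂ).re := Real.sqrt_pos.2 (by linarith)
  have hk2' : (c : ℂ) - (Real.sqrt (c - r) : ℂ) ^ 2 = r := by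
    rw [← Complex.ofReal_pow, hk2, ← Complex.ofReal_sub, sub_sub_cancel]
  have hsum := hasSum_freeResolvent_pow (y := 0) hW hC hk (by linarith)
    (by rwa [hk2', zero_add])
  simp only [map_zero] at hsum
  exact hu (hsum.unique hasSum_zero)

theorem exists_real_of_mem_spectrum (hW : MemLp W ⊤) (hW2 : MemLp W 2) (hC : ∀ x, |W x| ≤ C)
    {z : ℂ} (hz : z ∈ spectrum (schrodinger fun x => c + W x)) :
    ∃ r : ℝ, (r : ℂ) = z ∧ c - C ≤ r ∧ (c ≤ r ∨ IsEigenvalue (fun x => c + W x) r) := by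
  by_cases hc : z ∈ Complex.ofReal '' Ici c
  · obtain ⟨r, hr : c ≤ r, rfl⟩ := hc
    exact ⟨r, rfl, by linarith [(abs_nonneg _).trans (hC 0)], .inl hr⟩
  · have he : IsEigenvalue (fun x => c + W x) z := by
      by_contra he
      exact hz (mem_resolventSet_of_not_isEigenvalue hW hW2 hc he)
    obtain ⟨r, rfl⟩ := Complex.conj_eq_iff_real.1 (he.conj_eq hW)
    exact ⟨r, rfl, he.sub_le hW hC, .inr he⟩

theorem mem_resolventSet_of_lt (hW : MemLp W ⊤) (hW2 : MemLp W 2) (hC : ∀ x, |W x| ≤ C)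
    {r : ℝ} (hr : r < c - C) : (r : ℂ) ∈ resolventSet (schrodinger fun x => c + W x) := by
  by_contra hmem
  obtain ⟨s, hs, hle, -⟩ := exists_real_of_mem_spectrum hW hW2 hC hmem
  exact (Complex.ofReal_injective hs ▸ hle).not_gt hr

theorem exists_mem_spectrum_norm_eq_inv (hW : MemLp W ⊤) (hW2 : MemLp W 2)
    (hC : ∀ x, |W x| ≤ C) {μ : ℝ} (hμ : μ < c - C) {R : L2 →L[ℂ] L2} (hR0 : R ≠ 0)
    (hR : ∀ y, (R y, y + (μ : ℂ) • R y) ∈ schrodingerGraph fun x => c + W x)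
    (hR' : ∀ u f, (u, f) ∈ (schrodingerGraph fun x => c + W x) → R (f - (μ : ℂ) • u) = u) :
    ∃ l : ℝ, (l : ℂ) ∈ spectrum (schrodinger fun x => c + W x) ∧ μ < l ∧ ‖R‖ = (l - μ)⁻¹ := by
  have : Nontrivial (L2 →L[ℂ] L2) := ⟨R, 0, hR0⟩
  obtain ⟨s, hs, hsn⟩ := exists_mem_spectrum_norm_eq (isSelfAdjoint_of_mem_schrodingerGraph hW hR)
  have hs0 : s ≠ 0 := norm_ne_zero_iff.1 (hsn ▸ norm_ne_zero_iff.2 hR0)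
  have hmem := add_inv_mem_spectrum hR hR' hs0 hs
  obtain ⟨l, hl, hle, -⟩ := exists_real_of_mem_spectrum hW hW2 hC hmem
  have hμl : μ < l := hμ.trans_le hle
  refine ⟨l, hl ▸ hmem, hμl, ?_⟩
  have hsinv : s⁻¹ = ((l - μ : ℝ) : ℂ) := by rw [Complex.ofReal_sub, hl, add_sub_cancel_left]
  rw [← hsn, ← inv_inv s, hsinv, norm_inv, Complex.norm_of_nonneg (sub_pos.2 hμl).le]

theorem sub_smul_resolvent_apply {μ z : ℂ} {R : L2 →L[ℂ] L2} {u : L2}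
    (hR : ∀ u f, (u, f) ∈ schrodingerGraph U → R (f - μ • u) = u)
    (hu : (u, z • u) ∈ schrodingerGraph U) : (z - μ) • R u = u := by
  rw [← map_smul, sub_smul, hR u _ hu]

theorem IsEigenvalue.inv_sub_le_norm {μ r : ℝ} {R : L2 →L[ℂ] L2}
    (h : IsEigenvalue U r) (hμ : μ < r)
    (hR : ∀ u f, (u, f) ∈ schrodingerGraph U → R (f - (μ : ℂ) • u) = u) :
    (r - μ)⁻¹ ≤ ‖R‖ := by
  obtain ⟨u, hu, hg⟩ := h
  rw [inv_le_iff_one_le_mul₀' (sub_pos.2 hμ)]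
  refine le_of_mul_le_mul_right ?_ (norm_pos_iff.2 hu)
  calc 1 * ‖u‖ = ‖((r - μ : ℝ) : ℂ) • R u‖ := by
        rw [one_mul, Complex.ofReal_sub, sub_smul_resolvent_apply hR hg]
    _ = (r - μ) * ‖R u‖ := by rw [norm_smul, Complex.norm_of_nonneg (sub_pos.2 hμ).le]
    _ ≤ (r - μ) * (‖R‖ * ‖u‖) := by
        gcongr
        exact R.le_opNorm u
    _ = (r - μ) * ‖R‖ * ‖u‖ := by ring

theorem mem_schrodingerGraph_of_resolvent_apply {μ t : ℂ} (ht : t ≠ 0)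
    {R : L2 →L[ℂ] L2} (hR : ∀ y, (R y, y + μ • R y) ∈ schrodingerGraph U) {u : L2}
    (hu : R u = t⁻¹ • u) : (u, (μ + t) • u) ∈ schrodingerGraph U := by
  have h := (schrodingerGraph U).smul_mem t (hR u)
  rw [hu, Prod.smul_mk, smul_inv_smul₀ ht] at h
  convert! h using 2
  rw [smul_add, smul_comm t, smul_inv_smul₀ ht, add_smul, add_comm]

theorem absL2_mem_schrodingerGraph_of_norm_eq (hW : MemLp W ⊤) (hneg : ∀ x, W x ≤ 0)
    (hC : ∀ x, |W x| ≤ C) (hk : 0 < k) (hkC : C < k ^ 2) {l : ℝ} (hl : c - k ^ 2 < l)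
    {R : L2 →L[ℂ] L2} (hn : ‖R‖ = (l - (c - k ^ 2))⁻¹)
    (hR : ∀ y, (R y, y + ((c - k ^ 2 : ℝ) : ℂ) • R y) ∈ schrodingerGraph fun x => c + W x)
    (hR' : ∀ u f, (u, f) ∈ (schrodingerGraph fun x => c + W x) →
      R (f - ((c - k ^ 2 : ℝ) : ℂ) • u) = u)
    {u : L2} (hu : (u, (l : ℂ) • u) ∈ schrodingerGraph fun x => c + W x) :
    (absL2 u, (l : ℂ) • absL2 u) ∈ schrodingerGraph fun x => c + W x := by
  have ht : ((l - (c - k ^ 2) : ℝ) : ℂ) ≠ 0 := Complex.ofReal_ne_zero.2 (sub_pos.2 hl).ne'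
  have hnt : (‖R‖ : ℂ) = ((l - (c - k ^ 2) : ℝ) : ℂ)⁻¹ := by rw [hn, Complex.ofReal_inv]
  have hRu : R u = (‖R‖ : ℂ) • u := by
    rw [hnt, eq_inv_smul_iff₀ ht, Complex.ofReal_sub, sub_smul_resolvent_apply hR' hu]
  have hmax : ‖R‖ * ‖absL2 u‖ ^ 2 ≤ (inner ℂ (R (absL2 u)) (absL2 u)).re := by
    calc ‖R‖ * ‖absL2 u‖ ^ 2 = (inner ℂ (R u) u).re := by
          rw [hRu, inner_smul_left, Complex.conj_ofReal, Complex.re_ofReal_mul, norm_absL2,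
            ← RCLike.re_eq_complex_re, inner_self_eq_norm_sq]
      _ ≤ _ := re_inner_le_re_inner_absL2 hW hneg hC hk hkC (by simpa using hR) u
  have habs := apply_eq_norm_smul_of_le_re_inner hmax
  rw [hnt] at habs
  convert! mem_schrodingerGraph_of_resolvent_apply ht hR habs using 3
  rw [← Complex.ofReal_add, add_sub_cancel]

/-- The resolvent `R` at a point `μ` far below the spectrum has norm `(l - μ)⁻¹`, where `l` is the
bottom of the spectrum. Hence `u` is an eigenvector for `l` if and only if it maximizes
`⟨R u, u⟩` for given `‖u‖`, and positivity of `R` makes `|u|` a maximizer as well. -/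
theorem exists_ground_state (hW : MemLp W ⊤) (hW2 : MemLp W 2) (hneg : ∀ x, W x ≤ 0)
    (hC : ∀ x, |W x| ≤ C) {r : ℝ} (hr : r < c) (he : IsEigenvalue (fun x => c + W x) r) :
    ∃ l : ℝ, l ≤ r ∧ IsEigenvalue (fun x => c + W x) l ∧
      (∀ z ∈ spectrum (schrodinger fun x => c + W x), z.im = 0 ∧ l ≤ z.re) ∧
      ∀ u : L2, (u, (l : ℂ) • u) ∈ (schrodingerGraph fun x => c + W x) →
        (absL2 u, (l : ℂ) • absL2 u) ∈ schrodingerGraph fun x => c + W x := by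
  have hC0 : 0 ≤ C := (abs_nonneg _).trans (hC 0)
  have hkC : C < (C + 1) ^ 2 := by nlinarith
  have hμ : c - (C + 1) ^ 2 < c - C := by linarith
  obtain ⟨R, hR, hR'⟩ := mem_resolventSet_iff.1 (mem_resolventSet_of_lt hW hW2 hC hμ)
  have hle : ∀ s : ℝ, IsEigenvalue (fun x => c + W x) s → (s - (c - (C + 1) ^ 2))⁻¹ ≤ ‖R‖ :=
    fun s hs => hs.inv_sub_le_norm (hμ.trans_le (hs.sub_le hW hC)) hR'
  have hRpos : 0 < ‖R‖ :=
    (inv_pos.2 (sub_pos.2 (hμ.trans_le (he.sub_le hW hC)))).trans_le (hle r he)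
  obtain ⟨l, hl, hμl, hn⟩ :=
    exists_mem_spectrum_norm_eq_inv hW hW2 hC hμ (norm_pos_iff.1 hRpos) hR hR'
  have hmin : ∀ s : ℝ, IsEigenvalue (fun x => c + W x) s → l ≤ s := fun s hs => by
    have := hle s hs
    rw [hn, inv_le_inv₀ (sub_pos.2 (hμ.trans_le (hs.sub_le hW hC))) (sub_pos.2 hμl)] at this
    linarith
  have hlr := hmin r he
  refine ⟨l, hlr, ?_, fun z hz => ?_, fun u hu => ?_⟩
  · obtain ⟨s, hs, -, hs'⟩ := exists_real_of_mem_spectrum hW hW2 hC hl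
    obtain rfl := Complex.ofReal_injective hs
    exact hs'.resolve_left (hlr.trans_lt hr).not_ge
  · obtain ⟨s, rfl, -, hs⟩ := exists_real_of_mem_spectrum hW hW2 hC hz
    exact ⟨Complex.ofReal_im s, hs.elim (hlr.trans hr.le).trans (hmin s)⟩
  · exact absL2_mem_schrodingerGraph_of_norm_eq hW hneg hC (by linarith) hkC hμl hn hR hR' hu

end GroundState

/-! ### The two spectra -/

section Spectra

variable {W : ℝ → ℝ} {c : ℝ}

theorem continuousSpectrum_eq (hW : IsShortRange W) :
    continuousSpectrum (schrodinger fun x => c + W x) = Complex.ofReal '' Ici c := by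
  obtain ⟨C, hC⟩ := hW.exists_bound
  ext z
  constructor
  · rintro ⟨hz, hinj, -⟩
    by_contra hcut
    exact hz (mem_resolventSet_of_not_isEigenvalue hW.memLp_top hW.memLp_two hcut fun he =>
      ker_shift_ne_bot_iff.2 he (LinearMap.ker_eq_bot.2 hinj))
  · rintro ⟨r, hr, rfl⟩
    have hne := not_isEigenvalue_of_le (c := c) hW hr
    have hμ := mem_resolventSet_of_lt (c := c) hW.memLp_top hW.memLp_two hC (sub_one_lt _)
    exact ⟨mem_spectrum_of_le hW.memLp_top hW.memLp_two hr,
      injective_shift_of_not_isEigenvalue hne,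
      denseRange_shift hW.memLp_top (Complex.conj_ofReal r) (Complex.conj_ofReal _) hμ hne⟩

theorem essentialSpectrum_eq (hW : IsShortRange W) :
    essentialSpectrum (schrodinger fun x => c + W x) = Complex.ofReal '' Ici c := by
  ext z
  constructor
  · rintro ⟨hz, hd⟩
    by_contra hcut
    exact hz (mem_resolventSet_of_not_isEigenvalue hW.memLp_top hW.memLp_two hcut fun he =>
      hd (mem_discreteSpectrum_of_isEigenvalue hW.memLp_top hW.memLp_two hcut he))
  · rintro ⟨r, hr, rfl⟩
    exact ⟨mem_spectrum_of_le hW.memLp_top hW.memLp_two hr, fun hd =>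
      not_isEigenvalue_of_le hW hr (ker_shift_ne_bot_iff.1 hd.2.2.1)⟩

end Spectra

/-! ### Bound states -/

theorem isEigenfunction_schrodinger_iff {U η : ℝ → ℝ} {l : ℝ} :
    IsEigenfunction (schrodinger U) l η ↔
      ∃ u : L2, u ≠ 0 ∧ (∀ᵐ x, u x = (η x : ℂ)) ∧ (u, (l : ℂ) • u) ∈ schrodingerGraph U := by
  constructor
  · rintro ⟨f, hf0, hfη, hf⟩
    exact ⟨f, hf0, hfη, hf ▸ mem_graph_of_domain f⟩
  · rintro ⟨u, hu, huη, h⟩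
    obtain ⟨f, rfl, hf⟩ := exists_domain_of_mem_graph h
    exact ⟨f, hu, huη, hf⟩

/-- Real classical bound states: `η` solves `-η'' + U η = l η` pointwise, and `η, η' ∈ L²`. The
zero function is allowed. -/
structure IsBoundState (U : ℝ → ℝ) (l : ℝ) (η : ℝ → ℝ) : Prop where
  differentiable : Differentiable ℝ η
  hasDerivAt_deriv : ∀ x, HasDerivAt (deriv η) ((U x - l) * η x) x
  memLp : MemLp η 2 volume
  memLp_deriv : MemLp (deriv η) 2 volume

namespace IsBoundState

variable {U η ζ : ℝ → ℝ} {l : ℝ}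

theorem deriv_deriv (h : IsBoundState U l η) :
    deriv (deriv η) = fun x => (U x - l) * η x :=
  funext fun x => (h.hasDerivAt_deriv x).deriv

theorem add (hη : IsBoundState U l η) (hζ : IsBoundState U l ζ) : IsBoundState U l (η + ζ) := by
  have hderiv : deriv (η + ζ) = deriv η + deriv ζ :=
    funext fun x => deriv_add (hη.differentiable x) (hζ.differentiable x)
  refine ⟨hη.differentiable.add hζ.differentiable, fun x => ?_, hη.memLp.add hζ.memLp,
    hderiv ▸ hη.memLp_deriv.add hζ.memLp_deriv⟩
  rw [hderiv]
  exact ((hη.hasDerivAt_deriv x).add (hζ.hasDerivAt_deriv x)).congr_deriv (mul_add _ _ _).symm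

theorem comp_const_sub {b : ℝ} (hU : ∀ x, U (b - x) = U x) (h : IsBoundState U l η) :
    IsBoundState U l fun x => η (b - x) := by
  have hderiv : deriv (fun x => η (b - x)) = fun x => -deriv η (b - x) :=
    funext fun x => deriv_comp_const_sub η b x
  have hmp := Measure.measurePreserving_sub_left (volume : Measure ℝ) b
  refine ⟨h.differentiable.comp (differentiable_id.const_sub b), fun x => ?_,
    h.memLp.comp_measurePreserving hmp, ?_⟩
  · rw [hderiv]
    exact ((h.hasDerivAt_deriv (b - x)).comp_const_sub b x).neg.congr_deriv (by rw [hU, neg_neg])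
  · rw [hderiv]
    exact (h.memLp_deriv.comp_measurePreserving hmp).neg

theorem contDiff (hU : Continuous U) (h : IsBoundState U l η) : ContDiff ℝ 2 η := by
  have hη := h.differentiable.continuous
  rw [show (2 : WithTop ℕ∞) = 1 + 1 from rfl, contDiff_succ_iff_deriv, contDiff_one_iff_deriv,
    h.deriv_deriv]
  exact ⟨h.differentiable, by simp, fun x => (h.hasDerivAt_deriv x).differentiableAt,
    by fun_prop⟩

theorem isEigenfunction (hU : Continuous U) (hUb : ∃ C, ∀ x, |U x| ≤ C)
    (h : IsBoundState U l η) (h0 : η ≠ 0) : IsEigenfunction (schrodinger U) l η := by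
  obtain ⟨C, hC⟩ := hUb
  have hc := h.differentiable.continuous
  have hηL : MemLp (fun x => (η x : ℂ)) 2 volume := h.memLp.ofReal
  have hη₂ : MemLp (fun x => (U x - l) * η x) 2 volume :=
    h.memLp.of_le_mul (c := C + |l|) (Continuous.aestronglyMeasurable (by fun_prop))
      (.of_forall fun x => (norm_mul_le _ _).trans <| by
        gcongr
        exact (norm_sub_le _ _).trans (add_le_add_left (hC x) _))
  refine isEigenfunction_schrodinger_iff.2 ⟨hηL.toLp, fun hzero => h0 ?_, hηL.coeFn_toLp,
    mem_schrodingerGraph_of_hasDerivAt hηL.coeFn_toLp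
      (fun x => (h.differentiable x).hasDerivAt.ofReal_comp)
      (fun x => (h.hasDerivAt_deriv x).ofReal_comp) (by fun_prop) h.memLp_deriv.ofReal
      hη₂.ofReal ?_⟩
  · have hae : η =ᵐ[volume] 0 := by
      filter_upwards [hηL.coeFn_toLp, (Lp.eq_zero_iff_ae_eq_zero).1 hzero] with x hx hx0
      exact Complex.ofReal_eq_zero.1 (hx.symm.trans hx0)
    exact (Continuous.ae_eq_iff_eq volume hc continuous_zero).1 hae
  · filter_upwards [hηL.coeFn_toLp, Lp.coeFn_smul (l : ℂ) hηL.toLp] with x hx hxl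
    rw [hxl, Pi.smul_apply, hx, smul_eq_mul]
    push_cast
    ring

theorem isGrowingMode {V φ : ℝ → ℝ} (hU : Continuous (perturbationPotential V φ))
    (h : IsBoundState (perturbationPotential V φ) l η) (h0 : η ≠ 0) (hl : l < 0) :
    IsGrowingMode V φ (Real.sqrt (-l)) η := by
  refine ⟨Real.sqrt_pos.2 (neg_pos.2 hl), h0, h.contDiff hU, h.memLp, h.memLp_deriv,
    fun t x => ?_⟩
  have hexp : ∀ A : ℝ, deriv (fun s => Real.exp (Real.sqrt (-l) * s) * A) =
      fun s => Real.exp (Real.sqrt (-l) * s) * (Real.sqrt (-l) * A) := fun A => funext fun s => by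
    have hs := ((hasDerivAt_id s).const_mul (Real.sqrt (-l))).exp.mul_const A
    exact hs.deriv.trans (by simp only [id]; ring)
  simp only [hexp, deriv_const_mul_field', h.deriv_deriv]
  linear_combination
    Real.exp (Real.sqrt (-l) * t) * η x * Real.mul_self_sqrt (neg_pos.2 hl).le

end IsBoundState

section Nodeless

variable {U W : ℝ → ℝ} {c C : ℝ}

theorem exists_pos_isBoundState (hU : Continuous U) (hUb : ∃ C, ∀ x, |U x| ≤ C) {u : L2}
    (hu : u ≠ 0) {l : ℝ} (h : (absL2 u, (l : ℂ) • absL2 u) ∈ schrodingerGraph U) :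
    ∃ η, IsBoundState U l η ∧ (∀ x, 0 < η x) ∧ (fun x => ‖u x‖) =ᵐ[volume] η := by
  obtain ⟨F, F₁, huF, hF, hF₁, hL, hL₁⟩ := exists_hasDerivAt_of_mem_schrodingerGraph hU h
  have hFu : ∀ᵐ x, F x = (‖u x‖ : ℂ) := by
    filter_upwards [huF, coeFn_absL2 u] with x hx hx'
    rw [← hx, hx']
  have hFc : Continuous F := continuous_iff_continuousAt.2 fun x => (hF x).continuousAt
  have hre : (fun x => (F x).re) = fun x => ‖F x‖ := by
    refine (Continuous.ae_eq_iff_eq volume (by fun_prop) (by fun_prop)).1 ?_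
    filter_upwards [hFu] with x hx
    rw [hx, Complex.norm_real, norm_norm, Complex.ofReal_re]
  have hd : ∀ x, HasDerivAt (fun x => (F x).re) (F₁ x).re x := fun x =>
    Complex.reCLM.hasFDerivAt.comp_hasDerivAt x (hF x)
  have hd₁ : ∀ x, HasDerivAt (fun x => (F₁ x).re) ((U x - l) * (F x).re) x := fun x =>
    (Complex.reCLM.hasFDerivAt.comp_hasDerivAt x (hF₁ x)).congr_deriv (by simp)
  have hderiv : deriv (fun x => (F x).re) = fun x => (F₁ x).re := funext fun x => (hd x).deriv
  have hη : (fun x => ‖u x‖) =ᵐ[volume] fun x => (F x).re := by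
    filter_upwards [hFu] with x hx
    rw [hx, Complex.ofReal_re]
  have hnonneg : ∀ x, 0 ≤ (F x).re := fun x => (norm_nonneg _).trans_eq (congrFun hre x).symm
  refine ⟨fun x => (F x).re, ⟨fun x => (hd x).differentiableAt, hderiv ▸ hd₁, hL.re,
    hderiv ▸ hL₁.re⟩, fun x₀ => (hnonneg x₀).lt_of_ne fun h0 => hu ?_, hη⟩
  have hmin : IsLocalMin (fun x => (F x).re) x₀ :=
    Eventually.of_forall fun y => h0.symm.le.trans (hnonneg y)
  obtain ⟨C, hC⟩ := hUb
  have hzero := eq_zero_of_hasDerivAt_of_eq_zero (K := C + |l|)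
    (fun x => (norm_sub_le _ _).trans (add_le_add_left (hC x) _)) hd hd₁ h0.symm
    (hmin.hasDerivAt_eq_zero (hd x₀))
  rw [Lp.eq_zero_iff_ae_eq_zero]
  filter_upwards [hη] with x hx
  exact norm_eq_zero.1 (hx.trans (hzero x))

theorem exists_pos_isBoundState_of_apply_eq_zero (hWc : Continuous W) (hW2 : MemLp W 2 volume)
    (hneg : ∀ x, W x ≤ 0) (hC : ∀ x, |W x| ≤ C) {r : ℝ} (hr : r < c) {ζ : ℝ → ℝ}
    (hζ : IsEigenfunction (schrodinger fun x => c + W x) r ζ) (hζc : Continuous ζ) {x₀ : ℝ}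
    (hζ0 : ζ x₀ = 0) :
    ∃ l < r, (∀ z ∈ spectrum (schrodinger fun x => c + W x), z.im = 0 ∧ l ≤ z.re) ∧
      ∃ η, IsBoundState (fun x => c + W x) l η ∧ ∀ x, 0 < η x := by
  have hW : MemLp W ⊤ volume := memLp_top_of_bound hWc.aestronglyMeasurable C (.of_forall hC)
  have hU : Continuous fun x => c + W x := by fun_prop
  have hUb : ∃ B, ∀ x, |c + W x| ≤ B :=
    ⟨|c| + C, fun x => (abs_add_le _ _).trans (add_le_add_right (hC x) _)⟩
  obtain ⟨v, hv0, hvζ, hv⟩ := isEigenfunction_schrodinger_iff.1 hζ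
  obtain ⟨l, hlr, ⟨u, hu0, hu⟩, hmin, habs⟩ :=
    exists_ground_state hW hW2 hneg hC hr ⟨v, hv0, hv⟩
  have hne : l ≠ r := by
    rintro rfl
    obtain ⟨η, hη, hpos, hηv⟩ := exists_pos_isBoundState hU hUb hv0 (habs v hv)
    have hηζ : η = fun x => |ζ x| := by
      refine (Continuous.ae_eq_iff_eq volume hη.differentiable.continuous (by fun_prop)).1 ?_
      filter_upwards [hηv, hvζ] with x hx hx'
      rw [← hx, hx', Complex.norm_real, Real.norm_eq_abs]
    exact (hpos x₀).ne' (by simp only [hηζ, hζ0, abs_zero])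
  obtain ⟨η, hη, hpos, -⟩ := exists_pos_isBoundState hU hUb hu0 (habs u hu)
  exact ⟨l, hlr.lt_of_ne hne, hmin, η, hη, hpos⟩

end Nodeless

/-! ### The lump -/

section ShortRange

variable {W f : ℝ → ℝ}

theorem integrable_exp_neg_mul_abs {k : ℝ} (hk : 0 < k) :
    Integrable fun x : ℝ => Real.exp (-(k * |x|)) := by
  refine (integrable_expKernel (k := k) hk 1 1).norm.congr (.of_forall fun x => ?_)
  rcases le_or_gt x 0 with hx | hx
  · simp [expKernel, hx, abs_of_nonpos hx, Complex.norm_exp]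
  · simp [expKernel, hx.not_ge, abs_of_pos hx, Complex.norm_exp]

theorem isShortRange_of_abs_le_exp (hW : Continuous W) {C k : ℝ} (hk : 0 < k)
    (h : ∀ x, |W x| ≤ C * Real.exp (-(k * |x|))) : IsShortRange W := by
  have hC : 0 ≤ C := by simpa using (abs_nonneg _).trans (h 0)
  refine ⟨hW, ⟨C, fun x => (h x).trans (mul_le_of_le_one_right hC (Real.exp_le_one_iff.2 ?_))⟩,
    ((integrable_exp_neg_mul_abs (half_pos hk)).const_mul ((1 + 2 / k) * C)).mono'
      (Continuous.aestronglyMeasurable (by fun_prop)) (.of_forall fun x => ?_)⟩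
  · exact neg_nonpos.2 (by positivity)
  have hweight : 1 + |x| ≤ (1 + 2 / k) * Real.exp (k / 2 * |x|) :=
    calc 1 + |x| ≤ 1 + |x| + (k / 2 * |x| + 2 / k) := le_add_of_nonneg_right (by positivity)
      _ = (1 + 2 / k) * (k / 2 * |x| + 1) := by field_simp; ring
      _ ≤ _ := by
        gcongr
        exact Real.add_one_le_exp _
  calc ‖(1 + |x|) * W x‖ = (1 + |x|) * |W x| := by
        rw [norm_mul, Real.norm_eq_abs, Real.norm_eq_abs, abs_of_pos (by positivity)]
    _ ≤ (1 + 2 / k) * Real.exp (k / 2 * |x|) * (C * Real.exp (-(k * |x|))) := by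
        gcongr
        exact h x
    _ = (1 + 2 / k) * C * Real.exp (-(k / 2 * |x|)) := by
        rw [show -(k / 2 * |x|) = k / 2 * |x| + -(k * |x|) by ring, Real.exp_add]
        ring

namespace IsShortRange

theorem of_abs_le (hW : IsShortRange W) (hf : Continuous f) {A : ℝ}
    (h : ∀ x, |f x| ≤ A * |W x|) : IsShortRange f := by
  obtain ⟨C, hC⟩ := hW.exists_bound
  have hA : ∀ x, |f x| ≤ |A| * |W x| := fun x =>
    (h x).trans (mul_le_mul_of_nonneg_right (le_abs_self A) (abs_nonneg _))
  refine ⟨hf, ⟨|A| * C, fun x => (hA x).trans (by gcongr; exact hC x)⟩,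
    (hW.integrable_weight_mul.norm.const_mul |A|).mono'
      (Continuous.aestronglyMeasurable (by fun_prop)) (.of_forall fun x => ?_)⟩
  rw [norm_mul, norm_mul, mul_left_comm]
  exact mul_le_mul_of_nonneg_left (hA x) (norm_nonneg _)

theorem comp_mul_self (hW : IsShortRange W) {P : ℝ → ℝ} (hP : Continuous P) :
    IsShortRange fun x => P (W x) * W x := by
  obtain ⟨C, hC⟩ := hW.exists_bound
  obtain ⟨A, hA⟩ := (isCompact_Icc (a := -C) (b := C)).exists_bound_of_continuousOn
    hP.continuousOn
  refine hW.of_abs_le ((hP.comp hW.continuous).mul hW.continuous) (A := A) fun x => ?_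
  rw [abs_mul]
  exact mul_le_mul_of_nonneg_right (hA _ (abs_le.1 (hC x))) (abs_nonneg _)

end IsShortRange

end ShortRange

section QuarticPotential

variable {a : ℝ}

theorem quarticPotential_eq (ha : 0 < a) (u : ℝ) : quarticPotential a u
    = 2 * u ^ 4 - 4 * (Real.cosh (2 * a) / Real.sinh (2 * a)) * u ^ 3 + 2 * u ^ 2 := by
  have hs := (Real.sinh_pos_iff.2 ha).ne'
  have hc := (Real.cosh_pos a).ne'
  have hprod : Real.tanh a * (Real.cosh a / Real.sinh a) = 1 := by
    rw [Real.tanh_eq_sinh_div_cosh]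
    field_simp
  have hsum : Real.tanh a + Real.cosh a / Real.sinh a
      = 2 * (Real.cosh (2 * a) / Real.sinh (2 * a)) := by
    rw [Real.tanh_eq_sinh_div_cosh, Real.cosh_two_mul, Real.sinh_two_mul]
    field_simp
    ring
  rw [quarticPotential]
  linear_combination 2 * u ^ 2 * hprod - 2 * u ^ 3 * hsum

theorem deriv_quarticPotential (ha : 0 < a) : deriv (quarticPotential a) = fun u =>
    (8 * u ^ 2 - 12 * (Real.cosh (2 * a) / Real.sinh (2 * a)) * u + 4) * u := by
  ext u
  rw [funext (quarticPotential_eq ha)]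
  have h := ((((hasDerivAt_id u).pow 4).const_mul 2).sub (((hasDerivAt_id u).pow 3).const_mul
    (4 * (Real.cosh (2 * a) / Real.sinh (2 * a))))).add (((hasDerivAt_id u).pow 2).const_mul 2)
  refine h.deriv.trans ?_
  simp only [id]
  ring

theorem hasDerivAt_deriv_quarticPotential (ha : 0 < a) (u : ℝ) :
    HasDerivAt (deriv (quarticPotential a))
      (4 + (24 * u - 24 * (Real.cosh (2 * a) / Real.sinh (2 * a))) * u) u := by
  rw [deriv_quarticPotential ha]
  have h := (((((hasDerivAt_id u).pow 2).const_mul 8).sub ((hasDerivAt_id u).const_mul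
    (12 * (Real.cosh (2 * a) / Real.sinh (2 * a))))).add_const 4).mul (hasDerivAt_id u)
  refine h.congr_deriv ?_
  simp only [id, Pi.sub_apply, Pi.pow_apply]
  ring

theorem isFalseVacuum_quarticPotential (ha : 0 < a) : IsFalseVacuum (quarticPotential a) 0 := by
  have hs := Real.sinh_pos_iff.2 ha
  have htanh : 0 < Real.tanh a := by
    rw [Real.tanh_eq_sinh_div_cosh]
    exact div_pos hs (Real.cosh_pos a)
  have htanh1 : Real.tanh a < 1 := Real.tanh_lt_one a
  have hcoth : 1 < Real.cosh a / Real.sinh a := (one_lt_div hs).2 (Real.sinh_lt_cosh a)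
  refine ⟨?_, 1, ?_⟩
  · filter_upwards [Iio_mem_nhds htanh] with u (hu : u < Real.tanh a)
    have hprod : 0 ≤ (Real.tanh a - u) * (Real.cosh a / Real.sinh a - u) :=
      mul_nonneg (by linarith) (by linarith)
    simp only [quarticPotential]
    nlinarith [mul_nonneg (sq_nonneg u) hprod]
  · simp only [quarticPotential]
    nlinarith [mul_pos (sub_pos.2 htanh1) (sub_pos.2 hcoth)]

end QuarticPotential

section Lump

variable {a : ℝ} (x₀ : ℝ)

theorem lump_denom_pos (x : ℝ) : 0 < Real.cosh (2 * a) + Real.cosh (2 * (x - x₀)) :=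
  add_pos (Real.cosh_pos _) (Real.cosh_pos _)

theorem sinh_two_mul_pos (ha : 0 < a) : 0 < Real.sinh (2 * a) :=
  Real.sinh_pos_iff.2 (by linarith)

theorem lump_pos (ha : 0 < a) (x : ℝ) : 0 < lump a x₀ x :=
  div_pos (sinh_two_mul_pos ha) (lump_denom_pos x₀ x)

theorem lump_reflect (x : ℝ) : lump a x₀ (2 * x₀ - x) = lump a x₀ x := by
  rw [lump, lump, ← Real.cosh_neg (2 * (x - x₀))]
  ring_nf

theorem contDiff_lump {n : WithTop ℕ∞} : ContDiff ℝ n (lump a x₀) :=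
  contDiff_const.div (contDiff_const.add (Real.contDiff_cosh.comp (by fun_prop)))
    fun x => (lump_denom_pos x₀ x).ne'

theorem hasDerivAt_two_mul_sub (x : ℝ) : HasDerivAt (fun x : ℝ => 2 * (x - x₀)) 2 x := by
  simpa using ((hasDerivAt_id x).sub_const x₀).const_mul 2

theorem deriv_lump : deriv (lump a x₀) = fun x => -2 * Real.sinh (2 * a)
    * Real.sinh (2 * (x - x₀)) / (Real.cosh (2 * a) + Real.cosh (2 * (x - x₀))) ^ 2 := by
  ext x
  have h := (hasDerivAt_const x (Real.sinh (2 * a))).div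
    ((hasDerivAt_two_mul_sub x₀ x).cosh.const_add (Real.cosh (2 * a))) (lump_denom_pos x₀ x).ne'
  refine h.deriv.trans ?_
  ring

theorem deriv_lump_eq_zero_iff (ha : 0 < a) (x : ℝ) : deriv (lump a x₀) x = 0 ↔ x = x₀ := by
  have hs := (sinh_two_mul_pos ha).ne'
  have hD := (lump_denom_pos (a := a) x₀ x).ne'
  rw [deriv_lump]
  simp [hs, hD, sub_eq_zero]

theorem hasDerivAt_deriv_lump (ha : 0 < a) (x : ℝ) :
    HasDerivAt (deriv (lump a x₀)) (deriv (quarticPotential a) (lump a x₀ x)) x := by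
  have hD := lump_denom_pos (a := a) x₀ x
  have h := ((hasDerivAt_two_mul_sub x₀ x).sinh.const_mul (-2 * Real.sinh (2 * a))).div
    (((hasDerivAt_two_mul_sub x₀ x).cosh.const_add (Real.cosh (2 * a))).pow 2) (pow_pos hD 2).ne'
  rw [deriv_lump, deriv_quarticPotential ha]
  refine h.congr_deriv ?_
  have hs := (sinh_two_mul_pos ha).ne'
  have hsq := Real.sinh_sq (2 * a)
  have hsq' := Real.sinh_sq (2 * (x - x₀))
  have hD' := hD.ne'
  simp only [lump, Pi.pow_apply]
  field_simp
  push_cast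
  linear_combination 8 * (Real.cosh (2 * a) + Real.cosh (2 * (x - x₀))) * (hsq' - hsq)

theorem isStaticSolution_lump (ha : 0 < a) : IsStaticSolution (quarticPotential a) (lump a x₀) :=
  ⟨contDiff_lump x₀, fun x => (hasDerivAt_deriv_lump x₀ ha x).deriv⟩

theorem half_deriv_lump_sq (ha : 0 < a) (x : ℝ) :
    (1 / 2) * deriv (lump a x₀) x ^ 2 = quarticPotential a (lump a x₀ x) := by
  have hD := (lump_denom_pos (a := a) x₀ x).ne'
  have hs := (sinh_two_mul_pos ha).ne'
  simp only [quarticPotential_eq ha, deriv_lump, lump]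
  field_simp
  linear_combination 2 * Real.cosh_sq (2 * a) - 2 * Real.cosh_sq (2 * (x - x₀))

theorem lump_le_coth (ha : 0 < a) (x : ℝ) :
    lump a x₀ x ≤ Real.cosh (2 * a) / Real.sinh (2 * a) := by
  rw [lump, div_le_div_iff₀ (lump_denom_pos x₀ x) (sinh_two_mul_pos ha)]
  nlinarith [Real.cosh_sq (2 * a), mul_pos (Real.cosh_pos (2 * a)) (Real.cosh_pos (2 * (x - x₀)))]

theorem abs_deriv_lump_le (ha : 0 < a) (x : ℝ) : |deriv (lump a x₀) x| ≤ 2 * lump a x₀ x := by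
  have hφ := lump_pos x₀ ha x
  refine abs_le_of_sq_le_sq ?_ (by positivity)
  have h := half_deriv_lump_sq x₀ ha x
  rw [quarticPotential_eq ha] at h
  nlinarith [mul_nonneg (pow_pos hφ 3).le (sub_nonneg.2 (lump_le_coth x₀ ha x)), pow_pos hφ 4]

theorem lump_le_exp (ha : 0 < a) (x : ℝ) :
    lump a x₀ x ≤ 2 * Real.sinh (2 * a) * Real.exp (2 * |x₀|) * Real.exp (-(2 * |x|)) := by
  have := sinh_two_mul_pos ha
  have hexp : Real.exp (2 * |x| - 2 * |x₀|) / 2 ≤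
      Real.cosh (2 * a) + Real.cosh (2 * (x - x₀)) :=
    calc Real.exp (2 * |x| - 2 * |x₀|) / 2 ≤ Real.exp |2 * (x - x₀)| / 2 := by
          gcongr
          rw [abs_mul, abs_two]
          linarith [abs_sub_abs_le_abs_sub x x₀]
      _ ≤ Real.cosh (2 * (x - x₀)) := by
          rw [← Real.cosh_abs, Real.cosh_eq]
          linarith [Real.exp_pos (-|2 * (x - x₀)|)]
      _ ≤ _ := le_add_of_nonneg_left (Real.cosh_pos _).le
  rw [lump, div_le_iff₀ (lump_denom_pos x₀ x)]
  calc Real.sinh (2 * a)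
      = 2 * Real.sinh (2 * a) * Real.exp (2 * |x₀|) * Real.exp (-(2 * |x|))
        * (Real.exp (2 * |x| - 2 * |x₀|) / 2) := by
        rw [Real.exp_sub, Real.exp_neg]
        field_simp
    _ ≤ _ := by gcongr

theorem isShortRange_lump (ha : 0 < a) : IsShortRange (lump a x₀) :=
  isShortRange_of_abs_le_exp (contDiff_lump x₀ (n := 0)).continuous two_pos fun x =>
    (abs_of_pos (lump_pos x₀ ha x)).trans_le (lump_le_exp x₀ ha x)

theorem isLocalized_lump (ha : 0 < a) : IsLocalized (lump a x₀) 0 := by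
  have htendsto : ∀ l : Filter ℝ, Tendsto (fun x : ℝ => |x|) l atTop →
      Tendsto (lump a x₀) l (𝓝 0) := fun l hl => by
    refine squeeze_zero (fun x => (lump_pos x₀ ha x).le) (lump_le_exp x₀ ha) ?_
    simpa using (Real.tendsto_exp_neg_atTop_nhds_zero.comp
      (hl.const_mul_atTop two_pos)).const_mul (2 * Real.sinh (2 * a) * Real.exp (2 * |x₀|))
  exact ⟨⟨x₀, (lump_pos x₀ ha x₀).ne'⟩, htendsto _ tendsto_abs_atBot_atTop,
    htendsto _ tendsto_abs_atTop_atTop⟩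

theorem memLp_deriv_lump (ha : 0 < a) : MemLp (deriv (lump a x₀)) 2 volume :=
  ((isShortRange_lump x₀ ha).of_abs_le ((contDiff_lump x₀ (n := 1)).continuous_deriv le_rfl)
    fun x => (abs_deriv_lump_le x₀ ha x).trans_eq
      (by rw [abs_of_pos (lump_pos x₀ ha x)])).memLp_two

theorem hasFiniteEnergy_lump (ha : 0 < a) : HasFiniteEnergy (quarticPotential a) (lump a x₀) := by
  refine (memLp_deriv_lump x₀ ha).integrable_sq.congr (.of_forall fun x => ?_)
  simp only [← half_deriv_lump_sq x₀ ha]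
  ring

variable (a) in
/-- The potential well `V''(φ(x)) - 4` of the linearization about the lump. -/
def lumpWell (x : ℝ) : ℝ :=
  (24 * lump a x₀ x - 24 * (Real.cosh (2 * a) / Real.sinh (2 * a))) * lump a x₀ x

theorem perturbationPotential_lump (ha : 0 < a) :
    perturbationPotential (quarticPotential a) (lump a x₀) = fun x => 4 + lumpWell a x₀ x :=
  funext fun _ => (hasDerivAt_deriv_quarticPotential ha _).deriv

theorem lumpOperator_eq (ha : 0 < a) :
    lumpOperator a x₀ = schrodinger fun x => (4 : ℝ) + lumpWell a x₀ x := by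
  rw [lumpOperator, perturbationPotential_lump x₀ ha]

theorem isShortRange_lumpWell (ha : 0 < a) : IsShortRange (lumpWell a x₀) :=
  (isShortRange_lump x₀ ha).comp_mul_self
    (P := fun u => 24 * u - 24 * (Real.cosh (2 * a) / Real.sinh (2 * a))) (by fun_prop)

theorem lumpWell_nonpos (ha : 0 < a) (x : ℝ) : lumpWell a x₀ x ≤ 0 :=
  mul_nonpos_of_nonpos_of_nonneg (by linarith [lump_le_coth x₀ ha x]) (lump_pos x₀ ha x).le

/-- Translating the lump does not change the equation, so differentiating `φ'' = V'(φ)` in `x`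
gives a zero mode. -/
theorem isBoundState_deriv_lump (ha : 0 < a) :
    IsBoundState (perturbationPotential (quarticPotential a) (lump a x₀)) 0
      (deriv (lump a x₀)) := by
  have hφ'' : deriv (deriv (lump a x₀)) = fun x => deriv (quarticPotential a) (lump a x₀ x) :=
    funext fun x => (hasDerivAt_deriv_lump x₀ ha x).deriv
  refine ⟨fun x => (hasDerivAt_deriv_lump x₀ ha x).differentiableAt, fun x => ?_,
    memLp_deriv_lump x₀ ha, ?_⟩
  · rw [hφ'', sub_zero, perturbationPotential_lump x₀ ha]
    exact (hasDerivAt_deriv_quarticPotential ha _).comp x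
      ((contDiff_lump x₀).differentiable one_ne_zero x).hasDerivAt
  · rw [hφ'', deriv_quarticPotential ha]
    exact ((isShortRange_lump x₀ ha).comp_mul_self (P := fun u =>
      8 * u ^ 2 - 12 * (Real.cosh (2 * a) / Real.sinh (2 * a)) * u + 4) (by fun_prop)).memLp_two

end Lump

/-! ### Instability of the lump -/

section Instability

variable {a : ℝ} (x₀ : ℝ)

theorem continuous_perturbationPotential_lump (ha : 0 < a) :
    Continuous (perturbationPotential (quarticPotential a) (lump a x₀)) := by
  rw [perturbationPotential_lump x₀ ha]
  exact continuous_const.add (isShortRange_lumpWell x₀ ha).continuous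

theorem exists_abs_perturbationPotential_lump_le (ha : 0 < a) :
    ∃ C, ∀ x, |perturbationPotential (quarticPotential a) (lump a x₀) x| ≤ C := by
  obtain ⟨C, hC⟩ := (isShortRange_lumpWell x₀ ha).exists_bound
  rw [perturbationPotential_lump x₀ ha]
  exact ⟨|4| + C, fun x => (abs_add_le _ _).trans (add_le_add_right (hC x) _)⟩

theorem isEigenfunction_lumpOperator (ha : 0 < a) {l : ℝ} {η : ℝ → ℝ}
    (hη : IsBoundState (perturbationPotential (quarticPotential a) (lump a x₀)) l η)
    (h0 : η ≠ 0) : IsEigenfunction (lumpOperator a x₀) l η :=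
  hη.isEigenfunction (continuous_perturbationPotential_lump x₀ ha)
    (exists_abs_perturbationPotential_lump_le x₀ ha) h0

theorem isEigenfunction_deriv_lump (ha : 0 < a) :
    IsEigenfunction (lumpOperator a x₀) 0 (deriv (lump a x₀)) :=
  isEigenfunction_lumpOperator x₀ ha (isBoundState_deriv_lump x₀ ha) fun h =>
    add_ne_left.2 one_ne_zero ((deriv_lump_eq_zero_iff x₀ ha (x₀ + 1)).1 (congrFun h _))

/-- The zero mode `φ'` has a node, so it is not the ground state, which must therefore lie below
zero. -/
theorem exists_isBoundState_lump (ha : 0 < a) : ∃ l < 0,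
    (∀ z ∈ spectrum (lumpOperator a x₀), z.im = 0 ∧ l ≤ z.re) ∧
    ∃ η, IsBoundState (perturbationPotential (quarticPotential a) (lump a x₀)) l η ∧
      ∀ x, 0 < η x := by
  have hW := isShortRange_lumpWell x₀ ha
  obtain ⟨C, hC⟩ := hW.exists_bound
  have hζ := isEigenfunction_deriv_lump x₀ ha
  rw [lumpOperator_eq x₀ ha] at hζ ⊢
  rw [perturbationPotential_lump x₀ ha]
  exact exists_pos_isBoundState_of_apply_eq_zero hW.continuous hW.memLp_two
    (lumpWell_nonpos x₀ ha) hC four_pos hζ ((contDiff_lump x₀ (n := 1)).continuous_deriv le_rfl)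
    ((deriv_lump_eq_zero_iff x₀ ha x₀).2 rfl)

theorem exists_even_isBoundState_lump (ha : 0 < a) : ∃ l < 0,
    (∀ z ∈ spectrum (lumpOperator a x₀), z.im = 0 ∧ l ≤ z.re) ∧
    ∃ η, IsBoundState (perturbationPotential (quarticPotential a) (lump a x₀)) l η ∧
      (∀ x, 0 < η x) ∧ ∀ s, η (x₀ - s) = η (x₀ + s) := by
  obtain ⟨l, hl, hmin, η, hη, hpos⟩ := exists_isBoundState_lump x₀ ha
  have hreflect : ∀ x, perturbationPotential (quarticPotential a) (lump a x₀) (2 * x₀ - x)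
      = perturbationPotential (quarticPotential a) (lump a x₀) x := fun x => by
    rw [perturbationPotential, perturbationPotential, lump_reflect]
  refine ⟨l, hl, hmin, _, hη.add (hη.comp_const_sub hreflect),
    fun x => add_pos (hpos x) (hpos _), fun s => ?_⟩
  have hplus : 2 * x₀ - (x₀ - s) = x₀ + s := by ring
  have hminus : 2 * x₀ - (x₀ + s) = x₀ - s := by ring
  simp only [Pi.add_apply, hplus, hminus, add_comm]

theorem mem_discreteSpectrum_lumpOperator (ha : 0 < a) {l : ℝ} {η : ℝ → ℝ} (hl : l < 4)
    (hη : IsEigenfunction (lumpOperator a x₀) l η) :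
    (l : ℂ) ∈ discreteSpectrum (lumpOperator a x₀) := by
  have hW := isShortRange_lumpWell x₀ ha
  rw [lumpOperator_eq x₀ ha] at hη ⊢
  refine mem_discreteSpectrum_of_isEigenvalue hW.memLp_top hW.memLp_two ?_ ?_
  · rintro ⟨r, hr, hrl⟩
    exact hl.not_ge ((Complex.ofReal_injective hrl) ▸ hr)
  · obtain ⟨u, hu0, -, hu⟩ := isEigenfunction_schrodinger_iff.1 hη
    exact ⟨u, hu0, hu⟩

theorem exists_lump_ground_state (ha : 0 < a) :
    ∃ (l : ℝ) (η : ℝ → ℝ), l < 0 ∧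
      (l : ℂ) ∈ discreteSpectrum (lumpOperator a x₀) ∧
      (∀ z ∈ spectrum (lumpOperator a x₀), z.im = 0 ∧ l ≤ z.re) ∧
      IsEigenfunction (lumpOperator a x₀) l η ∧ (∀ x, η x ≠ 0) ∧
      (∀ s, η (x₀ - s) = η (x₀ + s)) ∧
      IsGrowingMode (quarticPotential a) (lump a x₀) (Real.sqrt (-l)) η := by
  obtain ⟨l, hl, hmin, η, hη, hpos, heven⟩ := exists_even_isBoundState_lump x₀ ha
  have h0 : η ≠ 0 := fun h => (hpos 0).ne' (congrFun h 0)
  have heig := isEigenfunction_lumpOperator x₀ ha hη h0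
  exact ⟨l, η, hl, mem_discreteSpectrum_lumpOperator x₀ ha (hl.trans four_pos) heig, hmin, heig,
    fun x => (hpos x).ne', heven,
    hη.isGrowingMode (continuous_perturbationPotential_lump x₀ ha) h0 hl⟩

theorem isSphaleron_lump (ha : 0 < a) : IsSphaleron (quarticPotential a) (lump a x₀) 0 where
  static := isStaticSolution_lump x₀ ha
  falseVacuum := isFalseVacuum_quarticPotential ha
  localized := isLocalized_lump x₀ ha
  finiteEnergy := hasFiniteEnergy_lump x₀ ha
  unstable := by
    obtain ⟨l, η, -, -, -, -, -, -, h⟩ := exists_lump_ground_state x₀ ha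
    exact ⟨_, η, h⟩

end Instability

end Sphaleron

end

theorem mainTheorem3 (a x₀ : ℝ) (ha : 0 < a) :
    -- the continuous spectrum and the essential spectrum are `[4, ∞)`
    Sphaleron.continuousSpectrum (Sphaleron.lumpOperator a x₀)
        = (fun r : ℝ => (r : ℂ)) '' Set.Ici 4 ∧
    Sphaleron.essentialSpectrum (Sphaleron.lumpOperator a x₀)
        = (fun r : ℝ => (r : ℂ)) '' Set.Ici 4 ∧
    -- the derivative of the lump is a zero mode with exactly one node
    Sphaleron.IsEigenfunction (Sphaleron.lumpOperator a x₀) 0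
        (deriv (Sphaleron.lump a x₀)) ∧
    {x : ℝ | deriv (Sphaleron.lump a x₀) x = 0} = {x₀} ∧
    -- the lowest point of the spectrum is a negative eigenvalue in the discrete spectrum, with a
    -- nodeless even eigenfunction, which gives a growing mode of the linearized equation
    (∃ (l : ℝ) (η : ℝ → ℝ), l < 0 ∧
      (l : ℂ) ∈ Sphaleron.discreteSpectrum (Sphaleron.lumpOperator a x₀) ∧
      (∀ z ∈ Sphaleron.spectrum (Sphaleron.lumpOperator a x₀), z.im = 0 ∧ l ≤ z.re) ∧
      Sphaleron.IsEigenfunction (Sphaleron.lumpOperator a x₀) l η ∧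
      (∀ x, η x ≠ 0) ∧
      (∀ s, η (x₀ - s) = η (x₀ + s)) ∧
      Sphaleron.IsGrowingMode (Sphaleron.quarticPotential a) (Sphaleron.lump a x₀)
        (Real.sqrt (-l)) η) ∧
    -- the lump is a sphaleron, in particular linearly unstable
    Sphaleron.IsSphaleron (Sphaleron.quarticPotential a) (Sphaleron.lump a x₀) 0 := by
  have hW := Sphaleron.isShortRange_lumpWell x₀ ha
  have hH := Sphaleron.lumpOperator_eq x₀ ha
  exact ⟨hH ▸ Sphaleron.continuousSpectrum_eq hW, hH ▸ Sphaleron.essentialSpectrum_eq hW,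
    Sphaleron.isEigenfunction_deriv_lump x₀ ha, Set.ext (Sphaleron.deriv_lump_eq_zero_iff x₀ ha),
    Sphaleron.exists_lump_ground_state x₀ ha, Sphaleron.isSphaleron_lump x₀ ha⟩
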